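/- **Setting.** Let $k=\ell+r$. For $1\le i\le k$ let $G_i\subset\mathbb R$ be a Borel set and $P_i(\cdot\mid s)$, $s\in G_i$, probability laws on $\mathbb R$ with cdf $F_{i,s}$, such that $s\mapsto F_{i,s}(y)$ is continuous on $G_i$ for every $y$. For $i\le \ell$ (continuous components) $F_{i,s}$ is a $C^1$-diffeomorphism of $\mathbb R$ onto $(0,1)$ with derivative $p_i(\cdot\mid s)$; for $i>\ell$ (discrete components) $P_i(\cdot\mid s)$ is carried by $\{0,1\}$ (binary) or by $\mathbb N=\{0,1,\dots\}$ (count), with $p_i(y\mid s)=P_i(\{y\}\mid s)$. Write $F^{-1}(u)=\inf\{x:F(x)\ge u\}$, let $\Phi$ be the standard Gaussian cdf, and for an invertible $k\times k$ correlation matrix $R$ let $$c_R(u)=\frac1{\sqrt{\det R}}\exp\Big(-\tfrac12\,\Phi^{-1}(u)'(R^{-1}-I)\Phi^{-1}(u)\Big),\qquad u\in(0,1)^k,$$ with $\Phi^{-1}(u)=(\Phi^{-1}(u_1),\dots,\Phi^{-1}(u_k))$, and let $C_R(du)=c_R(u)\,du$ be the Gaussian copula. For $s\in G_1\times\cdots\times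 G_k$ put $$p_R(y\mid s)=\prod_{i=1}^{\ell}p_i(y_i\mid s_i)\int_{F_{\ell+1,s_{\ell+1}}(y_{\ell+1}^-)}^{F_{\ell+1,s_{\ell+1}}(y_{\ell+1})}\!\!\cdots\int_{F_{k,s_k}(y_k^-)}^{F_{k,s_k}(y_k)}c_R\big(F_{1,s_1}(y_1),\dots,F_{\ell,s_\ell}(y_\ell),u_{\ell+1},\dots,u_k\big)\,du_{\ell+1}\cdots du_k .$$ Let $\Theta\subset\mathbb R^Q$ be compact, let $\Gamma$ be a compact set of invertible $k\times k$ correlation matrices, $\theta_0\in\Theta$ and $R_0\in\Gamma$. Let $((U_t,X_t))_{t\in\mathbb Z}$ be a stationary ergodic process with values in $[0,1]^k\times\mathbb R^m$, $\mathcal F_t=\sigma((U_s,X_s):s\le t)$, with $U_t\sim C_{R_0}$ independent of $\mathcal F_{t-1}$. Let $Y_t\in\mathbb R^k$ and $\lambda_t(\theta)\in G_1\times\cdots\times G_k$ ($t\in\mathbb Z$, $\theta\in\Theta$) satisfy almost surely $$Y_{i,t}=F^{-1}_{i,\lambda_{i,t}(\theta_0)}(U_{i,t}),\qquad \lambda_t(\theta)=g_\theta(\lambda_{t-1}(\theta),Y_{t-1},X_{t-1}),$$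 where $\lambda_t(\theta_0)$ is $\mathcal F_{t-1}$-measurable, the process $(Y_t,(\lambda_t(\theta))_{\theta\in\Theta},X_t)_{t\in\mathbb Z}$ is stationary and ergodic, and almost surely $\theta\mapsto\lambda_t(\theta)$ is continuous on $\Theta$. **Assumptions** (with $-\log 0=+\infty$). * (G1) Each discrete component is binary or count; for each count component $i$ and $s\in G_i$, $p_i(y\mid s)>0$ for all $y\in\mathbb N$, $\sum_{y\in\mathbb N}\log(1-F_{i,s}(y))\,p_i(y\mid s)>-\infty$ and $\sum_{y\in\mathbb N}\log(p_i(y\mid s))\,p_i(y\mid s)>-\infty$. * (G2) For $1\le i\le\ell$, $\ \mathbb E\big[\sup_{\theta\in\Theta}\{-\log F_{i,\lambda_{i,0}(\theta)}(Y_{i,0})\}+\sup_{\theta\in\Theta}\{-\log(1-F_{i,\lambda_{i,0}(\theta)}(Y_{i,0}))\}\big]<\infty$. * (G3) For $\ell<i\le k$, $\ \mathbb E\big[\sup_{\theta\in\Theta}\{-\log p_i(0\mid\lambda_{i,0}(\theta))\}+\sup_{\theta\in\Theta}\{-\log(1-p_i(0\mid\lambda_{i,0}(\theta)))\}\big]<\infty$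 and $\mathbb E\big[\sup_{\theta\in\Theta}\{-\log p_i(Y_{i,0}\mid\lambda_{i,0}(\theta))\}\big]<\infty$; for count components also $\mathbb E\big[\sup_{\theta\in\Theta}\{-\log(1-F_{i,\lambda_{i,0}(\theta)}(Y_{i,0}))\}\big]<\infty$. **Theorem.** Assume (G1)–(G3). Let $\hat\theta_n$ be $\Theta$-valued with $\hat\theta_n\to\theta_0$ almost surely, and let $\hat R_n$ be, for $n\ge1$, a maximizer over $R\in\Gamma$ of $$\frac1n\sum_{t=1}^n\log p_R\big(Y_t\mid\lambda_t(\hat\theta_n)\big).$$ Then $\hat R_n\to R_0$ almost surely. -/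

import Mathlib

open MeasureTheory ProbabilityTheory Set Filter Topology
open scoped ENNReal Matrix

noncomputable section

namespace MixedCopula

/-- The components of the multivariate series: `ℓ` continuous components followed by `r`
discrete (binary or count) components, so that the dimension is `k = ℓ + r`. -/
abbrev Idx (ℓ r : ℕ) : Type := Fin ℓ ⊕ Fin r

/-! ### Quantile functions and the Gaussian copula -/

/-- The quantile function `u ↦ inf {x : F(x) ≥ u}` of a law `ν` on the line (used for
`0 < u < 1`), where `F(x) = ν (-∞, x]`. -/
def quantile (ν : Measure ℝ) (u : ℝ) : ℝ := sInf {x : ℝ | u ≤ ν.real (Iic x)}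

/-- `Φ⁻¹`, the quantile function of the standard Gaussian law. -/
def probit (u : ℝ) : ℝ := quantile (gaussianReal 0 1) u

/-- Invertible correlation matrices. -/
def IsCorrelation {ι : Type*} [Fintype ι] (R : Matrix ι ι ℝ) : Prop :=
  R.PosDef ∧ ∀ i, R i i = 1

/-- The Gaussian copula density
`c_R(u) = det(R)^{-1/2} exp(-½ Φ⁻¹(u)ᵀ (R⁻¹ - I) Φ⁻¹(u))`. -/
def gaussianCopulaDensity {ι : Type*} [Fintype ι] [DecidableEq ι] (R : Matrix ι ι ℝ)
    (u : ι → ℝ) : ℝ :=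
  (Real.sqrt R.det)⁻¹ *
    Real.exp (-(1 / 2) *
      ((fun i => probit (u i)) ⬝ᵥ ((R⁻¹ - 1) *ᵥ fun i => probit (u i))))

/-- The Gaussian copula `C_R(du) = c_R(u) du` on the unit cube. -/
def gaussianCopula {ι : Type*} [Fintype ι] [DecidableEq ι] (R : Matrix ι ι ℝ) :
    Measure (ι → ℝ) :=
  ((volume : Measure (ι → ℝ)).restrict (Set.pi univ fun _ => Icc (0 : ℝ) 1)).withDensity
    fun u => ENNReal.ofReal (gaussianCopulaDensity R u)

/-! ### Univariate marginal families -/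

/-- The marginal families `P_i(· | s)`, `s ∈ G_i`, as laws on the real line (binary and count
values are the real numbers `0, 1` and `0, 1, 2, …`). The discrete components in `count` are the
count ones, the other discrete components are the binary ones. -/
structure Margins (ℓ r : ℕ) where
  /-- the range `G_i` of the parameter of the `i`-th family -/
  G : Idx ℓ r → Set ℝ
  /-- the law `P_i(· | s)` -/
  law : Idx ℓ r → ℝ → Measure ℝ
  /-- the discrete components that are counts -/
  count : Set (Fin r)

namespace Margins

variable {ℓ r : ℕ} (M : Margins ℓ r)

/-- The cdf `F_{i,s}(y)`. -/
def F (i : Idx ℓ r) (s y : ℝ) : ℝ := (M.law i s).real (Iic y)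

/-- The left limit `F_{i,s}(y⁻)` of the cdf. -/
def FLeft (i : Idx ℓ r) (s y : ℝ) : ℝ := (M.law i s).real (Iio y)

/-- The density `p_i(y | s)` of a continuous component with respect to Lebesgue measure. -/
def pCont (i : Fin ℓ) (s y : ℝ) : ℝ := deriv (M.F (Sum.inl i) s) y

/-- The density `p_j(y | s)` of a discrete component with respect to counting measure. -/
def pDisc (j : Fin r) (s y : ℝ) : ℝ := (M.law (Sum.inr j) s).real {y}

/-- The conventions on the marginal families: the cdf of a continuous component is a
diffeomorphism from `ℝ` onto `(0,1)`, that is, it is `C¹` with a positive derivative; the discrete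
components live on `{0,1}` or on `ℕ`; the cdfs depend continuously on the parameter. -/
structure Valid : Prop where
  measurableSet_G : ∀ i, MeasurableSet (M.G i)
  isProbabilityMeasure : ∀ i, ∀ s ∈ M.G i, IsProbabilityMeasure (M.law i s)
  contDiff : ∀ i : Fin ℓ, ∀ s ∈ M.G (Sum.inl i), ContDiff ℝ 1 (M.F (Sum.inl i) s)
  pCont_pos : ∀ i : Fin ℓ, ∀ s ∈ M.G (Sum.inl i), ∀ y : ℝ, 0 < M.pCont i s y
  binary_support : ∀ j : Fin r, j ∉ M.count → ∀ s ∈ M.G (Sum.inr j),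
    M.law (Sum.inr j) s ({0, 1} : Set ℝ)ᶜ = 0
  count_support : ∀ j ∈ M.count, ∀ s ∈ M.G (Sum.inr j),
    M.law (Sum.inr j) s (range (Nat.cast : ℕ → ℝ))ᶜ = 0
  continuousOn_F : ∀ i, ∀ y : ℝ, ContinuousOn (fun s => M.F i s y) (M.G i)

/-- The conditional density `p_R(y | s)` of the model with Gaussian copula parameter `R`:
`∏_{i ≤ ℓ} p_i(y_i | s_i)` times the integral of `c_R(F_{1,s_1}(y_1), …, F_{ℓ,s_ℓ}(y_ℓ), v)` over
the discrete coordinates `v`, where `v_j` runs from `F_{j,s_j}(y_j⁻)` to `F_{j,s_j}(y_j)`. -/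
def jointDensity (R : Matrix (Idx ℓ r) (Idx ℓ r) ℝ) (s y : Idx ℓ r → ℝ) : ℝ :=
  (∏ i : Fin ℓ, M.pCont i (s (Sum.inl i)) (y (Sum.inl i))) *
    ∫ v in Set.pi univ fun j : Fin r =>
        Ioc (M.FLeft (Sum.inr j) (s (Sum.inr j)) (y (Sum.inr j)))
          (M.F (Sum.inr j) (s (Sum.inr j)) (y (Sum.inr j))),
      gaussianCopulaDensity R
        (Sum.elim (fun i : Fin ℓ => M.F (Sum.inl i) (s (Sum.inl i)) (y (Sum.inl i))) v)

end Margins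

/-! ### Stationary ergodic processes and the observation-driven model -/

/-- The process `(Z_t)_{t ∈ ℤ}` is (strictly) stationary and ergodic: the shift of the path space
preserves the law of the process and is ergodic for it. -/
def IsStationaryErgodic {Ω S : Type*} [MeasurableSpace Ω] [MeasurableSpace S]
    (P : Measure Ω) (Z : ℤ → Ω → S) : Prop :=
  (∀ t, Measurable (Z t)) ∧
    Ergodic (fun (z : ℤ → S) (t : ℤ) => z (t + 1)) (P.map fun ω t => Z t ω)

/-- The sigma-field `ℱ_t` generated by `(U_s, X_s)`, `s ≤ t`. -/
@[reducible] def past {Ω A B : Type*} [MeasurableSpace A] [MeasurableSpace B]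
    (U : ℤ → Ω → A) (X : ℤ → Ω → B) (t : ℤ) : MeasurableSpace Ω :=
  ⨆ s : ℤ, ⨆ _ : s ≤ t, MeasurableSpace.comap (fun ω => (U s ω, X s ω)) inferInstance

/-- `U`, `X`, `Y` and `(lam · θ)_{θ ∈ Θ}` form the multivariate mixed-data observation-driven model
with marginal families `M`, dynamics `g`, parameter space `Θ`, true dynamic parameter `θ₀` and a
Gaussian copula with correlation matrix `R₀`. -/
structure IsModel {Ω : Type*} [MeasurableSpace Ω] (P : Measure Ω) {ℓ r m Q : ℕ}
    (M : Margins ℓ r)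
    (g : EuclideanSpace ℝ (Fin Q) → (Idx ℓ r → ℝ) → (Idx ℓ r → ℝ) → (Fin m → ℝ) →
      (Idx ℓ r → ℝ))
    (Θ : Set (EuclideanSpace ℝ (Fin Q))) (θ₀ : EuclideanSpace ℝ (Fin Q))
    (R₀ : Matrix (Idx ℓ r) (Idx ℓ r) ℝ)
    (U : ℤ → Ω → (Idx ℓ r → ℝ)) (X : ℤ → Ω → (Fin m → ℝ)) (Y : ℤ → Ω → (Idx ℓ r → ℝ))
    (lam : ℤ → EuclideanSpace ℝ (Fin Q) → Ω → (Idx ℓ r → ℝ)) : Prop where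
  /-- `((U_t, X_t))_t` is stationary and ergodic -/
  noise_ergodic : IsStationaryErgodic P fun t ω => (U t ω, X t ω)
  /-- `U_t` is independent of `ℱ_{t-1}` -/
  noise_indep : ∀ t, Indep (MeasurableSpace.comap (U t) inferInstance) (past U X (t - 1)) P
  /-- `U_t` is distributed according to the Gaussian copula with parameter `R₀` -/
  noise_law : ∀ t, P.map (U t) = gaussianCopula R₀
  /-- `Y_{i,t} = F_{i,λ_{i,t}}⁻¹(U_{i,t})` with `λ_t = λ_t(θ₀)` -/
  observation : ∀ t, ∀ᵐ ω ∂P, ∀ i, Y t ω i = quantile (M.law i (lam t θ₀ ω i)) (U t ω i)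
  /-- `λ_t(θ) = g_θ(λ_{t-1}(θ), Y_{t-1}, X_{t-1})` -/
  recursion : ∀ t, ∀ θ ∈ Θ, ∀ᵐ ω ∂P,
    lam t θ ω = g θ (lam (t - 1) θ ω) (Y (t - 1) ω) (X (t - 1) ω)
  /-- `λ_t(θ)` takes its values in `G_1 × ⋯ × G_k` -/
  lam_mem : ∀ t, ∀ᵐ ω ∂P, ∀ θ ∈ Θ, ∀ i, lam t θ ω i ∈ M.G i
  /-- the latent process is non-anticipative -/
  adapted : ∀ t, Measurable[past U X (t - 1)] (lam t θ₀)
  /-- the process `((Y_t, (λ_t(θ))_{θ ∈ Θ}, X_t))_t` is stationary and ergodic -/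
  solution_ergodic :
    IsStationaryErgodic P fun t ω => (Y t ω, fun θ : Θ => lam t θ ω, X t ω)
  /-- `θ ↦ λ_t(θ)` is almost surely continuous -/
  continuousOn_lam : ∀ t, ∀ᵐ ω ∂P, ContinuousOn (fun θ => lam t θ ω) Θ

/-! ### The integrability assumptions -/

/-- `-log x` for `0 ≤ x ≤ 1`, with `-log 0 = ∞`. -/
def negLog (x : ℝ) : ℝ≥0∞ := if x ≤ 0 then ⊤ else ENNReal.ofReal (-Real.log x)

/-- Count components have full support on `ℕ`, with `∑ log(1 - F(y)) p(y)` and `∑ log(p(y)) p(y)`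
(all terms of which are nonpositive) finite. The discrete components being binary or count is part
of `Margins.Valid`. -/
def AssumptionG1 {ℓ r : ℕ} (M : Margins ℓ r) : Prop :=
  ∀ j ∈ M.count, ∀ s ∈ M.G (Sum.inr j),
    (∀ y : ℕ, 0 < M.pDisc j s y) ∧
    (Summable fun y : ℕ => Real.log (1 - M.F (Sum.inr j) s y) * M.pDisc j s y) ∧
    (Summable fun y : ℕ => Real.log (M.pDisc j s y) * M.pDisc j s y)

/-- The integrability condition on the continuous components; `Y₀` and `lam₀` are `Y_0` and
`θ ↦ λ_0(θ)`. -/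
def AssumptionG2 {Ω : Type*} [MeasurableSpace Ω] (P : Measure Ω) {ℓ r Q : ℕ}
    (M : Margins ℓ r) (Θ : Set (EuclideanSpace ℝ (Fin Q)))
    (Y₀ : Ω → (Idx ℓ r → ℝ)) (lam₀ : EuclideanSpace ℝ (Fin Q) → Ω → (Idx ℓ r → ℝ)) : Prop :=
  ∀ i : Fin ℓ,
    ∫⁻ ω, ((⨆ θ ∈ Θ, negLog (M.F (Sum.inl i) (lam₀ θ ω (Sum.inl i)) (Y₀ ω (Sum.inl i)))) +
      ⨆ θ ∈ Θ, negLog (1 - M.F (Sum.inl i) (lam₀ θ ω (Sum.inl i)) (Y₀ ω (Sum.inl i)))) ∂P < ⊤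

/-- The integrability conditions on the discrete components; the third one is for count
components only. -/
def AssumptionG3 {Ω : Type*} [MeasurableSpace Ω] (P : Measure Ω) {ℓ r Q : ℕ}
    (M : Margins ℓ r) (Θ : Set (EuclideanSpace ℝ (Fin Q)))
    (Y₀ : Ω → (Idx ℓ r → ℝ)) (lam₀ : EuclideanSpace ℝ (Fin Q) → Ω → (Idx ℓ r → ℝ)) : Prop :=
  ∀ j : Fin r,
    ∫⁻ ω, ((⨆ θ ∈ Θ, negLog (M.pDisc j (lam₀ θ ω (Sum.inr j)) 0)) +
      ⨆ θ ∈ Θ, negLog (1 - M.pDisc j (lam₀ θ ω (Sum.inr j)) 0)) ∂P < ⊤ ∧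
    ∫⁻ ω, (⨆ θ ∈ Θ, negLog (M.pDisc j (lam₀ θ ω (Sum.inr j)) (Y₀ ω (Sum.inr j)))) ∂P < ⊤ ∧
    (j ∈ M.count →
      ∫⁻ ω, (⨆ θ ∈ Θ,
        negLog (1 - M.F (Sum.inr j) (lam₀ θ ω (Sum.inr j)) (Y₀ ω (Sum.inr j)))) ∂P < ⊤)

/-! ### The likelihood -/

/-- The normalized conditional log-likelihood `n⁻¹ ∑_{t=1}^n log p_R(Y_t | λ_t(θ))` along one
trajectory; `y t` stands for `Y_t` and `lam t θ` for `λ_t(θ)`. -/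
def avgLogLik {ℓ r Q : ℕ} (M : Margins ℓ r) (y : ℤ → (Idx ℓ r → ℝ))
    (lam : ℤ → EuclideanSpace ℝ (Fin Q) → (Idx ℓ r → ℝ)) (n : ℕ)
    (θ : EuclideanSpace ℝ (Fin Q)) (R : Matrix (Idx ℓ r) (Idx ℓ r) ℝ) : ℝ :=
  (n : ℝ)⁻¹ * ∑ t ∈ Finset.Icc 1 n, Real.log (M.jointDensity R (lam (t : ℤ) θ) (y (t : ℤ)))

end MixedCopula

end

open MixedCopula

/-! The marginal densities of the continuous components do not involve `R`, so for fixed θ two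
likelihoods differ only through the box integrals of the copula densities. Let q(θ, R) be the
resulting log-ratio of `R` against `R₀` at time 0 (`logRatio`). Since `R̂ₙ` maximizes over a set
containing `R₀`, the sums of q at `(θ̂ₙ, R̂ₙ)` are nonnegative. A Wald argument
(`ae_mapClusterPt_integral_nonneg`) then shows that almost surely E q ≥ 0 at every cluster point of
`(θ̂ₙ, R̂ₙ)`. Such a point has first coordinate `θ₀`, so by compactness it remains to prove E q(θ₀,
R) < 0 for `R ≠ R₀`.

Strict negativity (`integral_logRatio_neg`) is Gibbs' inequality. Given `λ₀(θ₀)`, which is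
independent of `U₀`, exp q is the density ratio of two discretized copulas and has mean one; as exp
x ≥ 1 + x with equality only at 0, E q = 0 forces the ratio to be one. The copulas of `R` and `R₀`
then give the same mass to each {u_i ≤ x_i, u_j ≤ x_j}, where x_i = 1/2 for a continuous component
and x_i = F_i(0) ∈ (0,1) for a discrete one. A bivariate Gaussian cdf is strictly increasing in the
correlation (`bivariateGaussian_real_Iic_prod_lt`), so one value per pair determines `R`.

The Wald argument needs an integrable envelope for q, uniform in θ and `R`. On the compact set Γ the
Gaussian density ratio lies between exp(-C - C|z|²) and exp(C + η|z|²) with η < 1/2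
(`exists_ratioBounds`); the upper bound is integrable against the standard Gaussian law. With
Φ⁻¹(u)² ≤ -2 log u - 2 log(1-u), this bounds the absolute log of a box integral by the logarithmic
terms of the assumptions (`exists_abs_log_boxIntegral_le`).

The only ergodic input is one-sided: an integrable function with negative mean has eventually
negative Birkhoff sums (`ae_eventually_birkhoffSum_neg`), proved with running maxima. -/

namespace MixedCopula

/-! ### A one-sided pointwise ergodic theorem -/

section Ergodic

variable {α : Type*}

/-- The running maximum `max (0, S_1, …, S_n)` of the Birkhoff sums of `f` along `T`. -/
noncomputable def birkhoffMax (T : α → α) (f : α → ℝ) : ℕ → α → ℝ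
  | 0, _ => 0
  | n + 1, x => max 0 (f x + birkhoffMax T f n (T x))

lemma birkhoffMax_nonneg (T : α → α) (f : α → ℝ) (n : ℕ) (x : α) : 0 ≤ birkhoffMax T f n x := by
  cases n with
  | zero => exact le_rfl
  | succ n => exact le_max_left _ _

lemma birkhoffMax_le_succ (T : α → α) (f : α → ℝ) (n : ℕ) (x : α) :
    birkhoffMax T f n x ≤ birkhoffMax T f (n + 1) x := by
  induction n generalizing x with
  | zero => exact birkhoffMax_nonneg _ _ _ _
  | succ n ih =>
    rw [birkhoffMax, birkhoffMax]
    exact max_le_max le_rfl (by linarith [ih (T x)])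

lemma birkhoffMax_mono (T : α → α) (f : α → ℝ) (x : α) : Monotone fun n => birkhoffMax T f n x :=
  monotone_nat_of_le_succ fun n => birkhoffMax_le_succ T f n x

lemma birkhoffSum_le_birkhoffMax (T : α → α) (f : α → ℝ) (n : ℕ) (x : α) :
    birkhoffSum T f n x ≤ birkhoffMax T f n x := by
  induction n generalizing x with
  | zero => simp [birkhoffSum, birkhoffMax]
  | succ n ih =>
    rw [birkhoffSum_succ', birkhoffMax]
    exact le_max_of_le_right (by linarith [ih (T x)])

/-- The recursion relates the maxima at `x` and `T x` by a shift of `f x`. Thus boundedness of the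
maxima is a strictly invariant event, to which ergodicity applies. -/
lemma bddAbove_birkhoffMax_iff (T : α → α) (f : α → ℝ) (x : α) :
    BddAbove (range fun n => birkhoffMax T f n (T x)) ↔
      BddAbove (range fun n => birkhoffMax T f n x) := by
  constructor
  · rintro ⟨C, hC⟩
    refine ⟨max 0 (f x + C), ?_⟩
    rintro _ ⟨n, rfl⟩
    refine (birkhoffMax_le_succ T f n x).trans ?_
    rw [birkhoffMax]
    have := hC ⟨n, rfl⟩
    exact max_le_max le_rfl (by simpa using this)
  · rintro ⟨C, hC⟩
    refine ⟨C - f x, ?_⟩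
    rintro _ ⟨n, rfl⟩
    have h : birkhoffMax T f (n + 1) x ≤ C := hC ⟨n + 1, rfl⟩
    rw [birkhoffMax] at h
    have := (le_max_right _ _).trans h
    show birkhoffMax T f n (T x) ≤ C - f x
    linarith

/-- The difference is `f x` unless the maximum is truncated at 0; in that case the subtracted term
lies between 0 and `-f x`. This is the domination used in the next limit theorem. -/
lemma abs_birkhoffMax_succ_sub_le (T : α → α) (f : α → ℝ) (n : ℕ) (x : α) :
    |birkhoffMax T f (n + 1) x - birkhoffMax T f n (T x)| ≤ |f x| := by
  rw [birkhoffMax]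
  have h0 := birkhoffMax_nonneg T f n (T x)
  rcases le_total 0 (f x + birkhoffMax T f n (T x)) with h | h
  · rw [max_eq_right h]
    simp
  · rw [max_eq_left h, zero_sub, abs_neg, abs_of_nonneg h0, abs_of_nonpos (by linarith)]
    linarith

variable [MeasurableSpace α] {μ : Measure α}

lemma measurable_birkhoffMax {T : α → α} (hT : Measurable T) {f : α → ℝ} (hf : Measurable f)
    (n : ℕ) : Measurable (birkhoffMax T f n) := by
  induction n with
  | zero => exact measurable_const
  | succ n ih => exact measurable_const.max (hf.add (ih.comp hT))

lemma integrable_birkhoffMax {T : α → α} (hT : MeasurePreserving T μ μ) {f : α → ℝ}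
    (hfi : Integrable f μ) (n : ℕ) : Integrable (birkhoffMax T f n) μ := by
  induction n with
  | zero => exact integrable_zero _ _ _
  | succ n ih =>
    have h : Integrable (fun x => f x + birkhoffMax T f n (T x)) μ :=
      hfi.add (hT.integrable_comp_of_integrable ih)
    exact (integrable_zero α ℝ μ).sup h

/-- Otherwise the maxima Mₙ tend to infinity almost everywhere, so M_{n+1} - Mₙ ∘ T is eventually
`f` and, by domination, its integrals converge to ∫ f < 0. By invariance these integrals equal ∫
(M_{n+1} - Mₙ) ≥ 0. -/
lemma ae_bddAbove_birkhoffMax [IsProbabilityMeasure μ] {T : α → α} (hT : Ergodic T μ) {f : α → ℝ}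
    (hf : Measurable f) (hfi : Integrable f μ) (hneg : ∫ x, f x ∂μ < 0) :
    ∀ᵐ x ∂μ, BddAbove (range fun n => birkhoffMax T f n x) := by
  have hTm := hT.toMeasurePreserving
  have hms : MeasurableSet {x | BddAbove (range fun n => birkhoffMax T f n x)} :=
    measurableSet_bddAbove_range fun n => measurable_birkhoffMax hTm.measurable hf n
  rcases hT.toPreErgodic.ae_mem_or_ae_notMem hms
    (by ext x; exact bddAbove_birkhoffMax_iff T f x) with h | h
  · exact h
  exfalso
  have hlim : Tendsto (fun n => ∫ x, (birkhoffMax T f (n + 1) x - birkhoffMax T f n (T x)) ∂μ)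
      atTop (𝓝 (∫ x, f x ∂μ)) := by
    refine tendsto_integral_of_dominated_convergence (fun x => |f x|) ?_ hfi.abs ?_ ?_
    · intro n
      exact ((measurable_birkhoffMax hTm.measurable hf (n + 1)).sub
        ((measurable_birkhoffMax hTm.measurable hf n).comp hTm.measurable)).aestronglyMeasurable
    · intro n
      exact Eventually.of_forall fun x => abs_birkhoffMax_succ_sub_le T f n x
    · filter_upwards [h] with x hx
      have hx' : ¬ BddAbove (range fun n => birkhoffMax T f n (T x)) := by
        rw [bddAbove_birkhoffMax_iff]; exact hx
      have htop : Tendsto (fun n => birkhoffMax T f n (T x)) atTop atTop :=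
        tendsto_atTop_atTop_of_monotone' (birkhoffMax_mono T f (T x)) hx'
      refine tendsto_const_nhds.congr' ?_
      filter_upwards [htop.eventually_ge_atTop (-f x)] with n hn
      rw [birkhoffMax, max_eq_right (by linarith)]
      ring
  have hnn : ∀ n, 0 ≤ ∫ x, (birkhoffMax T f (n + 1) x - birkhoffMax T f n (T x)) ∂μ := by
    intro n
    have hmeas : ∀ n, AEStronglyMeasurable (birkhoffMax T f n) μ := fun n =>
      (measurable_birkhoffMax hTm.measurable hf n).aestronglyMeasurable
    have hint : Integrable (fun x => birkhoffMax T f n (T x)) μ :=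
      hTm.integrable_comp_of_integrable (integrable_birkhoffMax hTm hfi n)
    rw [integral_sub (integrable_birkhoffMax hTm hfi _) hint,
      ← integral_map hTm.aemeasurable (by rw [hTm.map_eq]; exact hmeas n), hTm.map_eq]
    exact sub_nonneg.2 (integral_mono (integrable_birkhoffMax hTm hfi _)
      (integrable_birkhoffMax hTm hfi _) fun x => birkhoffMax_le_succ T f n x)
  exact absurd (ge_of_tendsto' hlim hnn) (by linarith)

/-- If an integrable function has negative mean, then its Birkhoff sums along an ergodic
transformation are eventually negative. -/
theorem ae_eventually_birkhoffSum_neg [IsProbabilityMeasure μ] {T : α → α} (hT : Ergodic T μ)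
    {f : α → ℝ} (hf : Measurable f) (hfi : Integrable f μ) (hneg : ∫ x, f x ∂μ < 0) :
    ∀ᵐ x ∂μ, ∀ᶠ n in atTop, birkhoffSum T f n x < 0 := by
  -- Adding half the gap keeps the mean negative; a bound C on the sums of `f + ε` then gives Sₙ ≤ C
  -- - nε.
  set ε : ℝ := -(∫ x, f x ∂μ) / 2 with hε
  have hεpos : 0 < ε := by linarith
  have hint : ∫ x, (f x + ε) ∂μ < 0 := by
    rw [integral_add hfi (integrable_const _), integral_const]
    simp only [probReal_univ, smul_eq_mul, one_mul]
    linarith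
  filter_upwards [ae_bddAbove_birkhoffMax hT (hf.add_const ε) (hfi.add (integrable_const ε)) hint]
    with x hx
  obtain ⟨C, hC⟩ := hx
  obtain ⟨N, hN⟩ := exists_nat_gt (C / ε)
  filter_upwards [eventually_ge_atTop N] with n hn
  have h1 : birkhoffSum T (fun x => f x + ε) n x ≤ C :=
    (birkhoffSum_le_birkhoffMax T _ n x).trans (hC ⟨n, rfl⟩)
  have h2 : birkhoffSum T (fun x => f x + ε) n x = birkhoffSum T f n x + n * ε := by
    simp [birkhoffSum, Finset.sum_add_distrib]
  have h3 : C < n * ε := by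
    have : (N : ℝ) ≤ n := by exact_mod_cast hn
    rw [div_lt_iff₀ hεpos] at hN
    nlinarith
  linarith

end Ergodic

/-! ### Transfer from the shift on path space to processes indexed by ℤ -/

section StationaryProcess

variable {Ω S : Type*} [MeasurableSpace Ω] [MeasurableSpace S] {P : Measure Ω} {Z : ℤ → Ω → S}

lemma IsStationaryErgodic.measurable_path (hZ : IsStationaryErgodic P Z) :
    Measurable fun ω t => Z t ω := measurable_pi_iff.2 hZ.1

lemma IsStationaryErgodic.map_succ (hZ : IsStationaryErgodic P Z) (t : ℤ) :
    P.map (Z (t + 1)) = P.map (Z t) := by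
  have h1 : ∀ s : ℤ, P.map (Z s) = (P.map fun ω t => Z t ω).map (fun z => z s) := fun s => by
    rw [Measure.map_map (measurable_pi_apply s) hZ.measurable_path]
    rfl
  rw [h1 (t + 1), h1 t]
  conv_rhs => rw [← hZ.2.toMeasurePreserving.map_eq]
  rw [Measure.map_map (measurable_pi_apply t) hZ.2.toMeasurePreserving.measurable]
  rfl

lemma IsStationaryErgodic.map_eq (hZ : IsStationaryErgodic P Z) (t : ℤ) :
    P.map (Z t) = P.map (Z 0) := by
  induction t with
  | zero => rfl
  | succ n ih => rw [hZ.map_succ, ih]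
  | pred n ih =>
    rw [← ih, ← hZ.map_succ (-(n : ℤ) - 1)]
    congr 2
    ring

lemma IsStationaryErgodic.ae_of_ae_zero (hZ : IsStationaryErgodic P Z) {p : S → Prop}
    (hp : MeasurableSet {z | p z}) (h : ∀ᵐ ω ∂P, p (Z 0 ω)) (t : ℤ) : ∀ᵐ ω ∂P, p (Z t ω) := by
  rw [← ae_map_iff (hZ.1 0).aemeasurable hp] at h
  rw [← ae_map_iff (hZ.1 t).aemeasurable hp, hZ.map_eq t]
  exact h

lemma IsStationaryErgodic.ae_eventually_sum_neg [IsProbabilityMeasure P]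
    (hZ : IsStationaryErgodic P Z) {f : S → ℝ} (hf : Measurable f)
    (hfi : Integrable (fun ω => f (Z 0 ω)) P) (hneg : ∫ ω, f (Z 0 ω) ∂P < 0) :
    ∀ᵐ ω ∂P, ∀ᶠ n : ℕ in atTop, ∑ t ∈ Finset.Icc 1 n, f (Z (t : ℤ) ω) < 0 := by
  have hpath := hZ.measurable_path
  have : IsProbabilityMeasure (P.map fun ω t => Z t ω) :=
    Measure.isProbabilityMeasure_map hpath.aemeasurable
  have h01 : P.map (Z 1) = P.map (Z 0) := hZ.map_eq 1
  -- Reading coordinate 1 turns the Birkhoff sum over 0, …, n-1 into the sum over t = 1, …, n.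
  have hfm : Measurable fun z : ℤ → S => f (z 1) := hf.comp (measurable_pi_apply 1)
  have hi1 : Integrable (fun ω => f (Z 1 ω)) P := by
    have h0 : Integrable f (P.map (Z 0)) :=
      (integrable_map_measure hf.aestronglyMeasurable (hZ.1 0).aemeasurable).2 hfi
    rw [← h01] at h0
    exact (integrable_map_measure hf.aestronglyMeasurable (hZ.1 1).aemeasurable).1 h0
  have hI1 : ∫ ω, f (Z 1 ω) ∂P = ∫ ω, f (Z 0 ω) ∂P := by
    rw [← integral_map (hZ.1 1).aemeasurable hf.aestronglyMeasurable, h01,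
      integral_map (hZ.1 0).aemeasurable hf.aestronglyMeasurable]
  have key := ae_eventually_birkhoffSum_neg hZ.2 hfm
    ((integrable_map_measure hfm.aestronglyMeasurable hpath.aemeasurable).2 hi1)
    (by rw [integral_map hpath.aemeasurable hfm.aestronglyMeasurable, hI1]; exact hneg)
  have hiter : ∀ (k : ℕ) (z : ℤ → S) (t : ℤ),
      (fun (z : ℤ → S) (t : ℤ) => z (t + 1))^[k] z t = z (t + k) := by
    intro k
    induction k with
    | zero => intro z t; simp
    | succ k ih =>
      intro z t
      rw [Function.iterate_succ_apply, ih]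
      congr 1
      push_cast
      ring
  filter_upwards [ae_of_ae_map hpath.aemeasurable key] with ω hω
  filter_upwards [hω] with n hn
  refine lt_of_eq_of_lt ?_ hn
  rw [birkhoffSum, Finset.range_eq_Ico, Finset.sum_Ico_eq_sum_range]
  rw [← Finset.Ico_add_one_right_eq_Icc, Finset.sum_Ico_eq_sum_range]
  refine Finset.sum_congr (by simp) fun k _ => ?_
  rw [hiter]
  push_cast
  simp

end StationaryProcess

/-! ### Consistency of maximizers of random criteria -/

section Wald

variable {Ω S C : Type*} [MeasurableSpace Ω] [MeasurableSpace S] {P : Measure Ω}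
  [IsProbabilityMeasure P] {Z : ℤ → Ω → S} [TopologicalSpace C] [CompactSpace C]
  [SecondCountableTopology C] {q : S → C → ℝ} {env : Ω → ℝ≥0∞}

/-- The supremum of the criterion over a shrinking neighbourhood decreases to its value at `c`, so
by monotone convergence its mean is negative for a small neighbourhood, and the one-sided ergodic
theorem applies to it. Suprema run over a countable dense set for measurability; continuity makes
them bound the whole neighbourhood. -/
lemma exists_nhds_ae_eventually_sum_neg (hZ : IsStationaryErgodic P Z)
    (hqm : ∀ p, Measurable fun z => q z p) (hqc : ∀ t, ∀ᵐ ω ∂P, Continuous (q (Z t ω)))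
    (henv : ∀ᵐ ω ∂P, ∀ p, ‖q (Z 0 ω) p‖ₑ ≤ env ω) (henv_fin : ∫⁻ ω, env ω ∂P < ⊤)
    {c : C} (hc : ∫ ω, q (Z 0 ω) c ∂P < 0) :
    ∃ V ∈ 𝓝 c, ∀ᵐ ω ∂P, ∀ᶠ n : ℕ in atTop, ∀ p ∈ V,
      ∑ t ∈ Finset.Icc 1 n, q (Z (t : ℤ) ω) p < 0 := by
  obtain ⟨D, hDc, hDd⟩ := TopologicalSpace.exists_countable_dense C
  obtain ⟨V, hV, hVb⟩ := (nhds_basis_opens c).exists_antitone_subbasis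
  set φ : ℕ → S → ℝ := fun m z => ⨆ d : ↥(V m ∩ D), q z d with hφ
  have hcount : ∀ m, Countable ↥(V m ∩ D) := fun m => (hDc.mono inter_subset_right).to_subtype
  have hne : ∀ m, Nonempty ↥(V m ∩ D) := fun m =>
    (hDd.inter_open_nonempty (V m) (hV m).2 ⟨c, (hV m).1⟩).to_subtype
  have hφm : ∀ m, Measurable (φ m) := fun m => .iSup fun d => hqm d
  have hbdd : ∀ z, Continuous (q z) → ∀ m, BddAbove (range fun d : ↥(V m ∩ D) => q z d) := by
    intro z hz m
    refine (isCompact_range hz).bddAbove.mono ?_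
    rintro _ ⟨d, rfl⟩
    exact ⟨d, rfl⟩
  have hle : ∀ z, Continuous (q z) → ∀ m, ∀ p ∈ V m, q z p ≤ φ m z := by
    intro z hz m p hp
    have h1 : p ∈ closure (V m ∩ D) := hDd.open_subset_closure_inter (hV m).2 hp
    refine closure_minimal (t := {p | q z p ≤ φ m z}) ?_ (isClosed_le hz continuous_const) h1
    intro d hd
    exact le_ciSup (hbdd z hz m) (⟨d, hd⟩ : ↥(V m ∩ D))
  have hanti : ∀ z, Continuous (q z) → Antitone fun m => φ m z := by
    intro z hz m m' hmm
    exact ciSup_le fun d => hle z hz m d (hVb.antitone hmm d.2.1)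
  have hlim : ∀ z, Continuous (q z) → Tendsto (fun m => φ m z) atTop (𝓝 (q z c)) := by
    intro z hz
    refine tendsto_order.2 ⟨fun a ha => Eventually.of_forall fun m =>
      ha.trans_le (hle z hz m c (hV m).1), fun a ha => ?_⟩
    obtain ⟨b, hb1, hb2⟩ := exists_between ha
    have : {p | q z p < b} ∈ 𝓝 c := (isOpen_lt hz continuous_const).mem_nhds hb1
    obtain ⟨N, -, hN⟩ := hVb.toHasBasis.mem_iff.1 this
    filter_upwards [eventually_ge_atTop N] with m hm
    exact (ciSup_le fun d => (hN (hVb.antitone hm d.2.1)).le).trans_lt hb2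
  have hint : ∀ m, Integrable (fun ω => φ m (Z 0 ω)) P := by
    intro m
    refine ⟨((hφm m).comp (hZ.1 0)).aestronglyMeasurable, lt_of_le_of_lt ?_ henv_fin⟩
    refine lintegral_mono_ae ?_
    filter_upwards [henv, hqc 0] with ω h1 h2
    have hcl : IsClosed {x : ℝ | ‖x‖ₑ ≤ env ω} := isClosed_le continuous_enorm continuous_const
    -- The supremum is a limit of values of the criterion, so it satisfies the same closed bound.
    have hmem := csSup_mem_closure (range_nonempty _) (hbdd (Z 0 ω) h2 m)
    refine closure_minimal (t := {x : ℝ | ‖x‖ₑ ≤ env ω}) ?_ hcl hmem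
    rintro _ ⟨d, rfl⟩
    exact h1 d
  have hintc : Integrable (fun ω => q (Z 0 ω) c) P :=
    ⟨((hqm c).comp (hZ.1 0)).aestronglyMeasurable,
      lt_of_le_of_lt (lintegral_mono_ae (henv.mono fun ω h => h c)) henv_fin⟩
  have hI : Tendsto (fun m => ∫ ω, φ m (Z 0 ω) ∂P) atTop (𝓝 (∫ ω, q (Z 0 ω) c ∂P)) :=
    integral_tendsto_of_tendsto_of_antitone hint hintc
      ((hqc 0).mono fun ω h => hanti _ h) ((hqc 0).mono fun ω h => hlim _ h)
  obtain ⟨m, hm⟩ := (hI.eventually_lt_const hc).exists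
  refine ⟨V m, hVb.mem m, ?_⟩
  filter_upwards [hZ.ae_eventually_sum_neg (hφm m) (hint m) hm, ae_all_iff.2 hqc] with ω h1 h2
  filter_upwards [h1] with n hn p hp
  exact (Finset.sum_le_sum fun t _ => hle _ (h2 _) m p hp).trans_lt hn

/-- If along a random sequence the empirical means of a criterion are nonnegative, then the criterion
has a nonnegative expectation at all its cluster points. -/
theorem ae_mapClusterPt_integral_nonneg (hZ : IsStationaryErgodic P Z)
    (hqm : ∀ p, Measurable fun z => q z p) (hqc : ∀ t, ∀ᵐ ω ∂P, Continuous (q (Z t ω)))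
    (henv : ∀ᵐ ω ∂P, ∀ p, ‖q (Z 0 ω) p‖ₑ ≤ env ω) (henv_fin : ∫⁻ ω, env ω ∂P < ⊤)
    {p : ℕ → Ω → C}
    (hp : ∀ᵐ ω ∂P, ∀ n : ℕ, 1 ≤ n → 0 ≤ ∑ t ∈ Finset.Icc 1 n, q (Z (t : ℤ) ω) (p n ω)) :
    ∀ᵐ ω ∂P, ∀ c, MapClusterPt c atTop (fun n => p n ω) → 0 ≤ ∫ ω, q (Z 0 ω) c ∂P := by
  choose! V hV hVae using fun c (hc : ∫ ω, q (Z 0 ω) c ∂P < 0) =>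
    exists_nhds_ae_eventually_sum_neg hZ hqm hqc henv henv_fin hc
  -- By the Lindelöf property countably many of these neighbourhoods suffice, so a single null set
  -- serves all points with negative mean.
  obtain ⟨T, hTN, hTc, hT⟩ := TopologicalSpace.countable_cover_nhdsWithin
    (s := {c | ∫ ω, q (Z 0 ω) c ∂P < 0}) (f := fun c => interior (V c))
    fun c hc => mem_nhdsWithin_of_mem_nhds (interior_mem_nhds.2 (hV c hc))
  filter_upwards [(ae_ball_iff hTc).2 fun c hc => hVae c (hTN hc), hp] with ω h1 h2 c hc
  by_contra! hneg
  obtain ⟨d, hd, hcd⟩ := mem_iUnion₂.1 (hT hneg)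
  have hfr := hc.frequently (isOpen_interior.mem_nhds hcd)
  obtain ⟨n, hn1, hn2, hn3⟩ := (hfr.and_eventually
    ((h1 d hd).and (eventually_ge_atTop 1))).exists
  exact absurd (hn2 _ (interior_subset hn1)) (not_lt.2 (h2 n hn3))

end Wald

/-! ### Quantile functions -/

section Quantile

lemma quantile_of_nonpos {ν : Measure ℝ} {u : ℝ} (hu : u ≤ 0) : quantile ν u = 0 := by
  have : {x : ℝ | u ≤ ν.real (Iic x)} = univ :=
    eq_univ_of_forall fun x => hu.trans measureReal_nonneg
  rw [quantile, this, Real.sInf_univ]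

variable {ν : Measure ℝ} [IsProbabilityMeasure ν] {u : ℝ}

lemma bddBelow_setOf_le_cdf (hu : 0 < u) : BddBelow {x : ℝ | u ≤ ν.real (Iic x)} := by
  obtain ⟨b, hb⟩ := ((tendsto_cdf_atBot ν).eventually_lt_const hu).exists
  refine ⟨b, fun x hx => ?_⟩
  by_contra! hxb
  have h1 := monotone_cdf ν hxb.le
  rw [cdf_eq_real ν x] at h1
  exact absurd (hx.trans h1) (not_le.2 hb)

lemma nonempty_setOf_le_cdf (hu : u < 1) : {x : ℝ | u ≤ ν.real (Iic x)}.Nonempty := by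
  obtain ⟨b, hb⟩ := ((tendsto_cdf_atTop ν).eventually_const_lt hu).exists
  rw [cdf_eq_real] at hb
  exact ⟨b, hb.le⟩

/-- The Galois connection between the quantile function and the cdf. -/
lemma quantile_le_iff (hu : u ∈ Ioo (0 : ℝ) 1) {x : ℝ} :
    quantile ν u ≤ x ↔ u ≤ ν.real (Iic x) := by
  constructor
  · intro h
    rw [← cdf_eq_real, ← StieltjesFunction.iInf_Ioi_eq (cdf ν) x]
    have : Nonempty (Ioi x) := ⟨⟨x + 1, by simp⟩⟩
    refine le_ciInf fun y => ?_
    obtain ⟨a, ha, hay⟩ := exists_lt_of_csInf_lt (nonempty_setOf_le_cdf hu.2)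
      (lt_of_le_of_lt h y.2)
    refine le_trans ha ?_
    rw [← cdf_eq_real]
    exact monotone_cdf ν hay.le
  · intro h
    exact csInf_le (bddBelow_setOf_le_cdf hu.1) h

lemma lt_quantile_iff (hu : u ∈ Ioo (0 : ℝ) 1) {x : ℝ} :
    x < quantile ν u ↔ ν.real (Iic x) < u := by
  rw [← not_le, quantile_le_iff hu, not_le]

lemma monotoneOn_quantile : MonotoneOn (quantile ν) (Ioo 0 1) := fun _ hu _ hv huv =>
  (quantile_le_iff hu).2 (huv.trans ((quantile_le_iff hv).1 le_rfl))

end Quantile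

/-! ### The probit function -/

section Probit

/-- The standard Gaussian law. -/
local notation "γ" => gaussianReal 0 1

lemma strictMono_gaussianReal_Iic : StrictMono fun x : ℝ => (γ).real (Iic x) := by
  intro x y hxy
  have h1 : (γ).real (Iic y) = (γ).real (Iic x) + (γ).real (Ioc x y) := by
    rw [← measureReal_union (Iic_disjoint_Ioc le_rfl) measurableSet_Ioc, Iic_union_Ioc_eq_Iic hxy.le]
  have h2 : 0 < (γ).real (Ioc x y) := by
    refine ENNReal.toReal_pos (fun h => ?_) (measure_ne_top _ _)
    have := gaussianReal_absolutelyContinuous' 0 one_ne_zero h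
    rw [Real.volume_Ioc, ENNReal.ofReal_eq_zero] at this
    linarith
  simp only
  linarith

lemma gaussianReal_Iic_mem_Ioo (x : ℝ) : (γ).real (Iic x) ∈ Ioo (0 : ℝ) 1 :=
  ⟨measureReal_nonneg.trans_lt (strictMono_gaussianReal_Iic (sub_one_lt x)),
    (strictMono_gaussianReal_Iic (lt_add_one x)).trans_le measureReal_le_one⟩

lemma probit_le_iff {u : ℝ} (hu : u ∈ Ioo (0 : ℝ) 1) {x : ℝ} :
    probit u ≤ x ↔ u ≤ (γ).real (Iic x) := quantile_le_iff hu

lemma lt_probit_iff {u : ℝ} (hu : u ∈ Ioo (0 : ℝ) 1) {x : ℝ} :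
    x < probit u ↔ (γ).real (Iic x) < u := lt_quantile_iff hu

lemma probit_gaussianReal_Iic (x : ℝ) : probit ((γ).real (Iic x)) = x := by
  refine le_antisymm ((probit_le_iff (gaussianReal_Iic_mem_Ioo x)).2 le_rfl) ?_
  exact strictMono_gaussianReal_Iic.le_iff_le.1
    ((probit_le_iff (gaussianReal_Iic_mem_Ioo x)).1 le_rfl)

/-- The set in the infimum is all of ℝ or empty, and `sInf` is 0 by convention in both cases. -/
lemma probit_of_notMem {u : ℝ} (hu : u ∉ Ioo (0 : ℝ) 1) : probit u = 0 := by
  rcases le_or_gt u 0 with h | h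
  · exact quantile_of_nonpos h
  have h1 : 1 ≤ u := by
    by_contra! h1
    exact hu ⟨h, h1⟩
  have : {x : ℝ | u ≤ (γ).real (Iic x)} = ∅ :=
    eq_empty_of_forall_notMem fun x hx => absurd (h1.trans hx)
      (not_le.2 (gaussianReal_Iic_mem_Ioo x).2)
  rw [probit, quantile, this, Real.sInf_empty]

lemma measurable_probit : Measurable probit := by
  refine measurable_of_Iic fun x => ?_
  have : probit ⁻¹' Iic x = (Ioo 0 1 ∩ Iic ((γ).real (Iic x))) ∪
      ((Ioo 0 1)ᶜ ∩ {_u | (0 : ℝ) ≤ x}) := by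
    ext u
    by_cases hu : u ∈ Ioo (0 : ℝ) 1
    · simp [probit_le_iff hu, hu.1, hu.2]
    · have := hu
      simp only [mem_Ioo] at this
      simp [probit_of_notMem hu, this]
  rw [this]
  exact (measurableSet_Ioo.inter measurableSet_Iic).union
    (measurableSet_Ioo.compl.inter (.const _))

/-- A monotone function whose image is all of ℝ cannot jump. -/
lemma continuousOn_probit : ContinuousOn probit (Ioo 0 1) := by
  intro u hu
  refine (continuousAt_of_monotoneOn_of_image_mem_nhds monotoneOn_quantile
    (isOpen_Ioo.mem_nhds hu) ?_).continuousWithinAt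
  refine mem_of_superset univ_mem fun x _ => ?_
  exact ⟨_, gaussianReal_Iic_mem_Ioo x, probit_gaussianReal_Iic x⟩

lemma map_probit_volume :
    ((volume : Measure ℝ).restrict (Icc 0 1)).map probit = γ := by
  rw [← Measure.restrict_congr_set Ioo_ae_eq_Icc]
  have : IsFiniteMeasure (((volume : Measure ℝ).restrict (Ioo 0 1)).map probit) :=
    Measure.isFiniteMeasure_map _ _
  refine Measure.ext_of_Iic _ _ fun x => ?_
  rw [Measure.map_apply measurable_probit measurableSet_Iic,
    Measure.restrict_apply (measurable_probit measurableSet_Iic)]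
  have h := gaussianReal_Iic_mem_Ioo x
  have : probit ⁻¹' Iic x ∩ Ioo 0 1 = Ioc 0 ((γ).real (Iic x)) := by
    ext u
    constructor
    · rintro ⟨h1, h2⟩
      exact ⟨h2.1, (probit_le_iff h2).1 h1⟩
    · rintro ⟨h1, h2⟩
      have hu : u ∈ Ioo (0 : ℝ) 1 := ⟨h1, h2.trans_lt h.2⟩
      exact ⟨(probit_le_iff hu).2 h2, hu⟩
  rw [this, Real.volume_Ioc, sub_zero, ofReal_measureReal]

/-- Chernoff's bound at the optimal exponent, which is `x` itself. -/
lemma gaussianReal_Iic_le_exp {x : ℝ} (hx : x ≤ 0) :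
    (γ).real (Iic x) ≤ Real.exp (-(x ^ 2 / 2)) := by
  have := measure_le_le_exp_mul_mgf (μ := γ) (X := id) x hx (integrable_exp_mul_gaussianReal x)
  rw [mgf_id_gaussianReal, ← Real.exp_add] at this
  refine this.trans (Real.exp_le_exp.2 (le_of_eq ?_))
  push_cast
  ring

lemma gaussianReal_Ici_le_exp {x : ℝ} (hx : 0 ≤ x) :
    (γ).real (Ici x) ≤ Real.exp (-(x ^ 2 / 2)) := by
  have := measure_ge_le_exp_mul_mgf (μ := γ) (X := id) x hx (integrable_exp_mul_gaussianReal x)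
  rw [mgf_id_gaussianReal, ← Real.exp_add] at this
  refine this.trans (Real.exp_le_exp.2 (le_of_eq ?_))
  push_cast
  ring

/-- Gaussian tails invert to logarithms. This turns quadratic forms in Φ⁻¹(u) into the logarithmic
quantities whose expectations are assumed finite. -/
lemma sq_probit_le {u : ℝ} (hu : u ∈ Ioo (0 : ℝ) 1) :
    probit u ^ 2 ≤ 2 * (-Real.log u) + 2 * (-Real.log (1 - u)) := by
  have hl1 : 0 ≤ -Real.log u := by linarith [Real.log_nonpos hu.1.le hu.2.le]
  have hl2 : 0 ≤ -Real.log (1 - u) := by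
    linarith [Real.log_nonpos (sub_nonneg.2 hu.2.le) (by linarith [hu.1])]
  rcases le_total (probit u) 0 with h | h
  · have h1 : u ≤ Real.exp (-(probit u ^ 2 / 2)) :=
      ((probit_le_iff hu).1 le_rfl).trans (gaussianReal_Iic_le_exp h)
    have := (Real.log_le_iff_le_exp hu.1).2 h1
    linarith
  -- The Galois connection gives Φ(y) < u only strictly below the quantile, so the tail bound is
  -- proved there and passed to the limit.
  · have key : ∀ y, 0 ≤ y → y < probit u → y ^ 2 ≤ -(2 * Real.log (1 - u)) := by
      intro y hy hyu
      have h1 := (lt_probit_iff hu).1 hyu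
      have h2 : (γ).real (Ioi y) = 1 - (γ).real (Iic y) := by
        rw [← compl_Iic, probReal_compl_eq_one_sub measurableSet_Iic]
      have h3 : (γ).real (Ioi y) ≤ (γ).real (Ici y) := measureReal_mono Ioi_subset_Ici_self
      have h4 : 1 - u ≤ Real.exp (-(y ^ 2 / 2)) := by
        linarith [gaussianReal_Ici_le_exp hy]
      have := (Real.log_le_iff_le_exp (sub_pos.2 hu.2)).2 h4
      linarith
    have : probit u ≤ Real.sqrt (-(2 * Real.log (1 - u))) := by
      refine le_of_forall_lt_imp_le_of_dense fun y hy => ?_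
      rcases le_total 0 y with h0 | h0
      · exact Real.le_sqrt_of_sq_le (key y h0 hy)
      · exact h0.trans (Real.sqrt_nonneg _)
    have := (Real.le_sqrt h (by linarith)).1 this
    linarith

end Probit

/-! ### The Gaussian law with a correlation matrix -/

section GaussianLaw

variable {ι : Type*} [Fintype ι]

/-- Since the Gaussian law has no atoms, it suffices to bound the mass strictly below the quantile.
Seen on the uniform law, that mass is carried by (0, u]. -/
lemma gaussianReal_Iic_probit {u : ℝ} (hu : u ∈ Ioo (0 : ℝ) 1) :
    (gaussianReal 0 1).real (Iic (probit u)) = u := by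
  refine le_antisymm ?_ ((probit_le_iff hu).1 le_rfl)
  have := nullSingletonClass_gaussianReal (μ := 0) (v := 1) one_ne_zero
  have h1 : gaussianReal 0 1 (Iic (probit u)) = gaussianReal 0 1 (Iio (probit u)) :=
    measure_congr Iio_ae_eq_Iic.symm
  have h2 : gaussianReal 0 1 (Iio (probit u)) ≤ ENNReal.ofReal u := by
    rw [← map_probit_volume, ← Measure.restrict_congr_set Ioo_ae_eq_Icc,
      Measure.map_apply measurable_probit measurableSet_Iio,
      Measure.restrict_apply (measurable_probit measurableSet_Iio)]
    calc volume (probit ⁻¹' Iio (probit u) ∩ Ioo 0 1) ≤ volume (Ioc 0 u) := by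
          refine measure_mono ?_
          rintro v ⟨hv1, hv2⟩
          refine ⟨hv2.1, ?_⟩
          by_contra! h
          exact absurd (monotoneOn_quantile hu hv2 h.le) (not_le.2 hv1)
      _ = ENNReal.ofReal u := by rw [Real.volume_Ioc, sub_zero]
  rw [measureReal_def, h1]
  exact ENNReal.toReal_le_of_le_ofReal hu.1.le h2

lemma probit_le_probit_iff {u v : ℝ} (hu : u ∈ Ioo (0 : ℝ) 1) (hv : v ∈ Ioo (0 : ℝ) 1) :
    probit u ≤ probit v ↔ u ≤ v := by
  rw [probit_le_iff hu, gaussianReal_Iic_probit hv]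

/-- The density of the Gaussian law with correlation matrix `R` with respect to the standard Gaussian
law. -/
noncomputable def gaussianRatio [DecidableEq ι] (R : Matrix ι ι ℝ) (z : ι → ℝ) : ℝ :=
  (Real.sqrt R.det)⁻¹ * Real.exp (-(1 / 2) * (z ⬝ᵥ ((R⁻¹ - 1) *ᵥ z)))

lemma continuous_gaussianRatio [DecidableEq ι] (R : Matrix ι ι ℝ) :
    Continuous (gaussianRatio R) := by
  unfold gaussianRatio
  fun_prop

lemma pi_gaussianReal_eq_withDensity :
    Measure.pi (fun _ : ι => gaussianReal 0 1) =
      (volume : Measure (ι → ℝ)).withDensity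
        fun x => ENNReal.ofReal (∏ i, gaussianPDFReal 0 1 (x i)) := by
  refine Measure.pi_eq fun s hs => ?_
  have hint : ∀ i, Integrable (gaussianPDFReal 0 1) ((volume : Measure ℝ).restrict (s i)) :=
    fun i => (integrable_gaussianPDFReal 0 1).restrict
  have hnn : ∀ x, 0 ≤ gaussianPDFReal 0 1 x := gaussianPDFReal_nonneg 0 1
  rw [withDensity_apply _ (MeasurableSet.univ_pi hs), volume_pi, Measure.restrict_pi_pi,
    ← ofReal_integral_eq_lintegral_ofReal (Integrable.fintype_prod hint)
      (ae_of_all _ fun x => Finset.prod_nonneg fun i _ => hnn (x i)),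
    integral_fintype_prod_eq_prod (fun (_ : ι) => gaussianPDFReal 0 1),
    ENNReal.ofReal_prod_of_nonneg fun i _ => integral_nonneg hnn]
  refine Finset.prod_congr rfl fun i _ => ?_
  rw [gaussianReal_apply_eq_integral _ one_ne_zero]

lemma prod_gaussianPDFReal (x : ι → ℝ) :
    ∏ i, gaussianPDFReal 0 1 (x i) =
      (∏ _i : ι, (Real.sqrt (2 * Real.pi))⁻¹) * Real.exp (-(1 / 2) * (x ⬝ᵥ x)) := by
  simp only [gaussianPDFReal, Finset.prod_mul_distrib, ← Real.exp_sum, dotProduct, Finset.mul_sum]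
  simp only [NNReal.coe_one, mul_one, sub_zero]
  congr 2
  refine Finset.sum_congr rfl fun i _ => ?_
  ring

lemma measurable_mulVec (A : Matrix ι ι ℝ) : Measurable fun x : ι → ℝ => A *ᵥ x := by
  have : Continuous fun x : ι → ℝ => A *ᵥ x := by fun_prop
  exact this.measurable

/-- The image of the standard Gaussian law by an invertible matrix. -/
lemma map_mulVec_pi_gaussianReal [DecidableEq ι] {A : Matrix ι ι ℝ} (hA : A.det ≠ 0) :
    (Measure.pi fun _ : ι => gaussianReal 0 1).map (fun x => A *ᵥ x) =
      (Measure.pi fun _ : ι => gaussianReal 0 1).withDensity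
        fun z => ENNReal.ofReal (gaussianRatio (A * Aᵀ) z) := by
  set h : (ι → ℝ) → ℝ := fun x => ∏ i, gaussianPDFReal 0 1 (x i) with hh
  have hhc : Measurable h := Finset.measurable_fun_prod _ fun i _ =>
    (measurable_gaussianPDFReal 0 1).comp (measurable_pi_apply i)
  have hAm := measurable_mulVec A
  have hAi := measurable_mulVec A⁻¹
  have hunit : IsUnit A.det := isUnit_iff_ne_zero.2 hA
  have hvol : (volume : Measure (ι → ℝ)).map (fun x => A *ᵥ x) =
      ENNReal.ofReal |A.det|⁻¹ • volume := by
    have := Real.map_matrix_volume_pi_eq_smul_volume_pi hA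
    rw [abs_inv] at this
    exact this
  -- Change of variables for the densities: det(AAᵀ) is the square of det A, and |A⁻¹z|² =
  -- zᵀ(AAᵀ)⁻¹z.
  have hkey : ∀ z, |A.det|⁻¹ * h (A⁻¹ *ᵥ z) = h z * gaussianRatio (A * Aᵀ) z := by
    intro z
    have h1 : Real.sqrt (A * Aᵀ).det = |A.det| := by
      rw [Matrix.det_mul, Matrix.det_transpose, Real.sqrt_mul_self_eq_abs]
    have h2 : (A⁻¹ *ᵥ z) ⬝ᵥ (A⁻¹ *ᵥ z) = z ⬝ᵥ ((A * Aᵀ)⁻¹ *ᵥ z) := by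
      rw [Matrix.mul_inv_rev, ← Matrix.transpose_nonsing_inv, ← Matrix.mulVec_mulVec,
        Matrix.dotProduct_mulVec z, Matrix.vecMul_transpose]
    rw [hh]
    simp only
    rw [prod_gaussianPDFReal, prod_gaussianPDFReal, gaussianRatio, h1, h2, Matrix.sub_mulVec,
      Matrix.one_mulVec, dotProduct_sub]
    have h3 : Real.exp (-(1 / 2) * (z ⬝ᵥ ((A * Aᵀ)⁻¹ *ᵥ z))) = Real.exp (-(1 / 2) * (z ⬝ᵥ z)) *
        Real.exp (-(1 / 2) * (z ⬝ᵥ ((A * Aᵀ)⁻¹ *ᵥ z) - z ⬝ᵥ z)) := by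
      rw [← Real.exp_add]
      ring_nf
    rw [h3]
    ring
  have hD : Measurable fun z => ENNReal.ofReal (gaussianRatio (A * Aᵀ) z) :=
    (continuous_gaussianRatio _).measurable.ennreal_ofReal
  ext s hs
  rw [Measure.map_apply hAm hs, withDensity_apply _ hs, pi_gaussianReal_eq_withDensity,
    withDensity_apply _ (hAm hs), restrict_withDensity hs,
    lintegral_withDensity_eq_lintegral_mul _ hhc.ennreal_ofReal hD]
  have hmeas : Measurable (s.indicator fun z => ENNReal.ofReal (h (A⁻¹ *ᵥ z))) :=
    ((hhc.comp hAi).ennreal_ofReal).indicator hs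
  calc ∫⁻ x in (fun x => A *ᵥ x) ⁻¹' s, ENNReal.ofReal (h x)
      = ∫⁻ x, (s.indicator fun z => ENNReal.ofReal (h (A⁻¹ *ᵥ z))) (A *ᵥ x) := by
        rw [← lintegral_indicator (hAm hs)]
        refine lintegral_congr fun x => ?_
        by_cases hx : A *ᵥ x ∈ s
        · rw [indicator_of_mem (show x ∈ (fun x => A *ᵥ x) ⁻¹' s from hx), indicator_of_mem hx,
            Matrix.mulVec_mulVec, Matrix.nonsing_inv_mul A hunit, Matrix.one_mulVec]
        · rw [indicator_of_notMem (show x ∉ (fun x => A *ᵥ x) ⁻¹' s from hx),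
            indicator_of_notMem hx]
    _ = ENNReal.ofReal |A.det|⁻¹ * ∫⁻ z in s, ENNReal.ofReal (h (A⁻¹ *ᵥ z)) := by
        rw [← lintegral_map hmeas hAm, hvol, lintegral_smul_measure, lintegral_indicator hs,
          smul_eq_mul]
    _ = _ := by
        rw [← lintegral_const_mul' _ _ ENNReal.ofReal_ne_top]
        refine lintegral_congr fun z => ?_
        rw [← ENNReal.ofReal_mul (by positivity), hkey, Pi.mul_apply, ENNReal.ofReal_mul]
        exact Finset.prod_nonneg fun i _ => gaussianPDFReal_nonneg 0 1 _

/-- The copula density is `gaussianRatio R` evaluated at the coordinatewise `probit`, a map that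
sends the uniform law on the cube to the standard Gaussian law. -/
lemma map_probit_gaussianCopula [DecidableEq ι] (R : Matrix ι ι ℝ) :
    (gaussianCopula R).map (fun u i => probit (u i)) =
      (Measure.pi fun _ : ι => gaussianReal 0 1).withDensity
        fun z => ENNReal.ofReal (gaussianRatio R z) := by
  have hpm : Measurable fun (u : ι → ℝ) i => probit (u i) :=
    measurable_pi_iff.2 fun i => measurable_probit.comp (measurable_pi_apply i)
  have hD : Measurable fun z => ENNReal.ofReal (gaussianRatio R z) :=
    (continuous_gaussianRatio _).measurable.ennreal_ofReal
  have hpi : ((volume : Measure (ι → ℝ)).restrict (Set.pi univ fun _ => Icc (0 : ℝ) 1)).map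
      (fun u i => probit (u i)) = Measure.pi fun _ : ι => gaussianReal 0 1 := by
    rw [volume_pi, Measure.restrict_pi_pi]
    have : ∀ i : ι, SigmaFinite (((volume : Measure ℝ).restrict (Icc 0 1)).map probit) := by
      intro i
      rw [map_probit_volume]
      infer_instance
    rw [Measure.pi_map_pi fun _ => measurable_probit.aemeasurable]
    simp_rw [map_probit_volume]
  ext s hs
  rw [Measure.map_apply hpm hs, gaussianCopula, withDensity_apply _ (hpm hs),
    withDensity_apply _ hs, ← hpi, ← lintegral_indicator hs, lintegral_map (hD.indicator hs) hpm,
    ← lintegral_indicator (hpm hs)]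
  rfl

-- The rows of the factor are unit vectors whose inner products are the entries of `R`. Combined
-- with `map_mulVec_pi_gaussianReal`, this realizes the Gaussian law with correlation `R` by linear
-- forms of a standard Gaussian vector.
open scoped MatrixOrder in
lemma IsCorrelation.exists_factor [DecidableEq ι] {R : Matrix ι ι ℝ} (hR : IsCorrelation R) :
    ∃ A : Matrix ι ι ℝ, A.det ≠ 0 ∧ R = A * Aᵀ := by
  obtain ⟨B, hB⟩ := CStarAlgebra.nonneg_iff_eq_star_mul_self.mp hR.1.posSemidef.nonneg
  rw [Matrix.star_eq_conjTranspose, Matrix.conjTranspose_eq_transpose_of_trivial] at hB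
  refine ⟨Bᵀ, fun h => ?_, by rw [Matrix.transpose_transpose, ← hB]⟩
  have := hR.1.det_pos
  rw [hB, Matrix.det_mul, h, zero_mul] at this
  exact lt_irrefl _ this

lemma ae_gaussianCopula_mem_Ioo [DecidableEq ι] (R : Matrix ι ι ℝ) :
    ∀ᵐ u ∂gaussianCopula R, ∀ i, u i ∈ Ioo (0 : ℝ) 1 := by
  refine (withDensity_absolutelyContinuous _ _).ae_le ?_
  have : (Set.pi univ fun _ : ι => Ioo (0 : ℝ) 1) =ᵐ[volume] Set.pi univ fun _ => Icc (0 : ℝ) 1 :=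
    Measure.pi_Ioo_ae_eq_pi_Icc
  rw [← Measure.restrict_congr_set this]
  filter_upwards [ae_restrict_mem (MeasurableSet.univ_pi fun _ => measurableSet_Ioo)] with u hu i
  exact hu i (mem_univ i)

lemma isProbabilityMeasure_gaussianCopula [DecidableEq ι] {R : Matrix ι ι ℝ}
    (hR : IsCorrelation R) : IsProbabilityMeasure (gaussianCopula R) := by
  obtain ⟨A, hA, rfl⟩ := hR.exists_factor
  have hpm : Measurable fun (u : ι → ℝ) i => probit (u i) :=
    measurable_pi_iff.2 fun i => measurable_probit.comp (measurable_pi_apply i)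
  have hAm := measurable_mulVec A
  have h := map_probit_gaussianCopula (A * Aᵀ)
  rw [← map_mulVec_pi_gaussianReal hA] at h
  refine ⟨?_⟩
  have h1 := congrArg (fun μ => μ univ) h
  simpa [Measure.map_apply hpm MeasurableSet.univ, Measure.map_apply hAm MeasurableSet.univ]
    using h1

/-! ### Pairs of linear forms of a standard Gaussian vector -/

lemma measurable_dotProduct_pair (a b : ι → ℝ) :
    Measurable fun x : ι → ℝ => (a ⬝ᵥ x, b ⬝ᵥ x) := by
  have : Continuous fun x : ι → ℝ => (a ⬝ᵥ x, b ⬝ᵥ x) := by fun_prop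
  exact this.measurable

/-- Coordinates are independent, so the characteristic function factorizes and depends on `a`, `b`
only through their Gram matrix. Pairs of forms in different dimensions can therefore be compared. -/
lemma charFunDual_map_pair {a b : ι → ℝ} (L : StrongDual ℝ (ℝ × ℝ)) :
    charFunDual ((Measure.pi fun _ : ι => gaussianReal 0 1).map
      fun x => (a ⬝ᵥ x, b ⬝ᵥ x)) L =
      Complex.exp (-(((L (1, 0)) ^ 2 * (a ⬝ᵥ a) + 2 * L (1, 0) * L (0, 1) * (a ⬝ᵥ b) +
        (L (0, 1)) ^ 2 * (b ⬝ᵥ b) : ℝ) : ℂ) / 2) := by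
  have hm := measurable_dotProduct_pair a b
  set s := L (1, 0)
  set t := L (0, 1)
  have hL : ∀ x : ι → ℝ, L (a ⬝ᵥ x, b ⬝ᵥ x) = ∑ i, (s * a i + t * b i) * x i := by
    intro x
    have h1 : ((a ⬝ᵥ x, b ⬝ᵥ x) : ℝ × ℝ) = (a ⬝ᵥ x) • (1, 0) + (b ⬝ᵥ x) • (0, 1) := by
      simp
    rw [h1, map_add, map_smul, map_smul, smul_eq_mul, smul_eq_mul, dotProduct, dotProduct,
      Finset.sum_mul, Finset.sum_mul, ← Finset.sum_add_distrib]
    exact Finset.sum_congr rfl fun i _ => by ring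
  rw [charFunDual_apply, integral_map hm.aemeasurable
    (Measurable.aestronglyMeasurable (by fun_prop))]
  simp_rw [hL, Complex.ofReal_sum, Finset.sum_mul, Complex.exp_sum]
  rw [integral_fintype_prod_eq_prod
    (f := fun i (x : ℝ) => Complex.exp ((((s * a i + t * b i) * x : ℝ) : ℂ) * Complex.I))]
  have h2 : ∀ i, ∫ x, Complex.exp ((((s * a i + t * b i) * x : ℝ) : ℂ) * Complex.I)
      ∂(gaussianReal 0 1) = Complex.exp (-((s * a i + t * b i : ℝ) : ℂ) ^ 2 / 2) := by
    intro i
    simp_rw [Complex.ofReal_mul, ← charFun_apply_real, charFun_gaussianReal]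
    congr 1
    simp
    ring
  simp_rw [h2, ← Complex.exp_sum]
  congr 1
  rw [← Finset.sum_div]
  congr 1
  simp_rw [dotProduct, Finset.mul_sum, ← Finset.sum_add_distrib]
  push_cast
  rw [← Finset.sum_neg_distrib]
  exact Finset.sum_congr rfl fun i _ => by ring

/-- The standard bivariate Gaussian law with correlation `ρ`. -/
noncomputable def bivariateGaussian (ρ : ℝ) : Measure (ℝ × ℝ) :=
  ((gaussianReal 0 1).prod (gaussianReal 0 1)).map
    fun p => (p.1, ρ * p.1 + Real.sqrt (1 - ρ ^ 2) * p.2)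

lemma bivariateGaussian_eq_map (ρ : ℝ) :
    bivariateGaussian ρ = (Measure.pi fun _ : Fin 2 => gaussianReal 0 1).map
      fun x => (![1, 0] ⬝ᵥ x, ![ρ, Real.sqrt (1 - ρ ^ 2)] ⬝ᵥ x) := by
  rw [bivariateGaussian, ← (measurePreserving_finTwoArrow (gaussianReal 0 1)).map_eq,
    Measure.map_map (by fun_prop) (MeasurableEquiv.measurable _)]
  congr 1
  ext x
  · simp [MeasurableEquiv.finTwoArrow, dotProduct, Fin.sum_univ_two]
  · simp [MeasurableEquiv.finTwoArrow, dotProduct, Fin.sum_univ_two]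

lemma map_pair_eq_bivariateGaussian {a b : ι → ℝ} {ρ : ℝ} (hρ : ρ ^ 2 ≤ 1) (haa : a ⬝ᵥ a = 1)
    (hbb : b ⬝ᵥ b = 1) (hab : a ⬝ᵥ b = ρ) :
    (Measure.pi fun _ : ι => gaussianReal 0 1).map (fun x => (a ⬝ᵥ x, b ⬝ᵥ x)) =
      bivariateGaussian ρ := by
  rw [bivariateGaussian_eq_map]
  have := Measure.isProbabilityMeasure_map (μ := Measure.pi fun _ : ι => gaussianReal 0 1)
    (measurable_dotProduct_pair a b).aemeasurable
  have := Measure.isProbabilityMeasure_map (μ := Measure.pi fun _ : Fin 2 => gaussianReal 0 1)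
    (measurable_dotProduct_pair ![1, 0] ![ρ, Real.sqrt (1 - ρ ^ 2)]).aemeasurable
  refine Measure.ext_of_charFunDual ?_
  ext L
  rw [charFunDual_map_pair, charFunDual_map_pair, haa, hbb, hab]
  have h : ![ρ, Real.sqrt (1 - ρ ^ 2)] ⬝ᵥ ![ρ, Real.sqrt (1 - ρ ^ 2)] = 1 := by
    simp [dotProduct, Fin.sum_univ_two, Real.mul_self_sqrt (sub_nonneg.2 hρ)]
    ring
  rw [h]
  simp [dotProduct, Fin.sum_univ_two]

end GaussianLaw

/-! ### Monotonicity of the bivariate Gaussian cdf in the correlation -/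

section Bivariate

/-- The conditional probability that the second coordinate of the bivariate Gaussian law is at most
`b`, given the first one. -/
noncomputable def condGaussianCdf (ρ b x : ℝ) : ℝ :=
  (gaussianReal 0 1).real (Iic ((b - ρ * x) / Real.sqrt (1 - ρ ^ 2)))

lemma measurable_condGaussianCdf (ρ b : ℝ) : Measurable (condGaussianCdf ρ b) :=
  strictMono_gaussianReal_Iic.monotone.measurable.comp (by fun_prop)

lemma integrable_condGaussianCdf (ρ b : ℝ) :
    Integrable (condGaussianCdf ρ b) (gaussianReal 0 1) := by
  refine Integrable.of_bound (measurable_condGaussianCdf ρ b).aestronglyMeasurable 1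
    (ae_of_all _ fun x => ?_)
  rw [condGaussianCdf, Real.norm_of_nonneg measureReal_nonneg]
  exact measureReal_le_one

lemma isProbabilityMeasure_bivariateGaussian (ρ : ℝ) :
    IsProbabilityMeasure (bivariateGaussian ρ) :=
  Measure.isProbabilityMeasure_map (by fun_prop)

lemma bivariateGaussian_real_prod {ρ : ℝ} (hρ : ρ ^ 2 < 1) {s : Set ℝ} (hs : MeasurableSet s)
    (b : ℝ) :
    (bivariateGaussian ρ).real (s ×ˢ Iic b) =
      ∫ x in s, condGaussianCdf ρ b x ∂(gaussianReal 0 1) := by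
  have hσ : 0 < Real.sqrt (1 - ρ ^ 2) := Real.sqrt_pos.2 (by linarith)
  have hm : Measurable fun p : ℝ × ℝ => (p.1, ρ * p.1 + Real.sqrt (1 - ρ ^ 2) * p.2) := by
    fun_prop
  rw [measureReal_def, bivariateGaussian, Measure.map_apply hm (hs.prod measurableSet_Iic),
    Measure.prod_apply (hm (hs.prod measurableSet_Iic)), ← integral_indicator hs,
    integral_eq_lintegral_of_nonneg_ae
      (ae_of_all _ fun x => indicator_nonneg (f := condGaussianCdf ρ b)
        (fun _ _ => measureReal_nonneg) x)
      ((measurable_condGaussianCdf ρ b).indicator hs).aestronglyMeasurable]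
  congr 1
  refine lintegral_congr fun x => ?_
  by_cases hx : x ∈ s
  · rw [indicator_of_mem hx, condGaussianCdf, ofReal_measureReal]
    congr 1
    ext y
    simp only [mem_preimage, mem_prod, mem_Iic, hx, true_and]
    rw [le_div_iff₀ hσ]
    constructor <;> intro h <;> linarith
  · rw [indicator_of_notMem hx, ENNReal.ofReal_zero]
    convert measure_empty (μ := gaussianReal 0 1)
    ext y
    simp [hx]

/-- The Gram matrix is symmetric in the two forms, so the law can be rewritten with the plain
coordinate in second position. -/
lemma map_snd_bivariateGaussian {ρ : ℝ} (hρ : ρ ^ 2 ≤ 1) :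
    (bivariateGaussian ρ).map Prod.snd = gaussianReal 0 1 := by
  have h1 : ![ρ, Real.sqrt (1 - ρ ^ 2)] ⬝ᵥ ![ρ, Real.sqrt (1 - ρ ^ 2)] = 1 := by
    simp [dotProduct, Fin.sum_univ_two, Real.mul_self_sqrt (sub_nonneg.2 hρ)]
    ring
  rw [← map_pair_eq_bivariateGaussian (a := ![ρ, Real.sqrt (1 - ρ ^ 2)]) (b := ![1, 0]) hρ h1
    (by simp [dotProduct, Fin.sum_univ_two]) (by simp [dotProduct, Fin.sum_univ_two]),
    Measure.map_map measurable_snd (measurable_dotProduct_pair _ _)]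
  convert (measurePreserving_eval (fun _ : Fin 2 => gaussianReal 0 1) 0).map_eq using 2
  ext x
  simp [dotProduct, Fin.sum_univ_two]

lemma integral_condGaussianCdf {ρ : ℝ} (hρ : ρ ^ 2 < 1) (b : ℝ) :
    ∫ x, condGaussianCdf ρ b x ∂(gaussianReal 0 1) = (gaussianReal 0 1).real (Iic b) := by
  have := isProbabilityMeasure_bivariateGaussian ρ
  rw [← setIntegral_univ, ← bivariateGaussian_real_prod hρ MeasurableSet.univ,
    ← map_snd_bivariateGaussian hρ.le,
    map_measureReal_apply measurable_snd measurableSet_Iic]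
  congr 1
  ext p
  simp

lemma setIntegral_gaussianReal_pos {f : ℝ → ℝ} (hf : Integrable f (gaussianReal 0 1)) {s : Set ℝ}
    (hs : MeasurableSet s) (hvol : volume s ≠ 0) (hpos : ∀ x ∈ s, 0 < f x) :
    0 < ∫ x in s, f x ∂(gaussianReal 0 1) := by
  rw [setIntegral_pos_iff_support_of_nonneg_ae
    ((ae_restrict_mem hs).mono fun x hx => (hpos x hx).le) hf.integrableOn]
  have : Function.support f ∩ s = s := inter_eq_right.2 fun x hx => (hpos x hx).ne'
  rw [this, pos_iff_ne_zero]
  exact fun h => hvol (gaussianReal_absolutelyContinuous' 0 one_ne_zero h)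

/-- The cdf of the standard bivariate Gaussian law is strictly increasing in the correlation. -/
lemma bivariateGaussian_real_Iic_prod_lt {ρ₁ ρ₂ : ℝ} (h₁ : ρ₁ ^ 2 < 1) (h₂ : ρ₂ ^ 2 < 1)
    (hlt : ρ₁ < ρ₂) (a b : ℝ) :
    (bivariateGaussian ρ₁).real (Iic a ×ˢ Iic b) <
      (bivariateGaussian ρ₂).real (Iic a ×ˢ Iic b) := by
  rw [bivariateGaussian_real_prod h₁ measurableSet_Iic,
    bivariateGaussian_real_prod h₂ measurableSet_Iic]
  have hσ₁ : 0 < Real.sqrt (1 - ρ₁ ^ 2) := Real.sqrt_pos.2 (by linarith)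
  have hσ₂ : 0 < Real.sqrt (1 - ρ₂ ^ 2) := Real.sqrt_pos.2 (by linarith)
  set σ₁ := Real.sqrt (1 - ρ₁ ^ 2)
  set σ₂ := Real.sqrt (1 - ρ₂ ^ 2)
  have hs₁ : σ₁ ^ 2 = 1 - ρ₁ ^ 2 := Real.sq_sqrt (by linarith)
  have hs₂ : σ₂ ^ 2 = 1 - ρ₂ ^ 2 := Real.sq_sqrt (by linarith)
  -- the slopes are ordered
  have hslope : ρ₁ / σ₁ < ρ₂ / σ₂ := by
    rw [div_lt_div_iff₀ hσ₁ hσ₂]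
    rcases le_or_gt 0 ρ₁ with h0 | h0
    · have : σ₂ < σ₁ := by
        refine lt_of_pow_lt_pow_left₀ 2 hσ₁.le ?_
        rw [hs₁, hs₂]
        nlinarith
      nlinarith
    · rcases le_or_gt 0 ρ₂ with h0' | h0'
      · have := mul_pos (neg_pos.2 h0) hσ₂
        have := mul_nonneg h0' hσ₁.le
        linarith
      · have : σ₁ < σ₂ := by
          refine lt_of_pow_lt_pow_left₀ 2 hσ₂.le ?_
          rw [hs₁, hs₂]
          nlinarith
        nlinarith
  set k := ρ₂ / σ₂ - ρ₁ / σ₁ with hk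
  have hkpos : 0 < k := sub_pos.2 hslope
  -- The arguments of the two conditional cdfs are affine in x and cross only at `c`, so the
  -- difference `d` has the sign of `c - x`. As both cdfs integrate to Φ(b), `d` has integral zero.
  set c := (b / σ₂ - b / σ₁) / k with hc
  have hcross : ∀ x, (b - ρ₂ * x) / σ₂ - (b - ρ₁ * x) / σ₁ = k * (c - x) := by
    intro x
    have : k * c = b / σ₂ - b / σ₁ := by
      rw [hc]
      field_simp
    rw [mul_sub, this, hk]
    field_simp
    ring
  set d : ℝ → ℝ := fun x => condGaussianCdf ρ₂ b x - condGaussianCdf ρ₁ b x with hd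
  have hdi : Integrable d (gaussianReal 0 1) :=
    (integrable_condGaussianCdf ρ₂ b).sub (integrable_condGaussianCdf ρ₁ b)
  have hdpos : ∀ x, x < c → 0 < d x := by
    intro x hx
    refine sub_pos.2 (strictMono_gaussianReal_Iic ?_)
    have := mul_pos hkpos (sub_pos.2 hx)
    linarith [hcross x]
  have hdneg : ∀ x, c < x → 0 < -d x := by
    intro x hx
    refine neg_pos.2 (sub_neg.2 (strictMono_gaussianReal_Iic ?_))
    have := mul_pos hkpos (sub_pos.2 hx)
    linarith [hcross x]
  have htot : ∫ x, d x ∂(gaussianReal 0 1) = 0 := by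
    rw [hd, integral_sub (integrable_condGaussianCdf ρ₂ b) (integrable_condGaussianCdf ρ₁ b),
      integral_condGaussianCdf h₁, integral_condGaussianCdf h₂, sub_self]
  -- Left of the crossing the integrand is positive; past it, the integral is minus the integral
  -- over (a, ∞), where `d` is negative.
  have hgoal : 0 < ∫ x in Iic a, d x ∂(gaussianReal 0 1) := by
    rcases le_or_gt a c with hac | hac
    · have := nullSingletonClass_gaussianReal (μ := 0) (v := 1) one_ne_zero
      rw [← setIntegral_congr_set Iio_ae_eq_Iic]
      exact setIntegral_gaussianReal_pos hdi measurableSet_Iio (by simp)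
        fun x hx => hdpos x (lt_of_lt_of_le hx hac)
    · have h1 := setIntegral_gaussianReal_pos hdi.neg (s := Ioi a) measurableSet_Ioi (by simp)
        fun x hx => hdneg x (hac.trans hx)
      have h2 := integral_add_compl (μ := gaussianReal 0 1) (measurableSet_Iic (a := a)) hdi
      rw [compl_Iic, htot] at h2
      simp only [Pi.neg_apply, integral_neg] at h1
      linarith
  rw [hd, integral_sub (integrable_condGaussianCdf ρ₂ b).integrableOn
    (integrable_condGaussianCdf ρ₁ b).integrableOn] at hgoal
  linarith

end Bivariate

/-! ### Identification of the correlation matrix -/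

section Identification

variable {ι : Type*} [Fintype ι] [DecidableEq ι]

/-- Testing positive definiteness on e_i - R_ij e_j gives 1 - R_ij² > 0. -/
lemma IsCorrelation.sq_lt_one {R : Matrix ι ι ℝ} (hR : IsCorrelation R) {i j : ι} (hij : i ≠ j) :
    R i j ^ 2 < 1 := by
  have hsymm : R j i = R i j := by
    have := hR.1.isHermitian.apply i j
    simpa using this
  have hx : (Pi.single i 1 - R i j • Pi.single j 1 : ι → ℝ) ≠ 0 := by
    intro h
    have := congrFun h i
    simp [hij] at this
  have h := hR.1.dotProduct_mulVec_pos hx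
  simp only [star_trivial, Matrix.mulVec_sub, Matrix.mulVec_smul, sub_dotProduct, dotProduct_sub,
    smul_dotProduct, dotProduct_smul, Matrix.mulVec_single_one, single_one_dotProduct,
    Matrix.col_apply, hR.2, hsymm, smul_eq_mul] at h
  nlinarith

/-- In Gaussian coordinates the copula is the law of Ax with R = AAᵀ, and two of its coordinates are
the linear forms given by two rows of A. -/
lemma gaussianCopula_real_pair {R : Matrix ι ι ℝ} (hR : IsCorrelation R) {i j : ι} (hij : i ≠ j)
    {x y : ℝ} (hx : x ∈ Ioo (0 : ℝ) 1) (hy : y ∈ Ioo (0 : ℝ) 1) :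
    (gaussianCopula R).real {u | u i ≤ x ∧ u j ≤ y} =
      (bivariateGaussian (R i j)).real (Iic (probit x) ×ˢ Iic (probit y)) := by
  obtain ⟨A, hA, hRA⟩ := hR.exists_factor
  have hdot : ∀ i j, A i ⬝ᵥ A j = R i j := by
    intro i j
    rw [hRA, Matrix.mul_apply]
    rfl
  rw [← map_pair_eq_bivariateGaussian (hR.sq_lt_one hij).le ((hdot i i).trans (hR.2 i))
    ((hdot j j).trans (hR.2 j)) (hdot i j)]
  have hpm : Measurable fun (u : ι → ℝ) i => probit (u i) :=
    measurable_pi_iff.2 fun i => measurable_probit.comp (measurable_pi_apply i)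
  have hpair : Measurable fun z : ι → ℝ => (z i, z j) := by fun_prop
  have hcomp : (fun x => (A i ⬝ᵥ x, A j ⬝ᵥ x)) = (fun z : ι → ℝ => (z i, z j)) ∘
      fun x => A *ᵥ x := rfl
  have hset : MeasurableSet (Iic (probit x) ×ˢ Iic (probit y)) :=
    measurableSet_Iic.prod measurableSet_Iic
  rw [hcomp, ← Measure.map_map hpair (measurable_mulVec A), map_mulVec_pi_gaussianReal hA, ← hRA,
    ← map_probit_gaussianCopula, Measure.map_map hpair hpm, measureReal_def, measureReal_def,
    Measure.map_apply (hpair.comp hpm) hset]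
  congr 1
  refine measure_congr ?_
  filter_upwards [ae_gaussianCopula_mem_Ioo R] with u hu
  refine propext ?_
  change (u i ≤ x ∧ u j ≤ y) ↔ (probit (u i) ≤ probit x ∧ probit (u j) ≤ probit y)
  rw [probit_le_probit_iff (hu i) hx, probit_le_probit_iff (hu j) hy]

/-- A Gaussian copula is identified by one value of the cdf of each of its bivariate margins. -/
theorem IsCorrelation.eq_of_forall_pair {R R' : Matrix ι ι ℝ} (hR : IsCorrelation R)
    (hR' : IsCorrelation R') {x : ι → ℝ} (hx : ∀ i, x i ∈ Ioo (0 : ℝ) 1)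
    (h : ∀ i j, (gaussianCopula R) {u | u i ≤ x i ∧ u j ≤ x j} =
      (gaussianCopula R') {u | u i ≤ x i ∧ u j ≤ x j}) : R = R' := by
  ext i j
  by_cases hij : i = j
  · rw [hij, hR.2, hR'.2]
  have h1 := congrArg ENNReal.toReal (h i j)
  simp only [← measureReal_def] at h1
  rw [gaussianCopula_real_pair hR hij (hx i) (hx j),
    gaussianCopula_real_pair hR' hij (hx i) (hx j)] at h1
  rcases lt_trichotomy (R i j) (R' i j) with hlt | heq | hlt
  · exact absurd h1 (bivariateGaussian_real_Iic_prod_lt (hR.sq_lt_one hij) (hR'.sq_lt_one hij)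
      hlt _ _).ne
  · exact heq
  · exact absurd h1 (bivariateGaussian_real_Iic_prod_lt (hR'.sq_lt_one hij) (hR.sq_lt_one hij)
      hlt _ _).ne'

end Identification

/-! ### Bounds on the Gaussian copula density -/

section RatioBounds

variable {ι : Type*} [Fintype ι]

lemma abs_dotProduct_mulVec_le {M : Matrix ι ι ℝ} {m : ℝ} (hM : ∀ i j, |M i j| ≤ m) (z : ι → ℝ) :
    |z ⬝ᵥ (M *ᵥ z)| ≤ m * Fintype.card ι * (z ⬝ᵥ z) := by
  rcases isEmpty_or_nonempty ι with hι | ⟨⟨i₀⟩⟩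
  · simp
  have hm : 0 ≤ m := (abs_nonneg _).trans (hM i₀ i₀)
  have h1 : z ⬝ᵥ (M *ᵥ z) = ∑ i, ∑ j, z i * (M i j * z j) := by
    simp [dotProduct, Matrix.mulVec, Finset.mul_sum]
  rw [h1]
  refine (Finset.abs_sum_le_sum_abs _ _).trans ?_
  calc ∑ i, |∑ j, z i * (M i j * z j)| ≤ ∑ i, ∑ j, m * ((z i ^ 2 + z j ^ 2) / 2) := by
        refine Finset.sum_le_sum fun i _ => (Finset.abs_sum_le_sum_abs _ _).trans
          (Finset.sum_le_sum fun j _ => ?_)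
        have h2 : |z i * (M i j * z j)| = |M i j| * (|z i| * |z j|) := by
          rw [abs_mul, abs_mul]
          ring
        have h3 : |z i| * |z j| ≤ (z i ^ 2 + z j ^ 2) / 2 := by
          nlinarith [sq_nonneg (|z i| - |z j|), sq_abs (z i), sq_abs (z j)]
        rw [h2]
        exact mul_le_mul (hM i j) h3 (by positivity) hm
    _ = m * Fintype.card ι * (z ⬝ᵥ z) := by
        simp_rw [← Finset.mul_sum, ← Finset.sum_div, Finset.sum_add_distrib, Finset.sum_const,
          Finset.card_univ, nsmul_eq_mul, ← Finset.mul_sum]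
        rw [dotProduct]
        simp_rw [← sq]
        ring

variable [DecidableEq ι]

/-- With R = AAᵀ, z_i is the product of a row of A with A⁻¹z. The unit diagonal makes that row a
unit vector, and Cauchy–Schwarz concludes; no eigenvalue is needed. -/
lemma IsCorrelation.sq_le_dotProduct_inv {R : Matrix ι ι ℝ} (hR : IsCorrelation R) (z : ι → ℝ)
    (i : ι) : z i ^ 2 ≤ z ⬝ᵥ (R⁻¹ *ᵥ z) := by
  obtain ⟨A, hA, hRA⟩ := hR.exists_factor
  have hunit : IsUnit A.det := isUnit_iff_ne_zero.2 hA
  have h2 : z ⬝ᵥ (R⁻¹ *ᵥ z) = (A⁻¹ *ᵥ z) ⬝ᵥ (A⁻¹ *ᵥ z) := by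
    rw [hRA, Matrix.mul_inv_rev, ← Matrix.transpose_nonsing_inv, ← Matrix.mulVec_mulVec,
      Matrix.dotProduct_mulVec z, Matrix.vecMul_transpose]
  have h3 : z i = A i ⬝ᵥ (A⁻¹ *ᵥ z) := by
    have : A *ᵥ (A⁻¹ *ᵥ z) = z := by
      rw [Matrix.mulVec_mulVec, Matrix.mul_nonsing_inv A hunit, Matrix.one_mulVec]
    exact (congrFun this i).symm
  have h4 : ∑ j, A i j ^ 2 = 1 := by
    have := hR.2 i
    rw [hRA, Matrix.mul_apply] at this
    simpa [sq] using this
  rw [h2, h3]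
  have := Finset.sum_mul_sq_le_sq_mul_sq Finset.univ (A i) (A⁻¹ *ᵥ z)
  rw [h4, one_mul] at this
  simpa [dotProduct, sq] using this

lemma IsCorrelation.dotProduct_self_le {R : Matrix ι ι ℝ} (hR : IsCorrelation R) (z : ι → ℝ) :
    z ⬝ᵥ z ≤ Fintype.card ι * (z ⬝ᵥ (R⁻¹ *ᵥ z)) := by
  calc z ⬝ᵥ z = ∑ i, z i ^ 2 := by simp [dotProduct, sq]
    _ ≤ ∑ _i : ι, z ⬝ᵥ (R⁻¹ *ᵥ z) := Finset.sum_le_sum fun i _ => hR.sq_le_dotProduct_inv z i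
    _ = _ := by simp

lemma continuousOn_matrix_inv {Γ : Set (Matrix ι ι ℝ)} (hΓ : ∀ R ∈ Γ, IsCorrelation R) :
    ContinuousOn (fun R : Matrix ι ι ℝ => R⁻¹) Γ := by
  have h : ContinuousOn (fun R : Matrix ι ι ℝ => R.det⁻¹ • R.adjugate) Γ := by
    refine ContinuousOn.smul (ContinuousOn.inv₀ ?_ fun R hR => (hΓ R hR).1.det_pos.ne') ?_
    · exact (Continuous.matrix_det continuous_id).continuousOn
    · exact (Continuous.matrix_adjugate continuous_id).continuousOn
  refine h.congr fun R hR => ?_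
  simp [Matrix.inv_def]

/-- Two-sided Gaussian bounds on the Gaussian copula densities with parameter in `Γ`. -/
structure RatioBounds (Γ : Set (Matrix ι ι ℝ)) (C η : ℝ) : Prop where
  C_pos : 0 < C
  nonneg : 0 ≤ η
  lt_half : η < 1 / 2
  lower : ∀ R ∈ Γ, ∀ z, Real.exp (-(C + C * (z ⬝ᵥ z))) ≤ gaussianRatio R z
  upper : ∀ R ∈ Γ, ∀ z, gaussianRatio R z ≤ Real.exp (C + η * (z ⬝ᵥ z))

/-- The exponent is (|z|² - zᵀR⁻¹z)/2 up to the log-determinant. Compactness bounds the determinant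
term and the entries of R⁻¹; the diagonal being one gives zᵀR⁻¹z ≥ |z|²/k for k > 0, which keeps η
strictly below 1/2. -/
lemma exists_ratioBounds {Γ : Set (Matrix ι ι ℝ)} (hΓ : IsCompact Γ)
    (hcorr : ∀ R ∈ Γ, IsCorrelation R) :
    ∃ C η : ℝ, RatioBounds Γ C η := by
  have hdet : ContinuousOn (fun R : Matrix ι ι ℝ => Real.log (Real.sqrt R.det)) Γ := by
    refine ContinuousOn.log ?_ fun R hR => (Real.sqrt_pos.2 (hcorr R hR).1.det_pos).ne'
    exact (Real.continuous_sqrt.comp (Continuous.matrix_det continuous_id)).continuousOn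
  obtain ⟨C₁, hC₁⟩ := hΓ.exists_bound_of_continuousOn hdet
  have hinv : ∀ i j, ∃ m, ∀ R ∈ Γ, ‖R⁻¹ i j‖ ≤ m := fun i j =>
    hΓ.exists_bound_of_continuousOn (f := fun R : Matrix ι ι ℝ => R⁻¹ i j)
      (continuousOn_pi.1 (continuousOn_pi.1 (continuousOn_matrix_inv hcorr) i) j)
  choose m hm using hinv
  set m' : ℝ := ∑ i, ∑ j, |m i j| with hm'
  have hmm : ∀ R ∈ Γ, ∀ i j, |R⁻¹ i j| ≤ m' := by
    intro R hR i j
    calc |R⁻¹ i j| ≤ |m i j| := (hm i j R hR).trans (le_abs_self _)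
      _ ≤ ∑ j, |m i j| := Finset.single_le_sum (f := fun j => |m i j|)
          (fun _ _ => abs_nonneg _) (Finset.mem_univ j)
      _ ≤ m' := Finset.single_le_sum (f := fun i => ∑ j, |m i j|)
          (fun _ _ => Finset.sum_nonneg fun _ _ => abs_nonneg _) (Finset.mem_univ i)
  have hm'0 : 0 ≤ m' := Finset.sum_nonneg fun _ _ => Finset.sum_nonneg fun _ _ => abs_nonneg _
  set k : ℝ := (Fintype.card ι : ℝ) with hk
  have hk0 : 0 ≤ k := Nat.cast_nonneg _
  -- Using k + 1 in place of k keeps η < 1/2 even when the index type is empty.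
  suffices h : ∀ R ∈ Γ, ∀ z,
      Real.exp (-((|C₁| + m' * k + 1) + (|C₁| + m' * k + 1) * (z ⬝ᵥ z))) ≤ gaussianRatio R z ∧
        gaussianRatio R z ≤
          Real.exp ((|C₁| + m' * k + 1) + 1 / 2 * (1 - 1 / (k + 1)) * (z ⬝ᵥ z)) by
    refine ⟨_, _, by positivity, ?_, ?_, fun R hR z => (h R hR z).1, fun R hR z => (h R hR z).2⟩
    · have : 1 / (k + 1) ≤ 1 := by
        rw [div_le_one (by linarith)]
        linarith
      linarith
    · have : 0 < 1 / (k + 1) := by positivity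
      linarith
  intro R hR z
  have hzz : 0 ≤ z ⬝ᵥ z := by
    simp only [dotProduct]
    exact Finset.sum_nonneg fun i _ => mul_self_nonneg _
  have hsq : 0 < Real.sqrt R.det := Real.sqrt_pos.2 (hcorr R hR).1.det_pos
  have hform : gaussianRatio R z = Real.exp (-Real.log (Real.sqrt R.det) +
      (1 / 2 * (z ⬝ᵥ z) - 1 / 2 * (z ⬝ᵥ (R⁻¹ *ᵥ z)))) := by
    rw [Real.exp_add, Real.exp_neg, Real.exp_log hsq, gaussianRatio, Matrix.sub_mulVec,
      Matrix.one_mulVec, dotProduct_sub]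
    congr 2
    ring
  have hlog := abs_le.1 ((hC₁ R hR).trans (le_abs_self _))
  have hq := (abs_le.1 (abs_dotProduct_mulVec_le (hmm R hR) z)).2
  have hq' := (hcorr R hR).dotProduct_self_le z
  rw [hform]
  have hmk : 0 ≤ m' * k := mul_nonneg hm'0 hk0
  constructor
  · refine Real.exp_le_exp.2 ?_
    have := abs_nonneg C₁
    nlinarith [hlog.2, mul_nonneg hmk hzz, mul_nonneg this hzz]
  · refine Real.exp_le_exp.2 ?_
    have hq0 : 0 ≤ z ⬝ᵥ (R⁻¹ *ᵥ z) := by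
      rcases isEmpty_or_nonempty ι with hι | ⟨⟨i⟩⟩
      · simp
      · exact (sq_nonneg _).trans ((hcorr R hR).sq_le_dotProduct_inv z i)
    have h1 : 1 / (k + 1) * (z ⬝ᵥ z) ≤ z ⬝ᵥ (R⁻¹ *ᵥ z) := by
      rw [div_mul_eq_mul_div, one_mul, div_le_iff₀ (by linarith)]
      nlinarith
    nlinarith [hlog.1]

end RatioBounds

/-! ### Integrals of the Gaussian copula density over boxes -/

section BoxIntegral

variable {α β : Type*}

/-- The cube `[0,1]^β`. -/
def unitCube (β : Type*) : Set (β → ℝ) := Set.pi univ fun _ => Icc (0 : ℝ) 1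

lemma pi_Ioc_subset_unitCube {a b : β → ℝ} (ha : ∀ j, 0 ≤ a j) (hb : ∀ j, b j ≤ 1) :
    (Set.pi univ fun j => Ioc (a j) (b j)) ⊆ unitCube β := fun _ hv j hj =>
  ⟨(ha j).trans (hv j hj).1.le, (hv j hj).2.trans (hb j)⟩

lemma measurable_sumElim : Measurable fun p : (α → ℝ) × (β → ℝ) => Sum.elim p.1 p.2 := by
  refine measurable_pi_iff.2 ?_
  rintro (i | j)
  · exact (measurable_pi_apply i).comp measurable_fst
  · exact (measurable_pi_apply j).comp measurable_snd

variable [Fintype α] [Fintype β]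

lemma integrable_exp_sq_gaussianReal {η : ℝ} (hη : η < 1 / 2) :
    Integrable (fun x : ℝ => Real.exp (η * x ^ 2)) (gaussianReal 0 1) := by
  rw [gaussianReal_of_var_ne_zero _ one_ne_zero,
    integrable_withDensity_iff (measurable_gaussianPDF 0 1)
      (ae_of_all _ fun x => ENNReal.ofReal_lt_top)]
  have h : ∀ x : ℝ, Real.exp (η * x ^ 2) * (gaussianPDF 0 1 x).toReal =
      (Real.sqrt (2 * Real.pi))⁻¹ * Real.exp (-(1 / 2 - η) * x ^ 2) := by
    intro x
    rw [toReal_gaussianPDF, gaussianPDFReal, mul_left_comm]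
    simp only [NNReal.coe_one, mul_one, sub_zero]
    rw [← Real.exp_add]
    congr 2
    ring
  simp_rw [h]
  exact (integrable_exp_neg_mul_sq (by linarith)).const_mul _

lemma integrableOn_prod_exp_sq_probit {η : ℝ} (hη : η < 1 / 2) :
    IntegrableOn (fun v : β → ℝ => ∏ j, Real.exp (η * probit (v j) ^ 2)) (unitCube β) := by
  rw [IntegrableOn, unitCube, volume_pi, Measure.restrict_pi_pi]
  refine Integrable.fintype_prod (f := fun _ x => Real.exp (η * probit x ^ 2)) fun j => ?_
  have h := integrable_exp_sq_gaussianReal hη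
  rw [← map_probit_volume] at h
  exact h.comp_measurable measurable_probit

lemma measurableSet_pi_Ioc (a b : β → ℝ) :
    MeasurableSet (Set.pi univ fun j => Ioc (a j) (b j)) :=
  MeasurableSet.univ_pi fun _ => measurableSet_Ioc

lemma probit_dotProduct_sumElim (u : α → ℝ) (v : β → ℝ) :
    (fun i => probit (Sum.elim u v i)) ⬝ᵥ (fun i => probit (Sum.elim u v i)) =
      (∑ i, probit (u i) ^ 2) + ∑ j, probit (v j) ^ 2 := by
  simp [dotProduct, Fintype.sum_sum_type, sq]

variable [DecidableEq α] [DecidableEq β]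

/-- The integral of the Gaussian copula density over a box in the last coordinates. -/
noncomputable def boxIntegral (R : Matrix (α ⊕ β) (α ⊕ β) ℝ) (u : α → ℝ) (a b : β → ℝ) : ℝ :=
  ∫ v in Set.pi univ fun j => Ioc (a j) (b j), gaussianCopulaDensity R (Sum.elim u v)

lemma gaussianCopulaDensity_nonneg {ι : Type*} [Fintype ι] [DecidableEq ι] (R : Matrix ι ι ℝ)
    (u : ι → ℝ) : 0 ≤ gaussianCopulaDensity R u :=
  mul_nonneg (inv_nonneg.2 (Real.sqrt_nonneg _)) (Real.exp_nonneg _)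

lemma measurable_gaussianCopulaDensity {ι : Type*} [Fintype ι] [DecidableEq ι]
    (R : Matrix ι ι ℝ) : Measurable (gaussianCopulaDensity R) := by
  have hpm : Measurable fun (u : ι → ℝ) i => probit (u i) :=
    measurable_pi_iff.2 fun i => measurable_probit.comp (measurable_pi_apply i)
  exact (continuous_gaussianRatio R).measurable.comp hpm

lemma measurable_density_sumElim (R : Matrix (α ⊕ β) (α ⊕ β) ℝ) :
    Measurable fun p : (α → ℝ) × (β → ℝ) => gaussianCopulaDensity R (Sum.elim p.1 p.2) :=
  (measurable_gaussianCopulaDensity R).comp measurable_sumElim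

lemma measurable_boxIntegral (R : Matrix (α ⊕ β) (α ⊕ β) ℝ) :
    Measurable fun w : (α → ℝ) × (β → ℝ) × (β → ℝ) => boxIntegral R w.1 w.2.1 w.2.2 := by
  have hset : MeasurableSet {q : ((α → ℝ) × (β → ℝ) × (β → ℝ)) × (β → ℝ) |
      q.2 ∈ Set.pi univ fun j => Ioc (q.1.2.1 j) (q.1.2.2 j)} := by
    have : {q : ((α → ℝ) × (β → ℝ) × (β → ℝ)) × (β → ℝ) |
        q.2 ∈ Set.pi univ fun j => Ioc (q.1.2.1 j) (q.1.2.2 j)} =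
        ⋂ j, ({q | q.1.2.1 j < q.2 j} ∩ {q | q.2 j ≤ q.1.2.2 j}) := by
      ext q
      simp [Set.mem_pi]
    rw [this]
    refine MeasurableSet.iInter fun j => ?_
    exact (measurableSet_lt (by fun_prop) (by fun_prop)).inter
      (measurableSet_le (by fun_prop) (by fun_prop))
  have hf : Measurable fun q : ((α → ℝ) × (β → ℝ) × (β → ℝ)) × (β → ℝ) =>
      {q : ((α → ℝ) × (β → ℝ) × (β → ℝ)) × (β → ℝ) |
        q.2 ∈ Set.pi univ fun j => Ioc (q.1.2.1 j) (q.1.2.2 j)}.indicator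
        (fun q => gaussianCopulaDensity R (Sum.elim q.1.1 q.2)) q :=
    ((measurable_density_sumElim R).comp
      ((measurable_fst.comp measurable_fst).prodMk measurable_snd)).indicator hset
  convert (hf.stronglyMeasurable.integral_prod_right' (ν := volume)).measurable using 2 with w
  rw [boxIntegral, ← integral_indicator (measurableSet_pi_Ioc _ _)]
  rfl

variable {Γ : Set (Matrix (α ⊕ β) (α ⊕ β) ℝ)} {C η : ℝ}

lemma RatioBounds.density_le (h : RatioBounds Γ C η) {R} (hR : R ∈ Γ) (u : α → ℝ) (v : β → ℝ) :
    gaussianCopulaDensity R (Sum.elim u v) ≤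
      Real.exp (C + η * ∑ i, probit (u i) ^ 2) * ∏ j, Real.exp (η * probit (v j) ^ 2) := by
  refine (h.upper R hR _).trans (le_of_eq ?_)
  rw [probit_dotProduct_sumElim, ← Real.exp_sum, ← Real.exp_add, ← Finset.mul_sum]
  congr 1
  ring

lemma RatioBounds.integrableOn_density (h : RatioBounds Γ C η) {R} (hR : R ∈ Γ) (u : α → ℝ) :
    IntegrableOn (fun v : β → ℝ => gaussianCopulaDensity R (Sum.elim u v)) (unitCube β) := by
  refine Integrable.mono' ((integrableOn_prod_exp_sq_probit h.lt_half).const_mul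
    (Real.exp (C + η * ∑ i, probit (u i) ^ 2))) ?_ (ae_of_all _ fun v => ?_)
  · exact ((measurable_density_sumElim R).comp measurable_prodMk_left).aestronglyMeasurable
  · rw [Real.norm_of_nonneg (gaussianCopulaDensity_nonneg _ _)]
    exact h.density_le hR u v

lemma RatioBounds.boxIntegral_le (h : RatioBounds Γ C η) {R} (hR : R ∈ Γ) (u : α → ℝ)
    {a b : β → ℝ} (ha : ∀ j, 0 ≤ a j) (hb : ∀ j, b j ≤ 1) :
    boxIntegral R u a b ≤ Real.exp (C + η * ∑ i, probit (u i) ^ 2) *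
      ∫ v in unitCube β, ∏ j, Real.exp (η * probit (v j) ^ 2) := by
  rw [← integral_const_mul]
  have hsub := pi_Ioc_subset_unitCube ha hb
  have hint := (integrableOn_prod_exp_sq_probit (β := β) h.lt_half).const_mul
    (Real.exp (C + η * ∑ i, probit (u i) ^ 2))
  refine (setIntegral_mono ((h.integrableOn_density hR u).mono_set hsub)
    (IntegrableOn.mono_set hint hsub) fun v => h.density_le hR u v).trans ?_
  exact setIntegral_mono_set hint (ae_of_all _ fun v => by positivity) hsub.eventuallyLE

/-- Only the middle half of each side is kept. There v_j stays at distance at least (b_j - a_j)/4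
from 0 and 1, so `sq_probit_le` bounds the exponent. -/
lemma RatioBounds.le_boxIntegral (h : RatioBounds Γ C η) {R} (hR : R ∈ Γ) (u : α → ℝ)
    {a b : β → ℝ} (ha : ∀ j, 0 ≤ a j) (hb : ∀ j, b j ≤ 1) (hab : ∀ j, a j < b j) :
    Real.exp (-(C + C * ((∑ i, probit (u i) ^ 2) +
      ∑ j, 4 * (Real.log 4 - Real.log (b j - a j))))) * ∏ j, ((b j - a j) / 2) ≤
      boxIntegral R u a b := by
  set J : Set (β → ℝ) :=
    Set.pi univ fun j => Ioc (a j + (b j - a j) / 4) (b j - (b j - a j) / 4) with hJ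
  have hsub := pi_Ioc_subset_unitCube ha hb
  have hJsub : J ⊆ Set.pi univ fun j => Ioc (a j) (b j) := by
    intro v hv j hj
    have := hab j
    exact ⟨by linarith [(hv j hj).1], by linarith [(hv j hj).2]⟩
  have hvol : (volume : Measure (β → ℝ)).real J = ∏ j, ((b j - a j) / 2) := by
    rw [measureReal_def, hJ, Real.volume_pi_Ioc_toReal fun j => by linarith [hab j]]
    exact Finset.prod_congr rfl fun j _ => by ring
  have hint := (h.integrableOn_density hR u).mono_set hsub
  have hfin : volume J ≠ ⊤ := by
    rw [hJ, Real.volume_pi_Ioc]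
    exact ENNReal.prod_ne_top fun _ _ => ENNReal.ofReal_ne_top
  calc _ = _ * (volume : Measure (β → ℝ)).real J := by rw [hvol]
    _ ≤ ∫ v in J, gaussianCopulaDensity R (Sum.elim u v) := by
        refine setIntegral_ge_of_const_le_real (measurableSet_pi_Ioc _ _) hfin (fun v hv => ?_)
          (hint.mono_set hJsub)
        refine le_trans (Real.exp_le_exp.2 (neg_le_neg ?_)) (h.lower R hR _)
        rw [probit_dotProduct_sumElim]
        have hv' : ∑ j, probit (v j) ^ 2 ≤
            ∑ j, 4 * (Real.log 4 - Real.log (b j - a j)) := by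
          refine Finset.sum_le_sum fun j _ => ?_
          have hj := hv j (mem_univ j)
          have hab' := sub_pos.2 (hab j)
          have hv1 : (b j - a j) / 4 ≤ v j := by linarith [hj.1, ha j]
          have hv2 : (b j - a j) / 4 ≤ 1 - v j := by linarith [hj.2, hb j]
          have hv3 : v j ∈ Ioo (0 : ℝ) 1 := ⟨by linarith, by linarith⟩
          have h1 := Real.log_le_log (by linarith) hv1
          have h2 := Real.log_le_log (by linarith) hv2
          rw [Real.log_div hab'.ne' (by norm_num)] at h1 h2
          linarith [sq_probit_le hv3]
        have := h.C_pos
        gcongr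
    _ ≤ boxIntegral R u a b :=
        setIntegral_mono_set hint (ae_of_all _ fun v => gaussianCopulaDensity_nonneg _ _)
          hJsub.eventuallyLE

lemma RatioBounds.boxIntegral_pos (h : RatioBounds Γ C η) {R} (hR : R ∈ Γ) (u : α → ℝ)
    {a b : β → ℝ} (ha : ∀ j, 0 ≤ a j) (hb : ∀ j, b j ≤ 1) (hab : ∀ j, a j < b j) :
    0 < boxIntegral R u a b :=
  lt_of_lt_of_le (mul_pos (Real.exp_pos _) (Finset.prod_pos fun j _ => by linarith [hab j]))
    (h.le_boxIntegral hR u ha hb hab)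

/-- Logarithms of the two preceding bounds. The right-hand side consists exactly of terms that (G2)
and (G3) control, since b_j - a_j will be a probability mass. -/
lemma RatioBounds.exists_abs_log_boxIntegral_le (h : RatioBounds Γ C η) :
    ∃ K : ℝ, 0 ≤ K ∧ ∀ R ∈ Γ, ∀ (u : α → ℝ) (a b : β → ℝ), (∀ i, u i ∈ Ioo (0 : ℝ) 1) →
      (∀ j, 0 ≤ a j) → (∀ j, b j ≤ 1) → (∀ j, a j < b j) →
      |Real.log (boxIntegral R u a b)| ≤ K * (1 + ∑ i, (-Real.log (u i) + -Real.log (1 - u i)) +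
        ∑ j, -Real.log (b j - a j)) := by
  set I := ∫ v in unitCube β, ∏ j, Real.exp (η * probit (v j) ^ 2)
  set n : ℝ := (Fintype.card β : ℝ)
  have hn : 0 ≤ n := Nat.cast_nonneg _
  have hC := h.C_pos
  have hl4 : 0 < Real.log 4 := Real.log_pos (by norm_num)
  have hl2 : 0 < Real.log 2 := Real.log_pos (by norm_num)
  refine ⟨C + |Real.log I| + 2 * C + 1 + 4 * C * n * Real.log 4 + 4 * C + n * Real.log 2,
    by positivity, ?_⟩
  intro R hR u a b hu ha hb hab
  have hpos := h.boxIntegral_pos hR u ha hb hab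
  set Su := ∑ i, (-Real.log (u i) + -Real.log (1 - u i)) with hSu
  set Sp := ∑ j, -Real.log (b j - a j) with hSp
  have hSu0 : 0 ≤ Su := Finset.sum_nonneg fun i _ => by
    linarith [Real.log_nonpos (hu i).1.le (hu i).2.le,
      Real.log_nonpos (x := 1 - u i) (by linarith [(hu i).2]) (by linarith [(hu i).1])]
  have hSp0 : 0 ≤ Sp := Finset.sum_nonneg fun j _ => by
    linarith [Real.log_nonpos (x := b j - a j) (by linarith [hab j]) (by linarith [ha j, hb j])]
  have hz : ∑ i, probit (u i) ^ 2 ≤ 2 * Su := by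
    rw [hSu, Finset.mul_sum]
    exact Finset.sum_le_sum fun i _ => by linarith [sq_probit_le (hu i)]
  have hz0 : 0 ≤ ∑ i, probit (u i) ^ 2 := Finset.sum_nonneg fun i _ => sq_nonneg _
  -- A nonpositive `I` would contradict positivity of the box integral through the upper bound.
  have hI : 0 < I := by
    by_contra! hI
    have := h.boxIntegral_le hR u ha hb
    have := mul_nonpos_of_nonneg_of_nonpos (Real.exp_nonneg (C + η * ∑ i, probit (u i) ^ 2)) hI
    linarith
  have hupper := Real.log_le_log hpos (h.boxIntegral_le hR u ha hb)
  rw [Real.log_mul (Real.exp_ne_zero _) hI.ne', Real.log_exp] at hupper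
  have hprod : 0 < ∏ j, ((b j - a j) / 2) := Finset.prod_pos fun j _ => by linarith [hab j]
  have hlower := Real.log_le_log (mul_pos (Real.exp_pos _) hprod)
    (h.le_boxIntegral hR u ha hb hab)
  have hlogprod : Real.log (∏ j, ((b j - a j) / 2)) = -Sp - n * Real.log 2 := by
    rw [Real.log_prod fun j _ => by linarith [hab j]]
    have : ∀ j, Real.log ((b j - a j) / 2) = Real.log (b j - a j) - Real.log 2 := fun j =>
      Real.log_div (by linarith [hab j]) (by norm_num)
    simp_rw [this, Finset.sum_sub_distrib, Finset.sum_const, Finset.card_univ, nsmul_eq_mul]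
    rw [hSp, Finset.sum_neg_distrib, neg_neg]
  have hsum4 : ∑ j, 4 * (Real.log 4 - Real.log (b j - a j)) = 4 * n * Real.log 4 + 4 * Sp := by
    simp_rw [← Finset.mul_sum, Finset.sum_sub_distrib, Finset.sum_const, Finset.card_univ,
      nsmul_eq_mul]
    rw [hSp, Finset.sum_neg_distrib]
    ring
  rw [Real.log_mul (Real.exp_ne_zero _) hprod.ne', Real.log_exp, hlogprod, hsum4] at hlower
  have hIabs := abs_nonneg (Real.log I)
  have hIle := le_abs_self (Real.log I)
  have hη := h.lt_half
  have hnl4 : 0 ≤ C * n * Real.log 4 := by positivity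
  have hnl2 : 0 ≤ n * Real.log 2 := by positivity
  have hηz : η * ∑ i, probit (u i) ^ 2 ≤ Su := by nlinarith [h.nonneg]
  have hCz : C * ∑ i, probit (u i) ^ 2 ≤ 2 * C * Su := by nlinarith
  have e1 : 0 ≤ C * Su := by positivity
  have e2 : 0 ≤ C * Sp := by positivity
  have e3 : 0 ≤ |Real.log I| * Su := by positivity
  have e4 : 0 ≤ |Real.log I| * Sp := by positivity
  have e5 : 0 ≤ C * n * Real.log 4 * Su := by positivity
  have e6 : 0 ≤ C * n * Real.log 4 * Sp := by positivity
  have e7 : 0 ≤ n * Real.log 2 * Su := by positivity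
  have e8 : 0 ≤ n * Real.log 2 * Sp := by positivity
  rw [abs_le]
  constructor <;> linarith

lemma continuousOn_gaussianRatio {ι : Type*} [Fintype ι] [DecidableEq ι]
    {Γ : Set (Matrix ι ι ℝ)} (hΓ : ∀ R ∈ Γ, IsCorrelation R) :
    ContinuousOn (fun p : Matrix ι ι ℝ × (ι → ℝ) => gaussianRatio p.1 p.2) (Γ ×ˢ univ) := by
  have hdet : ContinuousOn (fun p : Matrix ι ι ℝ × (ι → ℝ) => (Real.sqrt p.1.det)⁻¹)
      (Γ ×ˢ univ) := by
    refine ContinuousOn.inv₀ ?_ fun p hp => (Real.sqrt_pos.2 (hΓ p.1 hp.1).1.det_pos).ne'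
    exact (Real.continuous_sqrt.comp (Continuous.matrix_det continuous_fst)).continuousOn
  have hinv : ContinuousOn (fun p : Matrix ι ι ℝ × (ι → ℝ) => p.1⁻¹ - 1) (Γ ×ˢ univ) :=
    ((continuousOn_matrix_inv hΓ).comp continuousOn_fst fun p hp => hp.1).sub continuousOn_const
  refine hdet.mul (Real.continuous_exp.comp_continuousOn (continuousOn_const.mul ?_))
  have hc : Continuous fun q : Matrix ι ι ℝ × (ι → ℝ) => q.2 ⬝ᵥ (q.1 *ᵥ q.2) := by fun_prop
  exact hc.comp_continuousOn (hinv.prodMk continuousOn_snd)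

/-- The parameters for which the box integrals depend continuously on them. -/
def boxDomain (Γ : Set (Matrix (α ⊕ β) (α ⊕ β) ℝ)) :
    Set (Matrix (α ⊕ β) (α ⊕ β) ℝ × (α → ℝ) × (β → ℝ) × (β → ℝ)) :=
  {w | w.1 ∈ Γ ∧ (∀ i, w.2.1 i ∈ Ioo (0 : ℝ) 1) ∧ (∀ j, 0 ≤ w.2.2.1 j) ∧ ∀ j, w.2.2.2 j ≤ 1}

lemma continuousOn_density_boxDomain (hΓ : ∀ R ∈ Γ, IsCorrelation R) (v : β → ℝ) :
    ContinuousOn (fun w : Matrix (α ⊕ β) (α ⊕ β) ℝ × (α → ℝ) × (β → ℝ) × (β → ℝ) =>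
      gaussianCopulaDensity w.1 (Sum.elim w.2.1 v)) (boxDomain Γ) := by
  have hz : ContinuousOn (fun w : Matrix (α ⊕ β) (α ⊕ β) ℝ × (α → ℝ) × (β → ℝ) × (β → ℝ) =>
      fun i => probit (Sum.elim w.2.1 v i)) (boxDomain Γ) := by
    refine continuousOn_pi.2 ?_
    rintro (i | j)
    · simp only [Sum.elim_inl]
      exact continuousOn_probit.comp (by fun_prop) fun w hw => hw.2.1 i
    · simp only [Sum.elim_inr]
      exact continuousOn_const
  exact (continuousOn_gaussianRatio hΓ).comp (continuousOn_fst.prodMk hz)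
    fun w hw => ⟨hw.1, mem_univ _⟩

/-- Dominated convergence on the fixed unit cube, the moving box being an indicator. The dominating
function freezes the factor in `u` at its limit value plus one. -/
lemma RatioBounds.continuousOn_boxIntegral (h : RatioBounds Γ C η)
    (hΓ : ∀ R ∈ Γ, IsCorrelation R) :
    ContinuousOn (fun w : Matrix (α ⊕ β) (α ⊕ β) ℝ × (α → ℝ) × (β → ℝ) × (β → ℝ) =>
      boxIntegral w.1 w.2.1 w.2.2.1 w.2.2.2) (boxDomain Γ) := by
  have : FirstCountableTopology (Matrix (α ⊕ β) (α ⊕ β) ℝ) :=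
    inferInstanceAs (FirstCountableTopology (α ⊕ β → α ⊕ β → ℝ))
  intro w₀ hw₀
  set B : Matrix (α ⊕ β) (α ⊕ β) ℝ × (α → ℝ) × (β → ℝ) × (β → ℝ) → Set (β → ℝ) := fun w =>
    Set.pi univ fun j => Ioc (w.2.2.1 j) (w.2.2.2 j) with hB
  have hform : ∀ w ∈ boxDomain Γ, boxIntegral w.1 w.2.1 w.2.2.1 w.2.2.2 =
      ∫ v in unitCube β, (B w).indicator
        (fun v => gaussianCopulaDensity w.1 (Sum.elim w.2.1 v)) v := by
    intro w hw
    rw [integral_indicator (measurableSet_pi_Ioc _ _),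
      Measure.restrict_restrict (measurableSet_pi_Ioc _ _),
      inter_eq_left.2 (pi_Ioc_subset_unitCube hw.2.2.1 hw.2.2.2)]
    rfl
  rw [ContinuousWithinAt, hform w₀ hw₀]
  refine Tendsto.congr' (f₁ := fun w => ∫ v in unitCube β, (B w).indicator
        (fun v => gaussianCopulaDensity w.1 (Sum.elim w.2.1 v)) v)
    (eventually_mem_nhdsWithin.mono fun w hw => (hform w hw).symm) ?_
  have hsum : ContinuousOn (fun w : Matrix (α ⊕ β) (α ⊕ β) ℝ × (α → ℝ) × (β → ℝ) × (β → ℝ) =>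
      ∑ i, probit (w.2.1 i) ^ 2) (boxDomain Γ) :=
    continuousOn_finsetSum _ fun i _ =>
      (continuousOn_probit.comp (by fun_prop) fun w hw => hw.2.1 i).pow 2
  refine tendsto_integral_filter_of_dominated_convergence (fun v : β → ℝ =>
    Real.exp (C + η * ((∑ i, probit (w₀.2.1 i) ^ 2) + 1)) *
      ∏ j, Real.exp (η * probit (v j) ^ 2)) ?_ ?_ ?_ ?_
  · refine Eventually.of_forall fun w => ?_
    exact (((measurable_density_sumElim w.1).comp measurable_prodMk_left).indicator
      (measurableSet_pi_Ioc _ _)).aestronglyMeasurable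
  · filter_upwards [eventually_mem_nhdsWithin,
      (hsum w₀ hw₀).eventually_lt_const (lt_add_one _)] with w hw hlt
    refine ae_of_all _ fun v => ?_
    rw [Real.norm_of_nonneg (indicator_nonneg (fun _ _ => gaussianCopulaDensity_nonneg _ _) _)]
    refine (indicator_le_self' (fun _ _ => gaussianCopulaDensity_nonneg _ _) v).trans ?_
    refine (h.density_le hw.1 _ v).trans ?_
    have := h.nonneg
    gcongr
  · exact (integrableOn_prod_exp_sq_probit h.lt_half).const_mul _
  -- Off the null set of points sharing a coordinate with an endpoint of the limit box, membership
  -- in the box is locally constant in the endpoints.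
  · have hne : ∀ c : β → ℝ, ∀ᵐ v ∂(volume : Measure (β → ℝ)).restrict (unitCube β),
        ∀ j, v j ≠ c j := fun c => ae_restrict_of_ae
      (ae_all_iff.2 fun j => Measure.ae_eval_ne (μ := fun _ : β => (volume : Measure ℝ)) j (c j))
    filter_upwards [hne w₀.2.2.1, hne w₀.2.2.2] with v hva hvb
    have hd := continuousOn_density_boxDomain hΓ v w₀ hw₀
    have hat : ∀ j, Tendsto (fun w : Matrix (α ⊕ β) (α ⊕ β) ℝ × (α → ℝ) × (β → ℝ) × (β → ℝ) =>
        w.2.2.1 j) (𝓝[boxDomain Γ] w₀) (𝓝 (w₀.2.2.1 j)) := fun j =>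
      (Continuous.tendsto (by fun_prop) w₀).mono_left nhdsWithin_le_nhds
    have hbt : ∀ j, Tendsto (fun w : Matrix (α ⊕ β) (α ⊕ β) ℝ × (α → ℝ) × (β → ℝ) × (β → ℝ) =>
        w.2.2.2 j) (𝓝[boxDomain Γ] w₀) (𝓝 (w₀.2.2.2 j)) := fun j =>
      (Continuous.tendsto (by fun_prop) w₀).mono_left nhdsWithin_le_nhds
    by_cases hvB : v ∈ B w₀
    · rw [indicator_of_mem hvB]
      have hev : ∀ᶠ w in 𝓝[boxDomain Γ] w₀, v ∈ B w := by
        have h1 : ∀ᶠ w in 𝓝[boxDomain Γ] w₀, ∀ j, w.2.2.1 j < v j ∧ v j < w.2.2.2 j :=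
          eventually_all.2 fun j =>
            ((hat j).eventually_lt_const (hvB j (mem_univ j)).1).and
              ((hbt j).eventually_const_lt
                (lt_of_le_of_ne (hvB j (mem_univ j)).2 (hvb j)))
        exact h1.mono fun w hw j _ => ⟨(hw j).1, (hw j).2.le⟩
      exact hd.congr' (hev.mono fun w hw => (indicator_of_mem hw _).symm)
    · rw [indicator_of_notMem hvB]
      have hev : ∀ᶠ w in 𝓝[boxDomain Γ] w₀, v ∉ B w := by
        have : ∃ j, v j ∉ Ioc (w₀.2.2.1 j) (w₀.2.2.2 j) := by
          by_contra! hcon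
          exact hvB fun j _ => hcon j
        obtain ⟨j, hj⟩ := this
        rcases le_or_gt (v j) (w₀.2.2.1 j) with hle | hgt
        · filter_upwards [(hat j).eventually_const_lt (lt_of_le_of_ne hle (hva j))] with w hw hmem
          exact absurd (hmem j (mem_univ j)).1 (not_lt.2 hw.le)
        · have hlt : w₀.2.2.2 j < v j := by
            by_contra! hcon
            exact hj ⟨hgt, hcon⟩
          filter_upwards [(hbt j).eventually_lt_const hlt] with w hw hmem
          exact absurd (hmem j (mem_univ j)).2 (not_le.2 hw)
      exact tendsto_const_nhds.congr' (hev.mono fun w hw => (indicator_of_notMem hw _).symm)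

end BoxIntegral

/-! ### Marginal families -/

namespace Margins

variable {ℓ r : ℕ} {M : Margins ℓ r}

lemma Valid.ae_nat (hM : M.Valid) (j : Fin r) {s : ℝ} (hs : s ∈ M.G (Sum.inr j)) :
    ∀ᵐ y ∂M.law (Sum.inr j) s, y ∈ range (Nat.cast : ℕ → ℝ) := by
  by_cases hj : j ∈ M.count
  · exact hM.count_support j hj s hs
  · have h : ∀ᵐ y ∂M.law (Sum.inr j) s, y ∈ ({0, 1} : Set ℝ) := hM.binary_support j hj s hs
    filter_upwards [h] with y hy
    rcases hy with rfl | rfl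
    · exact ⟨0, Nat.cast_zero⟩
    · exact ⟨1, Nat.cast_one⟩

/-- For an integer n, n < y means n ≤ ⌈y⌉ - 1. Left limits thus inherit continuity and measurability
in the parameter from the cdf. -/
lemma Valid.FLeft_eq (hM : M.Valid) (j : Fin r) {s : ℝ} (hs : s ∈ M.G (Sum.inr j)) (y : ℝ) :
    M.FLeft (Sum.inr j) s y = M.F (Sum.inr j) s (⌈y⌉ - 1) := by
  refine measureReal_congr ?_
  filter_upwards [hM.ae_nat j hs] with x hx
  obtain ⟨n, rfl⟩ := hx
  refine propext ?_
  change (n : ℝ) < y ↔ (n : ℝ) ≤ ⌈y⌉ - 1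
  have h1 : ((n : ℤ) : ℝ) < y ↔ (n : ℤ) < ⌈y⌉ := Int.lt_ceil.symm
  have h2 : ((n : ℤ) : ℝ) ≤ ⌈y⌉ - 1 ↔ (n : ℤ) ≤ ⌈y⌉ - 1 := by
    rw [← Int.cast_one, ← Int.cast_sub, Int.cast_le]
  rw [Int.cast_natCast] at h1 h2
  rw [h1, h2, Int.le_sub_one_iff]

lemma Valid.pDisc_eq (hM : M.Valid) (j : Fin r) {s : ℝ} (hs : s ∈ M.G (Sum.inr j)) (y : ℝ) :
    M.pDisc j s y = M.F (Sum.inr j) s y - M.FLeft (Sum.inr j) s y := by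
  have := hM.isProbabilityMeasure _ s hs
  have h : M.F (Sum.inr j) s y = M.FLeft (Sum.inr j) s y + M.pDisc j s y := by
    rw [F, FLeft, pDisc, ← measureReal_union (by simp) (measurableSet_singleton y),
      Iio_union_right]
  linarith

lemma Valid.pDisc_zero (hM : M.Valid) (j : Fin r) {s : ℝ} (hs : s ∈ M.G (Sum.inr j)) :
    M.pDisc j s 0 = M.F (Sum.inr j) s 0 := by
  have : M.FLeft (Sum.inr j) s 0 = 0 := by
    rw [FLeft, measureReal_def]
    have : M.law (Sum.inr j) s (Iio 0) = 0 := by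
      refine measure_mono_null ?_ (hM.ae_nat j hs)
      rintro x hx ⟨n, rfl⟩
      exact absurd (mem_Iio.1 hx) (not_lt.2 n.cast_nonneg)
    rw [this, ENNReal.toReal_zero]
  rw [hM.pDisc_eq j hs, this, sub_zero]

lemma F_nonneg (i : Idx ℓ r) (s y : ℝ) : 0 ≤ M.F i s y := measureReal_nonneg

lemma Valid.F_le_one (hM : M.Valid) (i : Idx ℓ r) {s : ℝ} (hs : s ∈ M.G i) (y : ℝ) :
    M.F i s y ≤ 1 := by
  have := hM.isProbabilityMeasure i s hs
  exact measureReal_le_one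

lemma Valid.strictMono_F (hM : M.Valid) (i : Fin ℓ) {s : ℝ} (hs : s ∈ M.G (Sum.inl i)) :
    StrictMono (M.F (Sum.inl i) s) :=
  strictMono_of_deriv_pos fun y => hM.pCont_pos i s hs y

lemma Valid.F_mem_Ioo (hM : M.Valid) (i : Fin ℓ) {s : ℝ} (hs : s ∈ M.G (Sum.inl i)) (y : ℝ) :
    M.F (Sum.inl i) s y ∈ Ioo (0 : ℝ) 1 :=
  ⟨(F_nonneg _ _ _).trans_lt (hM.strictMono_F i hs (sub_one_lt y)),
    (hM.strictMono_F i hs (lt_add_one y)).trans_le (hM.F_le_one _ hs _)⟩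

lemma Valid.F_quantile (hM : M.Valid) (i : Fin ℓ) {s : ℝ} (hs : s ∈ M.G (Sum.inl i)) {u : ℝ}
    (hu : u ∈ Ioo (0 : ℝ) 1) :
    M.F (Sum.inl i) s (quantile (M.law (Sum.inl i) s) u) = u := by
  have := hM.isProbabilityMeasure _ s hs
  refine le_antisymm ?_ ((quantile_le_iff hu).1 le_rfl)
  have hc : Tendsto (M.F (Sum.inl i) s) (𝓝[<] (quantile (M.law (Sum.inl i) s) u))
      (𝓝 (M.F (Sum.inl i) s (quantile (M.law (Sum.inl i) s) u))) :=
    ((hM.contDiff i s hs).continuous.tendsto _).mono_left nhdsWithin_le_nhds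
  exact le_of_tendsto hc (eventually_mem_nhdsWithin.mono fun x hx => ((lt_quantile_iff hu).1 hx).le)

/-- The bounds of the likelihood integral are the edges of the cell of levels that produce the
observation `y`. -/
lemma Valid.quantile_eq_iff (hM : M.Valid) (j : Fin r) {s : ℝ} (hs : s ∈ M.G (Sum.inr j)) {u : ℝ}
    (hu : u ∈ Ioo (0 : ℝ) 1) (y : ℝ) :
    quantile (M.law (Sum.inr j) s) u = y ↔
      u ∈ Ioc (M.FLeft (Sum.inr j) s y) (M.F (Sum.inr j) s y) := by
  have := hM.isProbabilityMeasure _ s hs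
  constructor
  · rintro rfl
    refine ⟨?_, (quantile_le_iff hu).1 le_rfl⟩
    rw [hM.FLeft_eq j hs]
    refine (lt_quantile_iff hu).1 ?_
    linarith [Int.ceil_lt_add_one (quantile (M.law (Sum.inr j) s) u)]
  · rintro ⟨h1, h2⟩
    refine le_antisymm ((quantile_le_iff hu).2 h2) ?_
    by_contra! hlt
    have h3 : u ≤ M.F (Sum.inr j) s (quantile (M.law (Sum.inr j) s) u) :=
      (quantile_le_iff hu).1 le_rfl
    have h4 : M.F (Sum.inr j) s (quantile (M.law (Sum.inr j) s) u) ≤ M.FLeft (Sum.inr j) s y :=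
      measureReal_mono (Iic_subset_Iio.2 hlt)
    linarith

/-- A value outside ℕ has no mass, so its cell is empty and cannot contain `u`. -/
lemma Valid.quantile_mem_range (hM : M.Valid) (j : Fin r) {s : ℝ} (hs : s ∈ M.G (Sum.inr j))
    {u : ℝ} (hu : u ∈ Ioo (0 : ℝ) 1) :
    quantile (M.law (Sum.inr j) s) u ∈ range (Nat.cast : ℕ → ℝ) := by
  by_contra hn
  have h1 := (hM.quantile_eq_iff j hs hu _).1 rfl
  have h2 := hM.pDisc_eq j hs (quantile (M.law (Sum.inr j) s) u)
  have h3 : M.pDisc j s (quantile (M.law (Sum.inr j) s) u) = 0 := by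
    rw [pDisc, measureReal_def]
    have : M.law (Sum.inr j) s {quantile (M.law (Sum.inr j) s) u} = 0 := by
      refine measure_mono_null ?_ (hM.ae_nat j hs)
      rintro x rfl hx
      exact hn hx
    rw [this, ENNReal.toReal_zero]
  linarith [h1.1, h1.2]

/-! ### Measurability in the parameter -/

/-- The cdf as a function of the parameter and the argument, extended by `0`. -/
noncomputable def Fext (M : Margins ℓ r) (i : Idx ℓ r) (p : ℝ × ℝ) : ℝ :=
  {p : ℝ × ℝ | p.1 ∈ M.G i}.indicator (fun p => M.F i p.1 p.2) p

lemma Fext_of_mem {i : Idx ℓ r} {s : ℝ} (hs : s ∈ M.G i) (y : ℝ) :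
    M.Fext i (s, y) = M.F i s y := indicator_of_mem (s := {p : ℝ × ℝ | p.1 ∈ M.G i}) hs _

/-- Right continuity in `y` writes the cdf as an infimum over rationals above `y`, and each rational
section is continuous in the parameter on `M.G i`. -/
lemma Valid.measurable_Fext (hM : M.Valid) (i : Idx ℓ r) : Measurable (M.Fext i) := by
  have hq : ∀ q : ℚ, Measurable fun s => (M.G i).indicator (fun s => M.F i s q) s := by
    intro q
    classical
    have := (hM.continuousOn_F i q).measurable_piecewise (g := fun _ => (0 : ℝ))
      continuousOn_const (hM.measurableSet_G i)
    rwa [← Pi.zero_def, piecewise_eq_indicator] at this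
  -- Subtracting and adding 1 gives the value 1 to rationals not above `y`, where it cannot lower
  -- the infimum.
  have hform : M.Fext i = fun p => ⨅ q : ℚ,
      {p : ℝ × ℝ | p.2 < q}.indicator
        (fun p => (M.G i).indicator (fun s => M.F i s q) p.1 - 1) p + 1 := by
    ext ⟨s, y⟩
    have hval : ∀ q : ℚ, {p : ℝ × ℝ | p.2 < q}.indicator
        (fun p => (M.G i).indicator (fun s => M.F i s q) p.1 - 1) (s, y) + 1 =
        if y < q then (M.G i).indicator (fun s => M.F i s q) s else 1 := by
      intro q
      by_cases h : y < q
      · rw [if_pos h, indicator_of_mem (by exact h)]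
        ring
      · rw [if_neg h, indicator_of_notMem (by exact h)]
        ring
    simp only [hval]
    by_cases hs : s ∈ M.G i
    · have := hM.isProbabilityMeasure i s hs
      rw [Fext_of_mem hs]
      simp only [indicator_of_mem hs]
      refine le_antisymm (le_ciInf fun q => ?_) ?_
      · split_ifs with h
        · exact measureReal_mono (Iic_subset_Iic.2 h.le)
        · exact hM.F_le_one i hs y
      · have hF : M.F i s y = cdf (M.law i s) y := (cdf_eq_real _ _).symm
        rw [hF, ← StieltjesFunction.iInf_rat_gt_eq]
        have : Nonempty {q : ℚ // y < q} := by
          obtain ⟨q, hq⟩ := exists_rat_gt y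
          exact ⟨⟨q, hq⟩⟩
        refine le_ciInf fun q => ?_
        have hbdd : BddBelow (range fun q : ℚ => if y < q then M.F i s q else 1) := by
          refine ⟨0, ?_⟩
          rintro _ ⟨q, rfl⟩
          simp only
          split_ifs
          · exact F_nonneg _ _ _
          · exact zero_le_one
        refine (ciInf_le hbdd q.1).trans (le_of_eq ?_)
        rw [if_pos q.2, cdf_eq_real]
        rfl
    · rw [Fext, indicator_of_notMem (by exact hs)]
      simp only [indicator_of_notMem hs]
      obtain ⟨q, hq⟩ := exists_rat_gt y
      refine le_antisymm (le_ciInf fun q => by split_ifs <;> norm_num) ?_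
      have hbdd : BddBelow (range fun q : ℚ => if y < q then (0 : ℝ) else 1) := by
        refine ⟨0, ?_⟩
        rintro _ ⟨q, rfl⟩
        simp only
        split_ifs <;> norm_num
      exact (ciInf_le hbdd q).trans (by rw [if_pos hq])
  rw [hform]
  refine Measurable.iInf fun q => Measurable.add_const (Measurable.indicator ?_ ?_) _
  · exact ((hq q).comp measurable_fst).sub_const _
  · exact measurableSet_lt measurable_snd measurable_const

/-- The quantile function as a function of the parameter and the level, extended by `0`. -/
noncomputable def quantileExt (M : Margins ℓ r) (i : Idx ℓ r) (p : ℝ × ℝ) : ℝ :=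
  (M.G i ×ˢ Ioo (0 : ℝ) 1).indicator (fun p => quantile (M.law i p.1) p.2) p

lemma quantileExt_of_mem {i : Idx ℓ r} {s : ℝ} (hs : s ∈ M.G i) {u : ℝ} (hu : u ∈ Ioo (0 : ℝ) 1) :
    M.quantileExt i (s, u) = quantile (M.law i s) u :=
  indicator_of_mem (s := M.G i ×ˢ Ioo (0 : ℝ) 1) ⟨hs, hu⟩ _

lemma Valid.measurable_quantileExt (hM : M.Valid) (i : Idx ℓ r) :
    Measurable (M.quantileExt i) := by
  have hS : MeasurableSet (M.G i ×ˢ Ioo (0 : ℝ) 1) :=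
    (hM.measurableSet_G i).prod measurableSet_Ioo
  refine measurable_of_Iic fun x => ?_
  have : M.quantileExt i ⁻¹' Iic x =
      ((M.G i ×ˢ Ioo (0 : ℝ) 1) ∩ {p | p.2 ≤ M.Fext i (p.1, x)}) ∪
        ((M.G i ×ˢ Ioo (0 : ℝ) 1)ᶜ ∩ {_p | (0 : ℝ) ≤ x}) := by
    ext ⟨s, u⟩
    by_cases h : (s, u) ∈ M.G i ×ˢ Ioo (0 : ℝ) 1
    · have := hM.isProbabilityMeasure i s h.1
      rw [mem_preimage, mem_Iic, quantileExt_of_mem h.1 h.2, quantile_le_iff h.2]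
      simp only [mem_union, mem_inter_iff, h, true_and, mem_ofPred_eq, mem_compl_iff,
        not_true_eq_false, false_and, or_false]
      rw [Fext_of_mem h.1]
      rfl
    · rw [mem_preimage, mem_Iic, quantileExt, indicator_of_notMem h]
      simp only [mem_union, mem_inter_iff, h, false_and, false_or, mem_ofPred_eq, mem_compl_iff,
        not_false_eq_true, true_and]
  rw [this]
  refine (hS.inter (measurableSet_le measurable_snd ?_)).union (hS.compl.inter (.const _))
  exact (hM.measurable_Fext i).comp (measurable_fst.prodMk measurable_const)

/-- The arguments `(F_i(y_i))`, `(F_j(y_j⁻))`, `(F_j(y_j))` of the box integral in the conditional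
density. -/
noncomputable def boxArgs (M : Margins ℓ r) (p : (Idx ℓ r → ℝ) × (Idx ℓ r → ℝ)) :
    (Fin ℓ → ℝ) × (Fin r → ℝ) × (Fin r → ℝ) :=
  (fun i => M.Fext (Sum.inl i) (p.1 (Sum.inl i), p.2 (Sum.inl i)),
    fun j => M.Fext (Sum.inr j) (p.1 (Sum.inr j), ⌈p.2 (Sum.inr j)⌉ - 1),
    fun j => M.Fext (Sum.inr j) (p.1 (Sum.inr j), p.2 (Sum.inr j)))

lemma Valid.measurable_boxArgs (hM : M.Valid) : Measurable M.boxArgs := by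
  refine Measurable.prodMk ?_ (Measurable.prodMk ?_ ?_)
  · exact measurable_pi_iff.2 fun i => (hM.measurable_Fext _).comp (by fun_prop)
  · refine measurable_pi_iff.2 fun j => (hM.measurable_Fext _).comp ?_
    refine Measurable.prodMk (by fun_prop) (Measurable.sub_const ?_ _)
    have h : Measurable fun x : ℝ => ((⌈x⌉ : ℤ) : ℝ) :=
      (measurable_of_countable _).comp Int.measurable_ceil
    exact h.comp (by fun_prop)
  · exact measurable_pi_iff.2 fun j => (hM.measurable_Fext _).comp (by fun_prop)

lemma Valid.boxArgs_eq (hM : M.Valid) {s : Idx ℓ r → ℝ} (hs : ∀ i, s i ∈ M.G i)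
    (y : Idx ℓ r → ℝ) :
    M.boxArgs (s, y) = (fun i => M.F (Sum.inl i) (s (Sum.inl i)) (y (Sum.inl i)),
      fun j => M.FLeft (Sum.inr j) (s (Sum.inr j)) (y (Sum.inr j)),
      fun j => M.F (Sum.inr j) (s (Sum.inr j)) (y (Sum.inr j))) := by
  rw [boxArgs]
  refine Prod.ext (funext fun i => Fext_of_mem (hs _) _)
    (Prod.ext (funext fun j => ?_) (funext fun j => Fext_of_mem (hs _) _))
  exact (Fext_of_mem (hs _) _).trans (hM.FLeft_eq j (hs _) _).symm

/-- The integral of the copula density in the conditional density of the model. -/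
noncomputable def copulaPart (M : Margins ℓ r) (R : Matrix (Idx ℓ r) (Idx ℓ r) ℝ)
    (p : (Idx ℓ r → ℝ) × (Idx ℓ r → ℝ)) : ℝ :=
  boxIntegral R (M.boxArgs p).1 (M.boxArgs p).2.1 (M.boxArgs p).2.2

lemma Valid.measurable_copulaPart (hM : M.Valid) (R : Matrix (Idx ℓ r) (Idx ℓ r) ℝ) :
    Measurable (M.copulaPart R) := (measurable_boxIntegral R).comp hM.measurable_boxArgs

/-- The first factor is free of `R` and cancels in likelihood ratios; no moment of the marginal
densities is required. -/
lemma Valid.jointDensity_eq (hM : M.Valid) (R : Matrix (Idx ℓ r) (Idx ℓ r) ℝ) {s : Idx ℓ r → ℝ}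
    (hs : ∀ i, s i ∈ M.G i) (y : Idx ℓ r → ℝ) :
    M.jointDensity R s y =
      (∏ i : Fin ℓ, M.pCont i (s (Sum.inl i)) (y (Sum.inl i))) * M.copulaPart R (s, y) := by
  rw [copulaPart, hM.boxArgs_eq hs]
  rfl

end Margins

/-! ### Discretization of the last coordinates of the Gaussian copula -/

section Cells

variable {α β : Type*} [Fintype α] [Fintype β] [DecidableEq α] [DecidableEq β]

lemma lintegral_gaussianCopula_sum (R : Matrix (α ⊕ β) (α ⊕ β) ℝ) {g : (α ⊕ β → ℝ) → ℝ≥0∞}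
    (hg : Measurable g) :
    ∫⁻ x, g x ∂gaussianCopula R = ∫⁻ u in unitCube α, ∫⁻ v in unitCube β,
      ENNReal.ofReal (gaussianCopulaDensity R (Sum.elim u v)) * g (Sum.elim u v) := by
  have hd : Measurable fun x => ENNReal.ofReal (gaussianCopulaDensity R x) :=
    (measurable_gaussianCopulaDensity R).ennreal_ofReal
  rw [gaussianCopula, lintegral_withDensity_eq_lintegral_mul _ hd hg, volume_pi,
    Measure.restrict_pi_pi, ← (measurePreserving_sumPiEquivProdPi_symm (X := fun _ => ℝ)
      (fun _ : α ⊕ β => (volume : Measure ℝ).restrict (Icc 0 1))).lintegral_comp (hd.mul hg)]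
  have hm : Measurable fun p : (α → ℝ) × (β → ℝ) =>
      ((fun x => ENNReal.ofReal (gaussianCopulaDensity R x)) * g)
        ((MeasurableEquiv.sumPiEquivProdPi fun _ : α ⊕ β => ℝ).symm p) :=
    (hd.mul hg).comp (MeasurableEquiv.measurable _)
  rw [lintegral_prod _ hm.aemeasurable]
  simp only [unitCube, volume_pi, Measure.restrict_pi_pi]
  refine lintegral_congr fun u => lintegral_congr fun v => ?_
  have : (MeasurableEquiv.sumPiEquivProdPi fun _ : α ⊕ β => ℝ).symm (u, v) = Sum.elim u v := by
    ext (i | j) <;> rfl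
  rw [this, Pi.mul_apply]

variable {Γ : Set (Matrix (α ⊕ β) (α ⊕ β) ℝ)} {C η : ℝ} {N : (β → ℝ) → (β → ℕ)}
  {a b : (β → ℕ) → β → ℝ}

lemma RatioBounds.setLIntegral_cell (h : RatioBounds Γ C η) {R} (hR : R ∈ Γ)
    (hN : ∀ v : β → ℝ, (∀ j, v j ∈ Ioo (0 : ℝ) 1) →
      ∀ n, N v = n ↔ v ∈ Set.pi univ fun j => Ioc (a n j) (b n j))
    (ha : ∀ n j, 0 ≤ a n j) (hb : ∀ n j, b n j ≤ 1) (u : α → ℝ) (n : β → ℕ) :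
    ∫⁻ v in unitCube β, (N ⁻¹' {n}).indicator
      (fun v => ENNReal.ofReal (gaussianCopulaDensity R (Sum.elim u v))) v =
      ENNReal.ofReal (boxIntegral R u (a n) (b n)) := by
  have hsub := pi_Ioc_subset_unitCube (ha n) (hb n)
  rw [boxIntegral, ofReal_integral_eq_lintegral_ofReal
    ((h.integrableOn_density hR u).mono_set hsub)
    (ae_of_all _ fun v => gaussianCopulaDensity_nonneg _ _),
    ← inter_eq_left.2 hsub, ← Measure.restrict_restrict (measurableSet_pi_Ioc _ _),
    ← lintegral_indicator (measurableSet_pi_Ioc _ _)]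
  have hcube : ∀ᵐ v ∂(volume : Measure (β → ℝ)).restrict (unitCube β),
      ∀ j, v j ∈ Ioo (0 : ℝ) 1 := by
    have : (Set.pi univ fun _ : β => Ioo (0 : ℝ) 1) =ᵐ[volume] unitCube β :=
      Measure.pi_Ioo_ae_eq_pi_Icc
    rw [← Measure.restrict_congr_set this]
    filter_upwards [ae_restrict_mem (MeasurableSet.univ_pi fun _ => measurableSet_Ioo)]
      with v hv j using hv j (mem_univ j)
  refine lintegral_congr_ae ?_
  filter_upwards [hcube] with v hv
  by_cases hvn : N v = n
  · rw [indicator_of_mem (by exact hvn), indicator_of_mem ((hN v hv n).1 hvn)]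
  · rw [indicator_of_notMem (by exact hvn), indicator_of_notMem fun hmem => hvn ((hN v hv n).2 hmem)]

/-- Splitting the discrete coordinates by cell identifies the box integral as the density of (u,
N(v)) with respect to Lebesgue times counting measure. -/
lemma RatioBounds.lintegral_gaussianCopula_cell (h : RatioBounds Γ C η) {R} (hR : R ∈ Γ)
    (hNm : Measurable N)
    (hN : ∀ v : β → ℝ, (∀ j, v j ∈ Ioo (0 : ℝ) 1) →
      ∀ n, N v = n ↔ v ∈ Set.pi univ fun j => Ioc (a n j) (b n j))
    (ha : ∀ n j, 0 ≤ a n j) (hb : ∀ n j, b n j ≤ 1)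
    {φ : (α → ℝ) × (β → ℕ) → ℝ≥0∞} (hφ : Measurable φ) :
    ∫⁻ x, φ (fun i => x (Sum.inl i), N fun j => x (Sum.inr j)) ∂gaussianCopula R =
      ∫⁻ u in unitCube α, ∑' n, φ (u, n) * ENNReal.ofReal (boxIntegral R u (a n) (b n)) := by
  have hm : Measurable fun x : α ⊕ β → ℝ =>
      φ (fun i => x (Sum.inl i), N fun j => x (Sum.inr j)) := by
    refine hφ.comp (Measurable.prodMk (by fun_prop) (hNm.comp (by fun_prop)))
  rw [lintegral_gaussianCopula_sum R hm]
  refine lintegral_congr fun u => ?_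
  simp only [Sum.elim_inl, Sum.elim_inr]
  have hpt : ∀ v : β → ℝ, ENNReal.ofReal (gaussianCopulaDensity R (Sum.elim u v)) * φ (u, N v) =
      ∑' n, φ (u, n) * (N ⁻¹' {n}).indicator
        (fun v => ENNReal.ofReal (gaussianCopulaDensity R (Sum.elim u v))) v := by
    intro v
    rw [tsum_eq_single (N v)]
    · rw [indicator_of_mem (by simp), mul_comm]
    · intro n hn
      rw [indicator_of_notMem (by simpa using hn.symm), mul_zero]
  have hdm : ∀ n, Measurable fun v : β → ℝ => (N ⁻¹' {n}).indicator
      (fun v => ENNReal.ofReal (gaussianCopulaDensity R (Sum.elim u v))) v := fun n =>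
    (((measurable_density_sumElim R).comp measurable_prodMk_left).ennreal_ofReal).indicator
      (hNm (measurableSet_singleton n))
  simp_rw [hpt]
  rw [lintegral_tsum fun n => ((hdm n).const_mul _).aemeasurable]
  refine tsum_congr fun n => ?_
  rw [lintegral_const_mul _ (hdm n), h.setLIntegral_cell hR hN ha hb]

/-- A box integral vanishes only for an empty box, whatever `R` is. The discretized copulas are
therefore mutually absolutely continuous, and division by zero in their ratio is harmless. -/
lemma RatioBounds.boxIntegral_eq_zero (h : RatioBounds Γ C η) {R₀ R} (hR₀ : R₀ ∈ Γ)
    {u : α → ℝ} {a b : β → ℝ} (ha : ∀ j, 0 ≤ a j) (hb : ∀ j, b j ≤ 1)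
    (h0 : boxIntegral R₀ u a b = 0) : boxIntegral R u a b = 0 := by
  have : ∃ j, b j ≤ a j := by
    by_contra! hab
    exact (h.boxIntegral_pos hR₀ u ha hb hab).ne' h0
  obtain ⟨j, hj⟩ := this
  have hemp : (Set.pi univ fun j => Ioc (a j) (b j)) = ∅ :=
    univ_pi_eq_empty (i := j) (Ioc_eq_empty (not_lt.2 hj))
  rw [boxIntegral, hemp, Measure.restrict_empty, integral_zero_measure]

/-- The ratio of the box integrals is the density of the discretized copulas with respect to each
other. -/
lemma RatioBounds.lintegral_mul_ratio (h : RatioBounds Γ C η) {R₀ R} (hR₀ : R₀ ∈ Γ) (hR : R ∈ Γ)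
    (hNm : Measurable N)
    (hN : ∀ v : β → ℝ, (∀ j, v j ∈ Ioo (0 : ℝ) 1) →
      ∀ n, N v = n ↔ v ∈ Set.pi univ fun j => Ioc (a n j) (b n j))
    (ha : ∀ n j, 0 ≤ a n j) (hb : ∀ n j, b n j ≤ 1)
    {φ : (α → ℝ) × (β → ℕ) → ℝ≥0∞} (hφ : Measurable φ) :
    ∫⁻ x, φ (fun i => x (Sum.inl i), N fun j => x (Sum.inr j)) * ENNReal.ofReal
      (boxIntegral R (fun i => x (Sum.inl i)) (a (N fun j => x (Sum.inr j)))
          (b (N fun j => x (Sum.inr j))) /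
        boxIntegral R₀ (fun i => x (Sum.inl i)) (a (N fun j => x (Sum.inr j)))
          (b (N fun j => x (Sum.inr j)))) ∂gaussianCopula R₀ =
      ∫⁻ x, φ (fun i => x (Sum.inl i), N fun j => x (Sum.inr j)) ∂gaussianCopula R := by
  have hbox : ∀ R : Matrix (α ⊕ β) (α ⊕ β) ℝ,
      Measurable fun p : (α → ℝ) × (β → ℕ) => boxIntegral R p.1 (a p.2) (b p.2) := by
    intro R
    refine (measurable_boxIntegral R).comp (measurable_fst.prodMk (Measurable.prodMk ?_ ?_))
    · exact (measurable_of_countable a).comp measurable_snd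
    · exact (measurable_of_countable b).comp measurable_snd
  rw [h.lintegral_gaussianCopula_cell hR hNm hN ha hb hφ,
    h.lintegral_gaussianCopula_cell (φ := fun p => φ p * ENNReal.ofReal
      (boxIntegral R p.1 (a p.2) (b p.2) / boxIntegral R₀ p.1 (a p.2) (b p.2)))
      hR₀ hNm hN ha hb (hφ.mul ((hbox R).div (hbox R₀)).ennreal_ofReal)]
  refine lintegral_congr fun u => tsum_congr fun n => ?_
  have hnn : 0 ≤ boxIntegral R₀ u (a n) (b n) :=
    integral_nonneg fun v => gaussianCopulaDensity_nonneg _ _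
  rw [mul_assoc, ← ENNReal.ofReal_mul' hnn]
  by_cases h0 : boxIntegral R₀ u (a n) (b n) = 0
  · rw [h0, mul_zero, h.boxIntegral_eq_zero hR₀ (ha n) (hb n) h0]
  · rw [div_mul_cancel₀ _ h0]

end Cells

/-! ### Identification of the copula given the parameters of the margins -/

namespace Margins

variable {ℓ r : ℕ} {M : Margins ℓ r} {Γ : Set (Matrix (Idx ℓ r) (Idx ℓ r) ℝ)} {C η : ℝ}

/-- The observation with parameters `s` and copula variable `u`. -/
noncomputable def obs (M : Margins ℓ r) (p : (Idx ℓ r → ℝ) × (Idx ℓ r → ℝ)) : Idx ℓ r → ℝ :=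
  fun i => M.quantileExt i (p.1 i, p.2 i)

lemma Valid.measurable_obs (hM : M.Valid) : Measurable M.obs :=
  measurable_pi_iff.2 fun i => (hM.measurable_quantileExt i).comp (by fun_prop)

/-- The discrete observations as natural numbers. -/
noncomputable def cell (M : Margins ℓ r) (s : Idx ℓ r → ℝ) (v : Fin r → ℝ) : Fin r → ℕ :=
  fun j => ⌊M.quantileExt (Sum.inr j) (s (Sum.inr j), v j)⌋₊

lemma Valid.measurable_cell (hM : M.Valid) (s : Idx ℓ r → ℝ) : Measurable (M.cell s) :=
  measurable_pi_iff.2 fun j => Nat.measurable_floor.comp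
    ((hM.measurable_quantileExt _).comp (by fun_prop))

lemma Valid.cell_cast (hM : M.Valid) {s : Idx ℓ r → ℝ} (hs : ∀ i, s i ∈ M.G i) {v : Fin r → ℝ}
    (hv : ∀ j, v j ∈ Ioo (0 : ℝ) 1) (j : Fin r) :
    (M.cell s v j : ℝ) = quantile (M.law (Sum.inr j) (s (Sum.inr j))) (v j) := by
  rw [cell, quantileExt_of_mem (hs _) (hv j)]
  obtain ⟨n, hn⟩ := hM.quantile_mem_range j (hs _) (hv j)
  rw [← hn, Nat.floor_natCast]

lemma Valid.cell_eq_iff (hM : M.Valid) {s : Idx ℓ r → ℝ} (hs : ∀ i, s i ∈ M.G i) {v : Fin r → ℝ}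
    (hv : ∀ j, v j ∈ Ioo (0 : ℝ) 1) (n : Fin r → ℕ) :
    M.cell s v = n ↔ v ∈ Set.pi univ fun j => Ioc (M.FLeft (Sum.inr j) (s (Sum.inr j)) (n j))
      (M.F (Sum.inr j) (s (Sum.inr j)) (n j)) := by
  rw [funext_iff]
  simp only [mem_univ_pi]
  refine forall_congr' fun j => ?_
  rw [← hM.quantile_eq_iff j (hs _) (hv j), ← hM.cell_cast hs hv j, Nat.cast_inj]

/-- For continuous components F(F⁻¹(u)) = u, so the observation reveals `u` itself; for discrete
ones it reveals only the cell. -/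
lemma Valid.copulaPart_obs (hM : M.Valid) (R : Matrix (Idx ℓ r) (Idx ℓ r) ℝ) {s : Idx ℓ r → ℝ}
    (hs : ∀ i, s i ∈ M.G i) {u : Idx ℓ r → ℝ} (hu : ∀ i, u i ∈ Ioo (0 : ℝ) 1) :
    M.copulaPart R (s, M.obs (s, u)) = boxIntegral R (fun i => u (Sum.inl i))
      (fun j => M.FLeft (Sum.inr j) (s (Sum.inr j)) (M.cell s (fun j => u (Sum.inr j)) j))
      (fun j => M.F (Sum.inr j) (s (Sum.inr j)) (M.cell s (fun j => u (Sum.inr j)) j)) := by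
  have h1 : ∀ i, M.obs (s, u) i = quantile (M.law i (s i)) (u i) := fun i =>
    quantileExt_of_mem (hs i) (hu i)
  rw [copulaPart, hM.boxArgs_eq hs]
  simp only [h1]
  simp only [hM.F_quantile _ (hs _) (hu _),
    hM.cell_cast hs (v := fun j => u (Sum.inr j)) (fun j => hu _)]

lemma Valid.lintegral_mul_ratio (hM : M.Valid) (h : RatioBounds Γ C η) {R₀ R} (hR₀ : R₀ ∈ Γ)
    (hR : R ∈ Γ) {s : Idx ℓ r → ℝ} (hs : ∀ i, s i ∈ M.G i)
    {φ : (Fin ℓ → ℝ) × (Fin r → ℕ) → ℝ≥0∞} (hφ : Measurable φ) :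
    ∫⁻ u, φ (fun i => u (Sum.inl i), M.cell s fun j => u (Sum.inr j)) * ENNReal.ofReal
      (M.copulaPart R (s, M.obs (s, u)) / M.copulaPart R₀ (s, M.obs (s, u)))
      ∂gaussianCopula R₀ =
      ∫⁻ u, φ (fun i => u (Sum.inl i), M.cell s fun j => u (Sum.inr j)) ∂gaussianCopula R := by
  rw [← h.lintegral_mul_ratio hR₀ hR (hM.measurable_cell s)
    (fun v hv n => hM.cell_eq_iff hs hv n) (fun n j => measureReal_nonneg)
    (fun n j => hM.F_le_one _ (hs _) _) hφ]
  refine lintegral_congr_ae ?_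
  filter_upwards [ae_gaussianCopula_mem_Ioo R₀] with u hu
  rw [hM.copulaPart_obs R hs hu, hM.copulaPart_obs R₀ hs hu]

lemma Valid.lintegral_ratio (hM : M.Valid) (h : RatioBounds Γ C η)
    (hΓ : ∀ R ∈ Γ, IsCorrelation R) {R₀ R} (hR₀ : R₀ ∈ Γ) (hR : R ∈ Γ) {s : Idx ℓ r → ℝ}
    (hs : ∀ i, s i ∈ M.G i) :
    ∫⁻ u, ENNReal.ofReal (M.copulaPart R (s, M.obs (s, u)) / M.copulaPart R₀ (s, M.obs (s, u)))
      ∂gaussianCopula R₀ = 1 := by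
  have := isProbabilityMeasure_gaussianCopula (hΓ R hR)
  simpa using hM.lintegral_mul_ratio h hR₀ hR hs (φ := fun _ => 1) measurable_const

/-- The copula is identified by the conditional law of the observations, when the discrete components
are not almost surely zero or almost surely nonzero. -/
lemma Valid.eq_of_ratio_eq_one (hM : M.Valid) (h : RatioBounds Γ C η)
    (hΓ : ∀ R ∈ Γ, IsCorrelation R) {R₀ R} (hR₀ : R₀ ∈ Γ) (hR : R ∈ Γ) {s : Idx ℓ r → ℝ}
    (hs : ∀ i, s i ∈ M.G i)
    (hp : ∀ j, M.pDisc j (s (Sum.inr j)) 0 ∈ Ioo (0 : ℝ) 1)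
    (hone : ∀ᵐ u ∂gaussianCopula R₀,
      M.copulaPart R (s, M.obs (s, u)) / M.copulaPart R₀ (s, M.obs (s, u)) = 1) : R = R₀ := by
  have hp' : ∀ j, M.F (Sum.inr j) (s (Sum.inr j)) 0 ∈ Ioo (0 : ℝ) 1 := fun j => by
    rw [← hM.pDisc_zero j (hs _)]
    exact hp j
  -- For a discrete component the threshold makes {u_j ≤ x_j} the event of a zero observation. For a
  -- continuous one 1/2 is an arbitrary level in (0,1).
  refine ((hΓ R₀ hR₀).eq_of_forall_pair (hΓ R hR)
    (x := Sum.elim (fun _ => 1 / 2) fun j => M.F (Sum.inr j) (s (Sum.inr j)) 0) ?_ ?_).symm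
  · rintro (i | j)
    · constructor <;> norm_num
    · exact hp' j
  intro i i'
  -- The threshold events depend on the copula variable only through the continuous coordinates and
  -- the cells, where the laws under `R` and `R₀` have ratio one.
  set D : Idx ℓ r → Set ((Fin ℓ → ℝ) × (Fin r → ℕ)) := fun i =>
    Sum.elim (fun i => {p | p.1 i ≤ 1 / 2}) (fun j => {p | p.2 j = 0}) i with hD
  have hDm : ∀ i, MeasurableSet (D i) := by
    rintro (i | j)
    · exact measurableSet_le (by fun_prop) measurable_const
    · exact measurableSet_eq_fun (by fun_prop) measurable_const
  have hmem : ∀ u : Idx ℓ r → ℝ, (∀ i, u i ∈ Ioo (0 : ℝ) 1) → ∀ i,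
      ((fun i => u (Sum.inl i), M.cell s fun j => u (Sum.inr j)) ∈ D i ↔
        u i ≤ Sum.elim (fun _ => 1 / 2) (fun j => M.F (Sum.inr j) (s (Sum.inr j)) 0) i) := by
    intro u hu i
    rcases i with i | j
    · exact Iff.rfl
    · have := hM.isProbabilityMeasure _ _ (hs (Sum.inr j))
      change M.cell s (fun j => u (Sum.inr j)) j = 0 ↔
        u (Sum.inr j) ≤ M.F (Sum.inr j) (s (Sum.inr j)) 0
      have h1 := hM.cell_cast hs (v := fun j => u (Sum.inr j)) (fun j => hu _) j
      have h2 : u (Sum.inr j) ≤ M.F (Sum.inr j) (s (Sum.inr j)) 0 ↔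
          (M.cell s (fun j => u (Sum.inr j)) j : ℝ) ≤ 0 := by
        rw [h1, quantile_le_iff (hu _)]
        rfl
      rw [h2]
      norm_cast
      exact Nat.le_zero.symm
  have hms : MeasurableSet (D i ∩ D i') := (hDm i).inter (hDm i')
  have hmap : Measurable fun u : Idx ℓ r → ℝ =>
      ((fun i => u (Sum.inl i), M.cell s fun j => u (Sum.inr j)) :
        (Fin ℓ → ℝ) × (Fin r → ℕ)) :=
    Measurable.prodMk (by fun_prop) ((hM.measurable_cell s).comp (by fun_prop))
  have hset : ∀ R' : Matrix (Idx ℓ r) (Idx ℓ r) ℝ,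
      gaussianCopula R' {u | u i ≤ Sum.elim (fun _ => 1 / 2)
        (fun j => M.F (Sum.inr j) (s (Sum.inr j)) 0) i ∧ u i' ≤ Sum.elim (fun _ => 1 / 2)
        (fun j => M.F (Sum.inr j) (s (Sum.inr j)) 0) i'} =
      ∫⁻ u, (D i ∩ D i').indicator 1
        (fun i => u (Sum.inl i), M.cell s fun j => u (Sum.inr j)) ∂gaussianCopula R' := by
    intro R'
    have : ∀ u : Idx ℓ r → ℝ, (D i ∩ D i').indicator (1 : (Fin ℓ → ℝ) × (Fin r → ℕ) → ℝ≥0∞)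
        (fun i => u (Sum.inl i), M.cell s fun j => u (Sum.inr j)) =
        ((fun u : Idx ℓ r → ℝ => ((fun i => u (Sum.inl i), M.cell s fun j => u (Sum.inr j)) :
        (Fin ℓ → ℝ) × (Fin r → ℕ))) ⁻¹' (D i ∩ D i')).indicator 1 u := fun u => rfl
    simp_rw [this]
    rw [lintegral_indicator_one (hmap hms)]
    refine measure_congr ?_
    filter_upwards [ae_gaussianCopula_mem_Ioo R'] with u hu
    exact propext (and_congr (hmem u hu i) (hmem u hu i')).symm
  rw [hset, hset, ← hM.lintegral_mul_ratio h hR₀ hR hs (measurable_one.indicator hms)]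
  refine lintegral_congr_ae ?_
  filter_upwards [hone] with u hu
  rw [hu, ENNReal.ofReal_one, mul_one]

end Margins

/-! ### The log-likelihood ratio and its envelope -/

lemma negLog_le_iff {x : ℝ} {e : ℝ≥0∞} (he : e ≠ ⊤) : negLog x ≤ e ↔ Real.exp (-e.toReal) ≤ x := by
  rw [negLog]
  split_ifs with hx
  · simp only [top_le_iff, he, false_iff, not_le]
    exact hx.trans_lt (Real.exp_pos _)
  · push Not at hx
    rw [ENNReal.ofReal_le_iff_le_toReal he, ← Real.le_log_iff_exp_le hx]
    exact neg_le

/-- Each sublevel set at a finite level is a closed half-line, because the value is ⊤ on nonpositive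
reals. -/
lemma lowerSemicontinuous_negLog : LowerSemicontinuous negLog := by
  rw [lowerSemicontinuous_iff_isClosed_preimage]
  intro e
  by_cases he : e = ⊤
  · rw [he, Iic_top, preimage_univ]
    exact isClosed_univ
  · have : negLog ⁻¹' Iic e = Ici (Real.exp (-e.toReal)) := by
      ext x
      exact negLog_le_iff he
    rw [this]
    exact isClosed_Ici

lemma pos_of_negLog_ne_top {x : ℝ} (h : negLog x ≠ ⊤) : 0 < x := by
  by_contra! hx
  exact h (if_pos hx)

lemma toReal_negLog {x : ℝ} (h0 : 0 < x) (h1 : x ≤ 1) : (negLog x).toReal = -Real.log x := by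
  rw [negLog, if_neg (not_le.2 h0), ENNReal.toReal_ofReal]
  linarith [Real.log_nonpos h0.le h1]

section Penalty

variable {α β : Type*} [Fintype α] [Fintype β]

/-- The quantity that controls the logarithm of the box integrals. -/
noncomputable def penalty (w : (α → ℝ) × (β → ℝ) × (β → ℝ)) : ℝ≥0∞ :=
  ∑ i, (negLog (w.1 i) + negLog (1 - w.1 i)) + ∑ j, negLog (w.2.2 j - w.2.1 j)

lemma lowerSemicontinuous_penalty :
    LowerSemicontinuous (penalty : (α → ℝ) × (β → ℝ) × (β → ℝ) → ℝ≥0∞) := by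
  have h : ∀ f : (α → ℝ) × (β → ℝ) × (β → ℝ) → ℝ, Continuous f →
      LowerSemicontinuous fun w => negLog (f w) := fun f hf =>
    lowerSemicontinuous_negLog.comp hf
  refine LowerSemicontinuous.add ?_ ?_
  · exact lowerSemicontinuous_sum fun i _ =>
      (h _ (by fun_prop)).add (h _ (by fun_prop))
  · exact lowerSemicontinuous_sum fun j _ => h _ (by fun_prop)

lemma lt_of_penalty_ne_top {w : (α → ℝ) × (β → ℝ) × (β → ℝ)} (hw : penalty w ≠ ⊤) (j : β) :
    w.2.1 j < w.2.2 j := by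
  have h1 : ∑ j, negLog (w.2.2 j - w.2.1 j) ≠ ⊤ := (ENNReal.add_ne_top.1 hw).2
  have h2 := ENNReal.sum_ne_top.1 h1 j (Finset.mem_univ j)
  linarith [pos_of_negLog_ne_top h2]

lemma toReal_penalty {w : (α → ℝ) × (β → ℝ) × (β → ℝ)} (hw : penalty w ≠ ⊤)
    (hu : ∀ i, w.1 i ∈ Ioo (0 : ℝ) 1) (ha : ∀ j, 0 ≤ w.2.1 j) (hb : ∀ j, w.2.2 j ≤ 1) :
    (penalty w).toReal = ∑ i, (-Real.log (w.1 i) + -Real.log (1 - w.1 i)) +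
      ∑ j, -Real.log (w.2.2 j - w.2.1 j) := by
  obtain ⟨h1, h2⟩ := ENNReal.add_ne_top.1 hw
  have h3 := ENNReal.sum_ne_top.1 h1
  rw [penalty, ENNReal.toReal_add h1 h2, ENNReal.toReal_sum h3,
    ENNReal.toReal_sum (ENNReal.sum_ne_top.1 h2)]
  congr 1
  · refine Finset.sum_congr rfl fun i hi => ?_
    obtain ⟨h4, h5⟩ := ENNReal.add_ne_top.1 (h3 i hi)
    rw [ENNReal.toReal_add h4 h5, toReal_negLog (hu i).1 (hu i).2.le,
      toReal_negLog (by linarith [(hu i).2]) (by linarith [(hu i).1])]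
  · refine Finset.sum_congr rfl fun j _ => ?_
    exact toReal_negLog (sub_pos.2 (lt_of_penalty_ne_top hw j)) (by linarith [ha j, hb j])

end Penalty

namespace Margins

variable {ℓ r : ℕ} {M : Margins ℓ r} {Γ : Set (Matrix (Idx ℓ r) (Idx ℓ r) ℝ)} {C η : ℝ}
  {T E : Type*}

/-- The log-likelihood ratio of `R` and `R₀`, at the dynamic parameter `θ`. -/
noncomputable def logRatio (M : Margins ℓ r) (R₀ : Matrix (Idx ℓ r) (Idx ℓ r) ℝ)
    (z : (Idx ℓ r → ℝ) × (T → Idx ℓ r → ℝ) × E) (p : T × Γ) : ℝ :=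
  Real.log (M.copulaPart p.2 (z.2.1 p.1, z.1)) - Real.log (M.copulaPart R₀ (z.2.1 p.1, z.1))

/-- The supremum of the penalty along a sequence of dynamic parameters. -/
noncomputable def envelope (M : Margins ℓ r) (d : ℕ → T)
    (z : (Idx ℓ r → ℝ) × (T → Idx ℓ r → ℝ) × E) : ℝ≥0∞ :=
  ⨆ n, penalty (M.boxArgs (z.2.1 (d n), z.1))

section Measurability

variable [MeasurableSpace E]

lemma Valid.measurable_args (hM : M.Valid) (θ : T) :
    Measurable fun z : (Idx ℓ r → ℝ) × (T → Idx ℓ r → ℝ) × E => M.boxArgs (z.2.1 θ, z.1) :=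
  hM.measurable_boxArgs.comp (by fun_prop)

lemma Valid.measurable_logRatio (hM : M.Valid) (R₀ : Matrix (Idx ℓ r) (Idx ℓ r) ℝ) (p : T × Γ) :
    Measurable fun z : (Idx ℓ r → ℝ) × (T → Idx ℓ r → ℝ) × E => M.logRatio R₀ z p :=
  (Real.measurable_log.comp ((hM.measurable_copulaPart _).comp (by fun_prop))).sub
    (Real.measurable_log.comp ((hM.measurable_copulaPart _).comp (by fun_prop)))

lemma Valid.measurable_envelope (hM : M.Valid) (d : ℕ → T) :
    Measurable (M.envelope d : (Idx ℓ r → ℝ) × (T → Idx ℓ r → ℝ) × E → ℝ≥0∞) :=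
  Measurable.iSup fun n => lowerSemicontinuous_penalty.measurable.comp (hM.measurable_args (d n))

end Measurability

variable [TopologicalSpace T]

/-- The regularity of the path of the latent process. -/
structure Regular (M : Margins ℓ r) (d : ℕ → T) (z : (Idx ℓ r → ℝ) × (T → Idx ℓ r → ℝ) × E) :
    Prop where
  mem : ∀ θ i, z.2.1 θ i ∈ M.G i
  cont : Continuous z.2.1
  finite : M.envelope d z ≠ ⊤

variable {d : ℕ → T} {z : (Idx ℓ r → ℝ) × (T → Idx ℓ r → ℝ) × E}

lemma Valid.continuous_boxArgs (hM : M.Valid) (hz : M.Regular d z) :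
    Continuous fun θ => M.boxArgs (z.2.1 θ, z.1) := by
  have h : ∀ i y, Continuous fun θ => M.Fext i (z.2.1 θ i, y) := by
    intro i y
    have h1 : (fun θ => M.Fext i (z.2.1 θ i, y)) = fun θ => M.F i (z.2.1 θ i) y :=
      funext fun θ => Fext_of_mem (hz.mem θ i) y
    rw [h1]
    exact (hM.continuousOn_F i y).comp_continuous ((continuous_apply i).comp hz.cont)
      fun θ => hz.mem θ i
  exact (continuous_pi fun i => h (Sum.inl i) _).prodMk
    ((continuous_pi fun j => h (Sum.inr j) (⌈z.1 (Sum.inr j)⌉ - 1)).prodMk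
      (continuous_pi fun j => h (Sum.inr j) _))

/-- Lower semicontinuity extends the bound from a dense sequence to every θ, so the envelope can be
a countable, hence measurable, supremum on path space. -/
lemma Valid.penalty_le (hM : M.Valid) (hd : DenseRange d) (hz : M.Regular d z) (θ : T) :
    penalty (M.boxArgs (z.2.1 θ, z.1)) ≤ M.envelope d z := by
  have hcl : IsClosed {θ | penalty (M.boxArgs (z.2.1 θ, z.1)) ≤ M.envelope d z} :=
    (lowerSemicontinuous_penalty.comp
      (hM.continuous_boxArgs hz)).isClosed_preimage (M.envelope d z)
  refine closure_minimal ?_ hcl (hd θ)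
  rintro _ ⟨n, rfl⟩
  exact le_iSup (fun n => penalty (M.boxArgs (z.2.1 (d n), z.1))) n

lemma Valid.boxArgs_mem (hM : M.Valid) (hz : M.Regular d z) (θ : T) :
    (∀ i, (M.boxArgs (z.2.1 θ, z.1)).1 i ∈ Ioo (0 : ℝ) 1) ∧
      (∀ j, 0 ≤ (M.boxArgs (z.2.1 θ, z.1)).2.1 j) ∧
      ∀ j, (M.boxArgs (z.2.1 θ, z.1)).2.2 j ≤ 1 := by
  rw [hM.boxArgs_eq (hz.mem θ)]
  exact ⟨fun i => hM.F_mem_Ioo i (hz.mem θ _) _, fun j => measureReal_nonneg,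
    fun j => hM.F_le_one _ (hz.mem θ _) _⟩

lemma Valid.copulaPart_pos (hM : M.Valid) (h : RatioBounds Γ C η) (hd : DenseRange d)
    (hz : M.Regular d z) {R} (hR : R ∈ Γ) (θ : T) : 0 < M.copulaPart R (z.2.1 θ, z.1) := by
  obtain ⟨-, ha, hb⟩ := hM.boxArgs_mem hz θ
  exact h.boxIntegral_pos hR _ ha hb
    (lt_of_penalty_ne_top ((hM.penalty_le hd hz θ).trans_lt hz.finite.lt_top).ne)

lemma Valid.continuous_logRatio (hM : M.Valid) (h : RatioBounds Γ C η)
    (hΓ : ∀ R ∈ Γ, IsCorrelation R) (hd : DenseRange d) (hz : M.Regular d z)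
    {R₀ : Matrix (Idx ℓ r) (Idx ℓ r) ℝ} (hR₀ : R₀ ∈ Γ) :
    Continuous (M.logRatio R₀ z : T × Γ → ℝ) := by
  have hargs := hM.continuous_boxArgs hz
  have hc : ∀ f : T × Γ → Γ, Continuous f →
      Continuous fun p : T × Γ => M.copulaPart (f p) (z.2.1 p.1, z.1) := by
    intro f hf
    refine (h.continuousOn_boxIntegral hΓ).comp_continuous
      ((continuous_subtype_val.comp hf).prodMk (hargs.comp continuous_fst)) fun p => ?_
    obtain ⟨h1, h2, h3⟩ := hM.boxArgs_mem hz p.1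
    exact ⟨(f p).2, h1, h2, h3⟩
  refine Continuous.sub ?_ ?_
  · exact (hc Prod.snd continuous_snd).log fun p => (hM.copulaPart_pos h hd hz p.2.2 p.1).ne'
  · exact (hc (fun _ => ⟨R₀, hR₀⟩) continuous_const).log
      fun p => (hM.copulaPart_pos h hd hz hR₀ p.1).ne'

lemma Valid.exists_enorm_logRatio_le (hM : M.Valid) (h : RatioBounds Γ C η) (hd : DenseRange d)
    {R₀ : Matrix (Idx ℓ r) (Idx ℓ r) ℝ} (hR₀ : R₀ ∈ Γ) :
    ∃ K : ℝ, ∀ z : (Idx ℓ r → ℝ) × (T → Idx ℓ r → ℝ) × E, M.Regular d z →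
      ∀ p : T × Γ, ‖M.logRatio R₀ z p‖ₑ ≤ ENNReal.ofReal K * (1 + M.envelope d z) := by
  obtain ⟨K, hK0, hK⟩ := h.exists_abs_log_boxIntegral_le
  refine ⟨2 * K, fun z hz p => ?_⟩
  have hb : ∀ R ∈ Γ, |Real.log (M.copulaPart R (z.2.1 p.1, z.1))| ≤
      K * (1 + (M.envelope d z).toReal) := by
    intro R hR
    obtain ⟨h1, h2, h3⟩ := hM.boxArgs_mem hz p.1
    have hle := hM.penalty_le hd hz p.1
    have hfin := (hle.trans_lt hz.finite.lt_top).ne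
    refine (hK R hR _ _ _ h1 h2 h3 (lt_of_penalty_ne_top hfin)).trans ?_
    rw [add_assoc, ← toReal_penalty hfin h1 h2 h3]
    have := ENNReal.toReal_mono hz.finite hle
    gcongr
  have habs : |M.logRatio R₀ z p| ≤ 2 * K * (1 + (M.envelope d z).toReal) := by
    refine (abs_sub _ _).trans ?_
    linarith [hb p.2 p.2.2, hb R₀ hR₀]
  rw [Real.enorm_eq_ofReal_abs]
  refine (ENNReal.ofReal_le_ofReal habs).trans (le_of_eq ?_)
  rw [ENNReal.ofReal_mul (by positivity), ENNReal.ofReal_add zero_le_one ENNReal.toReal_nonneg,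
    ENNReal.ofReal_one, ENNReal.ofReal_toReal hz.finite]

end Margins

/-- If `f` has nonnegative mean and `exp f` has mean at most one, then `f` vanishes. -/
lemma ae_eq_zero_of_lintegral_exp_le_one {Ω : Type*} [MeasurableSpace Ω] {P : Measure Ω}
    [IsProbabilityMeasure P] {f : Ω → ℝ} (hf : Integrable f P)
    (hexp : ∫⁻ ω, ENNReal.ofReal (Real.exp (f ω)) ∂P ≤ 1) (hpos : 0 ≤ ∫ ω, f ω ∂P) :
    f =ᵐ[P] 0 := by
  have hm : AEStronglyMeasurable (fun ω => Real.exp (f ω)) P :=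
    Real.continuous_exp.comp_aestronglyMeasurable hf.1
  have hei : Integrable (fun ω => Real.exp (f ω)) P := by
    refine ⟨hm, ?_⟩
    rw [hasFiniteIntegral_iff_ofReal (ae_of_all _ fun ω => Real.exp_nonneg _)]
    exact hexp.trans_lt ENNReal.one_lt_top
  have he1 : ∫ ω, Real.exp (f ω) ∂P ≤ 1 := by
    rw [integral_eq_lintegral_of_nonneg_ae (ae_of_all _ fun ω => Real.exp_nonneg _) hm]
    exact ENNReal.toReal_le_of_le_ofReal zero_le_one (by simpa using hexp)
  -- This nonnegative function has integral at most 0, and it vanishes only where `f` does.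
  have hnn : ∀ ω, 0 ≤ Real.exp (f ω) - 1 - f ω := fun ω => by linarith [Real.add_one_le_exp (f ω)]
  have hei1 : Integrable (fun ω => Real.exp (f ω) - 1) P := hei.sub (integrable_const 1)
  have hgi : Integrable (fun ω => Real.exp (f ω) - 1 - f ω) P := hei1.sub hf
  have hint : ∫ ω, (Real.exp (f ω) - 1 - f ω) ∂P = 0 := by
    refine le_antisymm ?_ (integral_nonneg hnn)
    rw [integral_sub hei1 hf, integral_sub hei (integrable_const 1),
      integral_const]
    simp only [probReal_univ, smul_eq_mul, one_mul]
    linarith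
  filter_upwards [(integral_eq_zero_iff_of_nonneg hnn hgi).1 hint] with ω hω
  by_contra h0
  have h1 := Real.add_one_lt_exp (show f ω ≠ 0 from h0)
  have h2 : Real.exp (f ω) - 1 - f ω = 0 := hω
  linarith

lemma past_le {Ω A B : Type*} [mΩ : MeasurableSpace Ω] [MeasurableSpace A] [MeasurableSpace B]
    {U : ℤ → Ω → A} {X : ℤ → Ω → B} (h : ∀ t, Measurable fun ω => (U t ω, X t ω)) (t : ℤ) :
    past U X t ≤ mΩ :=
  iSup_le fun s => iSup_le fun _ => (h s).comap_le

/-! ### Almost sure and mean properties of the likelihood ratio under the model -/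

namespace IsModel

variable {Ω : Type*} [MeasurableSpace Ω] {P : Measure Ω} {ℓ r m Q : ℕ}
  {M : Margins ℓ r}
  {g : EuclideanSpace ℝ (Fin Q) → (Idx ℓ r → ℝ) → (Idx ℓ r → ℝ) → (Fin m → ℝ) → (Idx ℓ r → ℝ)}
  {Θ : Set (EuclideanSpace ℝ (Fin Q))} {θ₀ : EuclideanSpace ℝ (Fin Q)}
  {R₀ : Matrix (Idx ℓ r) (Idx ℓ r) ℝ}
  {U : ℤ → Ω → (Idx ℓ r → ℝ)} {X : ℤ → Ω → (Fin m → ℝ)} {Y : ℤ → Ω → (Idx ℓ r → ℝ)}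
  {lam : ℤ → EuclideanSpace ℝ (Fin Q) → Ω → (Idx ℓ r → ℝ)}
  {Γ : Set (Matrix (Idx ℓ r) (Idx ℓ r) ℝ)} {C η : ℝ}

lemma measurable_U (h : IsModel P M g Θ θ₀ R₀ U X Y lam) (t : ℤ) : Measurable (U t) :=
  measurable_fst.comp (h.noise_ergodic.1 t)

lemma measurable_lam (h : IsModel P M g Θ θ₀ R₀ U X Y lam) (t : ℤ) : Measurable (lam t θ₀) :=
  (h.adapted t).mono (past_le h.noise_ergodic.1 _) le_rfl

lemma indepFun (h : IsModel P M g Θ θ₀ R₀ U X Y lam) (t : ℤ) :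
    IndepFun (lam t θ₀) (U t) P :=
  indep_of_indep_of_le_left (h.noise_indep t).symm (h.adapted t).comap_le

lemma ae_U_mem (h : IsModel P M g Θ θ₀ R₀ U X Y lam) (t : ℤ) :
    ∀ᵐ ω ∂P, ∀ i, U t ω i ∈ Ioo (0 : ℝ) 1 := by
  have := ae_gaussianCopula_mem_Ioo R₀
  rw [← h.noise_law t] at this
  exact ae_of_ae_map (h.measurable_U t).aemeasurable this

lemma ae_eq_obs (h : IsModel P M g Θ θ₀ R₀ U X Y lam) (hθ₀ : θ₀ ∈ Θ) (t : ℤ) :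
    ∀ᵐ ω ∂P, Y t ω = M.obs (lam t θ₀ ω, U t ω) := by
  filter_upwards [h.observation t, h.lam_mem t, h.ae_U_mem t] with ω h1 h2 h3
  ext i
  rw [h1 i]
  exact (Margins.quantileExt_of_mem (h2 θ₀ hθ₀ i) (h3 i)).symm

lemma ae_pDisc_zero_mem (h : IsModel P M g Θ θ₀ R₀ U X Y lam) (hM : M.Valid) (hθ₀ : θ₀ ∈ Θ)
    (hG3 : AssumptionG3 P M Θ (Y 0) (lam 0)) :
    ∀ᵐ ω ∂P, ∀ j, M.pDisc j (lam 0 θ₀ ω (Sum.inr j)) 0 ∈ Ioo (0 : ℝ) 1 := by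
  refine ae_all_iff.2 fun j => ?_
  -- The mass at 0 equals the cdf at 0, whose extension is jointly measurable; finiteness almost
  -- everywhere can then be drawn from the finite integral.
  set f : Ω → ℝ := fun ω => M.Fext (Sum.inr j) (lam 0 θ₀ ω (Sum.inr j), 0) with hf
  have hfm : Measurable f := (hM.measurable_Fext _).comp
    (((measurable_pi_apply _).comp (h.measurable_lam 0)).prodMk measurable_const)
  have hfp : ∀ᵐ ω ∂P, f ω = M.pDisc j (lam 0 θ₀ ω (Sum.inr j)) 0 := by
    filter_upwards [h.lam_mem 0] with ω hω
    rw [hM.pDisc_zero j (hω θ₀ hθ₀ _)]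
    exact Margins.Fext_of_mem (hω θ₀ hθ₀ _) _
  have hsum : Measurable fun ω => negLog (f ω) + negLog (1 - f ω) :=
    (lowerSemicontinuous_negLog.measurable.comp hfm).add
      (lowerSemicontinuous_negLog.measurable.comp (hfm.const_sub 1))
  have hlt : ∫⁻ ω, (negLog (f ω) + negLog (1 - f ω)) ∂P < ⊤ := by
    refine lt_of_le_of_lt (lintegral_mono_ae ?_) (hG3 j).1
    filter_upwards [hfp] with ω hω
    rw [hω]
    exact add_le_add
      (le_iSup₂ (f := fun θ (_ : θ ∈ Θ) => negLog (M.pDisc j (lam 0 θ ω (Sum.inr j)) 0)) θ₀ hθ₀)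
      (le_iSup₂ (f := fun θ (_ : θ ∈ Θ) => negLog (1 - M.pDisc j (lam 0 θ ω (Sum.inr j)) 0))
        θ₀ hθ₀)
  filter_upwards [ae_lt_top hsum hlt.ne, hfp] with ω h1 h2
  obtain ⟨h3, h4⟩ := ENNReal.add_ne_top.1 h1.ne
  rw [← h2]
  exact ⟨pos_of_negLog_ne_top h3, by linarith [pos_of_negLog_ne_top h4]⟩

/-- The supremum of the penalty is at most the sum of the suprema of its terms. Those of the
continuous components are bounded by (G2), and F_j(y) - F_j(y⁻) = p_j(y) reduces the others to (G3).
-/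
lemma lintegral_envelope_lt_top (h : IsModel P M g Θ θ₀ R₀ U X Y lam) (hM : M.Valid)
    (hG2 : AssumptionG2 P M Θ (Y 0) (lam 0)) (hG3 : AssumptionG3 P M Θ (Y 0) (lam 0))
    (d : ℕ → Θ) :
    ∫⁻ ω, M.envelope d (Y 0 ω, fun θ : Θ => lam 0 θ ω, X 0 ω) ∂P < ⊤ := by
  have hargs : ∀ n, Measurable fun ω => M.boxArgs (lam 0 (d n) ω, Y 0 ω) := fun n =>
    (hM.measurable_args (d n)).comp (h.solution_ergodic.1 0)
  have hmem : ∀ᵐ ω ∂P, ∀ n, M.boxArgs (lam 0 (d n) ω, Y 0 ω) =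
      (fun i => M.F (Sum.inl i) (lam 0 (d n) ω (Sum.inl i)) (Y 0 ω (Sum.inl i)),
      fun j => M.FLeft (Sum.inr j) (lam 0 (d n) ω (Sum.inr j)) (Y 0 ω (Sum.inr j)),
      fun j => M.F (Sum.inr j) (lam 0 (d n) ω (Sum.inr j)) (Y 0 ω (Sum.inr j))) := by
    filter_upwards [h.lam_mem 0] with ω hω n
    exact hM.boxArgs_eq (hω (d n) (d n).2) _
  set A : Fin ℓ → Ω → ℝ≥0∞ := fun i ω =>
    ⨆ n, negLog ((M.boxArgs (lam 0 (d n) ω, Y 0 ω)).1 i) with hA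
  set B : Fin ℓ → Ω → ℝ≥0∞ := fun i ω =>
    ⨆ n, negLog (1 - (M.boxArgs (lam 0 (d n) ω, Y 0 ω)).1 i) with hB
  set D : Fin r → Ω → ℝ≥0∞ := fun j ω => ⨆ n, negLog
    ((M.boxArgs (lam 0 (d n) ω, Y 0 ω)).2.2 j - (M.boxArgs (lam 0 (d n) ω, Y 0 ω)).2.1 j) with hD
  have hneg := lowerSemicontinuous_negLog.measurable
  have hAm : ∀ i, Measurable (A i) := fun i => Measurable.iSup fun n =>
    hneg.comp ((measurable_pi_apply i).comp (measurable_fst.comp (hargs n)))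
  have hBm : ∀ i, Measurable (B i) := fun i => Measurable.iSup fun n =>
    hneg.comp (((measurable_pi_apply i).comp (measurable_fst.comp (hargs n))).const_sub 1)
  have hDm : ∀ j, Measurable (D j) := fun j => Measurable.iSup fun n =>
    hneg.comp (((measurable_pi_apply j).comp (measurable_snd.comp
      (measurable_snd.comp (hargs n)))).sub
      ((measurable_pi_apply j).comp (measurable_fst.comp (measurable_snd.comp (hargs n)))))
  have hABm : ∀ i, Measurable fun ω => A i ω + B i ω := fun i => (hAm i).add (hBm i)
  have hABi : ∀ i, ∫⁻ ω, (A i ω + B i ω) ∂P < ⊤ := by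
    intro i
    refine lt_of_le_of_lt (lintegral_mono_ae ?_) (hG2 i)
    filter_upwards [hmem] with ω hω
    refine add_le_add (iSup_le fun n => ?_) (iSup_le fun n => ?_)
    · rw [hω n]
      exact le_iSup₂ (f := fun θ (_ : θ ∈ Θ) =>
        negLog (M.F (Sum.inl i) (lam 0 θ ω (Sum.inl i)) (Y 0 ω (Sum.inl i)))) (d n).1 (d n).2
    · rw [hω n]
      exact le_iSup₂ (f := fun θ (_ : θ ∈ Θ) =>
        negLog (1 - M.F (Sum.inl i) (lam 0 θ ω (Sum.inl i)) (Y 0 ω (Sum.inl i)))) (d n).1 (d n).2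
  have hDi : ∀ j, ∫⁻ ω, D j ω ∂P < ⊤ := by
    intro j
    refine lt_of_le_of_lt (lintegral_mono_ae ?_) (hG3 j).2.1
    filter_upwards [hmem, h.lam_mem 0] with ω hω hω'
    refine iSup_le fun n => ?_
    rw [hω n]
    simp only
    rw [← hM.pDisc_eq j (hω' (d n) (d n).2 _)]
    exact le_iSup₂ (f := fun θ (_ : θ ∈ Θ) =>
      negLog (M.pDisc j (lam 0 θ ω (Sum.inr j)) (Y 0 ω (Sum.inr j)))) (d n).1 (d n).2
  have hle : ∀ ω, M.envelope d (Y 0 ω, fun θ : Θ => lam 0 θ ω, X 0 ω) ≤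
      ∑ i, (A i ω + B i ω) + ∑ j, D j ω := by
    intro ω
    refine iSup_le fun n => add_le_add ?_ ?_
    · exact Finset.sum_le_sum fun i _ => add_le_add
        (le_iSup (fun n => negLog ((M.boxArgs (lam 0 (d n) ω, Y 0 ω)).1 i)) n)
        (le_iSup (fun n => negLog (1 - (M.boxArgs (lam 0 (d n) ω, Y 0 ω)).1 i)) n)
    · exact Finset.sum_le_sum fun j _ =>
        le_iSup (fun n => negLog ((M.boxArgs (lam 0 (d n) ω, Y 0 ω)).2.2 j -
          (M.boxArgs (lam 0 (d n) ω, Y 0 ω)).2.1 j)) n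
  refine (lintegral_mono hle).trans_lt ?_
  rw [lintegral_add_right _ (Finset.measurable_fun_sum _ fun j _ => hDm j),
    lintegral_finsetSum _ fun i _ => hABm i, lintegral_finsetSum _ fun j _ => hDm j]
  exact ENNReal.add_lt_top.2 ⟨ENNReal.sum_lt_top.2 fun i _ => hABi i,
    ENNReal.sum_lt_top.2 fun j _ => hDi j⟩

/-- Integrability gives a finite envelope at time 0 only; stationarity carries it to every `t`
because the envelope is a measurable function of the state. -/
lemma ae_regular (h : IsModel P M g Θ θ₀ R₀ U X Y lam) (hM : M.Valid)
    (hG2 : AssumptionG2 P M Θ (Y 0) (lam 0)) (hG3 : AssumptionG3 P M Θ (Y 0) (lam 0))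
    (d : ℕ → Θ) (t : ℤ) :
    ∀ᵐ ω ∂P, M.Regular d (Y t ω, fun θ : Θ => lam t θ ω, X t ω) := by
  have henv := hM.measurable_envelope (E := Fin m → ℝ) d
  have h0 : ∀ᵐ ω ∂P, M.envelope d (Y 0 ω, fun θ : Θ => lam 0 θ ω, X 0 ω) ≠ ⊤ :=
    (ae_lt_top (henv.comp (h.solution_ergodic.1 0))
      (h.lintegral_envelope_lt_top hM hG2 hG3 d).ne).mono fun ω hω => hω.ne
  have ht := h.solution_ergodic.ae_of_ae_zero
    (p := fun z => M.envelope d z ≠ ⊤) (henv (measurableSet_singleton ⊤)).compl h0 t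
  filter_upwards [ht, h.lam_mem t, h.continuousOn_lam t] with ω h1 h2 h3
  exact ⟨fun θ i => h2 θ θ.2 i, continuousOn_iff_continuous_domRestrict.1 h3, h1⟩

variable [IsProbabilityMeasure P]

lemma map_prod_eq (h : IsModel P M g Θ θ₀ R₀ U X Y lam) (t : ℤ) :
    P.map (fun ω => (lam t θ₀ ω, U t ω)) = (P.map (lam t θ₀)).prod (gaussianCopula R₀) := by
  rw [(indepFun_iff_map_prod_eq_prod_map_map (h.measurable_lam t).aemeasurable
    (h.measurable_U t).aemeasurable).1 (h.indepFun t), h.noise_law t]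

/-- The conditional likelihood ratio has mean one. -/
lemma lintegral_ratio (h : IsModel P M g Θ θ₀ R₀ U X Y lam) (hM : M.Valid) (hθ₀ : θ₀ ∈ Θ)
    (hb : RatioBounds Γ C η) (hΓ : ∀ R ∈ Γ, IsCorrelation R) (hR₀ : R₀ ∈ Γ) {R} (hR : R ∈ Γ) :
    ∫⁻ ω, ENNReal.ofReal (M.copulaPart R (lam 0 θ₀ ω, Y 0 ω) /
      M.copulaPart R₀ (lam 0 θ₀ ω, Y 0 ω)) ∂P = 1 := by
  have := isProbabilityMeasure_gaussianCopula (hΓ R₀ hR₀)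
  have := Measure.isProbabilityMeasure_map (μ := P) (h.measurable_lam 0).aemeasurable
  have hobs : Measurable fun p : (Idx ℓ r → ℝ) × (Idx ℓ r → ℝ) => (p.1, M.obs p) :=
    measurable_fst.prodMk hM.measurable_obs
  have hm : Measurable fun p : (Idx ℓ r → ℝ) × (Idx ℓ r → ℝ) => ENNReal.ofReal
      (M.copulaPart R (p.1, M.obs p) / M.copulaPart R₀ (p.1, M.obs p)) :=
    (((hM.measurable_copulaPart R).comp hobs).div
      ((hM.measurable_copulaPart R₀).comp hobs)).ennreal_ofReal
  have hpair : Measurable fun ω => (lam 0 θ₀ ω, U 0 ω) :=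
    (h.measurable_lam 0).prodMk (h.measurable_U 0)
  calc _ = ∫⁻ ω, ENNReal.ofReal (M.copulaPart R (lam 0 θ₀ ω, M.obs (lam 0 θ₀ ω, U 0 ω)) /
      M.copulaPart R₀ (lam 0 θ₀ ω, M.obs (lam 0 θ₀ ω, U 0 ω))) ∂P := by
        refine lintegral_congr_ae ?_
        filter_upwards [h.ae_eq_obs hθ₀ 0] with ω hω
        rw [hω]
    _ = ∫⁻ s, ∫⁻ u, ENNReal.ofReal (M.copulaPart R (s, M.obs (s, u)) /
          M.copulaPart R₀ (s, M.obs (s, u))) ∂gaussianCopula R₀ ∂(P.map (lam 0 θ₀)) := by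
        rw [← lintegral_prod _ hm.aemeasurable, ← h.map_prod_eq 0, lintegral_map hm hpair]
    _ = ∫⁻ _s, 1 ∂(P.map (lam 0 θ₀)) := by
        refine lintegral_congr_ae ?_
        have hGm : MeasurableSet {s : Idx ℓ r → ℝ | ∀ i, s i ∈ M.G i} := by
          rw [ofPred_forall]
          exact MeasurableSet.iInter fun i => measurable_pi_apply i (hM.measurableSet_G i)
        have hG : ∀ᵐ s ∂(P.map (lam 0 θ₀)), ∀ i, s i ∈ M.G i :=
          (ae_map_iff (h.measurable_lam 0).aemeasurable hGm).2
            ((h.lam_mem 0).mono fun ω hω => hω θ₀ hθ₀)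
        filter_upwards [hG] with s hs
        exact hM.lintegral_ratio hb hΓ hR₀ hR hs
    _ = 1 := by simp

/-- If the conditional likelihood ratio is constant, then the copulas are equal. -/
lemma eq_of_ratio_eq_one (h : IsModel P M g Θ θ₀ R₀ U X Y lam) (hM : M.Valid) (hθ₀ : θ₀ ∈ Θ)
    (hb : RatioBounds Γ C η) (hΓ : ∀ R ∈ Γ, IsCorrelation R) (hR₀ : R₀ ∈ Γ) {R} (hR : R ∈ Γ)
    (hp : ∀ᵐ ω ∂P, ∀ j, M.pDisc j (lam 0 θ₀ ω (Sum.inr j)) 0 ∈ Ioo (0 : ℝ) 1)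
    (hone : ∀ᵐ ω ∂P, M.copulaPart R (lam 0 θ₀ ω, Y 0 ω) /
      M.copulaPart R₀ (lam 0 θ₀ ω, Y 0 ω) = 1) : R = R₀ := by
  have := isProbabilityMeasure_gaussianCopula (hΓ R₀ hR₀)
  have hobs : Measurable fun p : (Idx ℓ r → ℝ) × (Idx ℓ r → ℝ) => (p.1, M.obs p) :=
    measurable_fst.prodMk hM.measurable_obs
  have hm : Measurable fun p : (Idx ℓ r → ℝ) × (Idx ℓ r → ℝ) =>
      M.copulaPart R (p.1, M.obs p) / M.copulaPart R₀ (p.1, M.obs p) :=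
    ((hM.measurable_copulaPart R).comp hobs).div ((hM.measurable_copulaPart R₀).comp hobs)
  have hpair : Measurable fun ω => (lam 0 θ₀ ω, U 0 ω) :=
    (h.measurable_lam 0).prodMk (h.measurable_U 0)
  have hset : MeasurableSet {p : (Idx ℓ r → ℝ) × (Idx ℓ r → ℝ) |
      M.copulaPart R (p.1, M.obs p) / M.copulaPart R₀ (p.1, M.obs p) = 1} :=
    hm (measurableSet_singleton 1)
  have h1 : ∀ᵐ p ∂((P.map (lam 0 θ₀)).prod (gaussianCopula R₀)),
      M.copulaPart R (p.1, M.obs p) / M.copulaPart R₀ (p.1, M.obs p) = 1 := by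
    rw [← h.map_prod_eq 0, ae_map_iff hpair.aemeasurable hset]
    filter_upwards [hone, h.ae_eq_obs hθ₀ 0] with ω h1 h2
    rw [← h2]
    exact h1
  have h2 := ae_of_ae_map (h.measurable_lam 0).aemeasurable (Measure.ae_ae_of_ae_prod h1)
  -- By Fubini a single parameter value λ₀(θ₀) makes the ratio one for almost every `u`, and
  -- identification at that value suffices.
  obtain ⟨ω, hω1, hω2, hω3⟩ := (h2.and (hp.and (h.lam_mem 0))).exists
  exact hM.eq_of_ratio_eq_one hb hΓ hR₀ hR (hω3 θ₀ hθ₀) hω2 hω1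

/-- The exponential of the log-ratio has mean one, so a nonnegative mean would force the ratio to be
one almost surely, and identification would give `R = R₀`. -/
lemma integral_logRatio_neg (h : IsModel P M g Θ θ₀ R₀ U X Y lam) (hM : M.Valid)
    (hθ₀ : θ₀ ∈ Θ) (hb : RatioBounds Γ C η) (hΓ : ∀ R ∈ Γ, IsCorrelation R) (hR₀ : R₀ ∈ Γ)
    (hG2 : AssumptionG2 P M Θ (Y 0) (lam 0)) (hG3 : AssumptionG3 P M Θ (Y 0) (lam 0))
    {R} (hR : R ∈ Γ) (hne : R ≠ R₀) :
    ∫ ω, M.logRatio (Γ := Γ) R₀ (Y 0 ω, fun θ : Θ => lam 0 θ ω, X 0 ω)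
      (⟨θ₀, hθ₀⟩, ⟨R, hR⟩) ∂P < 0 := by
  have : Nonempty Θ := ⟨⟨θ₀, hθ₀⟩⟩
  set d := TopologicalSpace.denseSeq Θ
  have hd : DenseRange d := TopologicalSpace.denseRange_denseSeq Θ
  have hreg := h.ae_regular hM hG2 hG3 d 0
  obtain ⟨K, hK⟩ := hM.exists_enorm_logRatio_le (E := Fin m → ℝ) hb hd hR₀
  set f : Ω → ℝ := fun ω => M.logRatio (Γ := Γ) R₀ (Y 0 ω, fun θ : Θ => lam 0 θ ω, X 0 ω)
      (⟨θ₀, hθ₀⟩, ⟨R, hR⟩) with hf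
  have hfin : ∫⁻ ω, ENNReal.ofReal K *
      (1 + M.envelope d (Y 0 ω, fun θ : Θ => lam 0 θ ω, X 0 ω)) ∂P < ⊤ := by
    rw [lintegral_const_mul' _ _ ENNReal.ofReal_ne_top, lintegral_add_left measurable_const]
    refine ENNReal.mul_lt_top ENNReal.ofReal_lt_top (ENNReal.add_lt_top.2 ⟨by simp, ?_⟩)
    exact h.lintegral_envelope_lt_top hM hG2 hG3 d
  have hfi : Integrable f P := by
    refine ⟨((hM.measurable_logRatio R₀ _).comp
      (h.solution_ergodic.1 0)).aestronglyMeasurable, ?_⟩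
    exact (lintegral_mono_ae (hreg.mono fun ω hω => hK _ hω _)).trans_lt hfin
  have hexp : ∀ᵐ ω ∂P, Real.exp (f ω) = M.copulaPart R (lam 0 θ₀ ω, Y 0 ω) /
      M.copulaPart R₀ (lam 0 θ₀ ω, Y 0 ω) := by
    filter_upwards [hreg] with ω hω
    have h1 := hM.copulaPart_pos hb hd hω hR ⟨θ₀, hθ₀⟩
    have h2 := hM.copulaPart_pos hb hd hω hR₀ ⟨θ₀, hθ₀⟩
    simp only [hf, Margins.logRatio]
    rw [Real.exp_sub, Real.exp_log h1, Real.exp_log h2]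
  by_contra! hpos
  have hzero : f =ᵐ[P] 0 := by
    refine ae_eq_zero_of_lintegral_exp_le_one hfi (le_of_eq ?_) hpos
    rw [← h.lintegral_ratio hM hθ₀ hb hΓ hR₀ hR]
    exact lintegral_congr_ae (hexp.mono fun ω hω => by simp only [hω])
  refine hne (h.eq_of_ratio_eq_one hM hθ₀ hb hΓ hR₀ hR (h.ae_pDisc_zero_mem hM hθ₀ hG3) ?_)
  filter_upwards [hexp, hzero] with ω h1 h2
  rw [← h1, h2, Pi.zero_apply, Real.exp_zero]

end IsModel

/-- The difference of two average log-likelihoods is the average of the log-likelihood ratio. -/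
lemma Margins.Valid.sum_logRatio_nonneg {ℓ r m Q : ℕ} {M : Margins ℓ r} (hM : M.Valid)
    {Θ : Set (EuclideanSpace ℝ (Fin Q))} {Γ : Set (Matrix (Idx ℓ r) (Idx ℓ r) ℝ)} {C η : ℝ}
    (hb : RatioBounds Γ C η) {d : ℕ → Θ} (hd : DenseRange d) {y : ℤ → (Idx ℓ r → ℝ)}
    {lam : ℤ → EuclideanSpace ℝ (Fin Q) → (Idx ℓ r → ℝ)} {x : ℤ → (Fin m → ℝ)}
    (hreg : ∀ t, M.Regular d (y t, fun θ : Θ => lam t θ, x t))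
    {R₀ : Matrix (Idx ℓ r) (Idx ℓ r) ℝ} (hR₀ : R₀ ∈ Γ) (p : Θ × Γ) {n : ℕ} (hn : 1 ≤ n)
    (hmax : avgLogLik M y lam n p.1 R₀ ≤ avgLogLik M y lam n p.1 p.2) :
    0 ≤ ∑ t ∈ Finset.Icc 1 n,
      M.logRatio R₀ (y (t : ℤ), fun θ : Θ => lam (t : ℤ) θ, x (t : ℤ)) p := by
  have hlog : ∀ (t : ℤ), ∀ R ∈ Γ, Real.log (M.jointDensity R (lam t p.1) (y t)) =
      Real.log (∏ i : Fin ℓ, M.pCont i (lam t p.1 (Sum.inl i)) (y t (Sum.inl i))) +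
        Real.log (M.copulaPart R (lam t p.1, y t)) := by
    intro t R hR
    rw [hM.jointDensity_eq R ((hreg t).mem p.1), Real.log_mul]
    · exact Finset.prod_ne_zero_iff.2 fun i _ =>
        (hM.pCont_pos i _ ((hreg t).mem p.1 (Sum.inl i)) _).ne'
    · exact (hM.copulaPart_pos hb hd (hreg t) hR p.1).ne'
  have hn' : (0 : ℝ) < (n : ℝ)⁻¹ := inv_pos.2 (by exact_mod_cast hn)
  have h1 := le_of_mul_le_mul_left hmax hn'
  rw [← sub_nonneg, ← Finset.sum_sub_distrib] at h1
  refine h1.trans (le_of_eq (Finset.sum_congr rfl fun t _ => ?_))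
  rw [hlog t _ p.2.2, hlog t R₀ hR₀, Margins.logRatio]
  ring

lemma eq_of_mapClusterPt_of_tendsto {ι E : Type*} [TopologicalSpace E] [T2Space E] {l : Filter ι}
    {f : ι → E} {a b : E} (h1 : MapClusterPt a l f) (h2 : Tendsto f l (𝓝 b)) : a = b := by
  have : (𝓝 a ⊓ 𝓝 b).NeBot := Filter.NeBot.mono h1 (inf_le_inf_left _ h2)
  exact eq_of_nhds_neBot this

end MixedCopula

/-! ### Consistency of the copula estimator -/

theorem mainTheorem1 {Ω : Type*} [MeasurableSpace Ω] (P : Measure Ω) [IsProbabilityMeasure P]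
    {ℓ r m Q : ℕ} (M : Margins ℓ r) (hM : M.Valid)
    (g : EuclideanSpace ℝ (Fin Q) → (Idx ℓ r → ℝ) → (Idx ℓ r → ℝ) → (Fin m → ℝ) →
      (Idx ℓ r → ℝ))
    (Θ : Set (EuclideanSpace ℝ (Fin Q))) (hΘ : IsCompact Θ)
    (Γ : Set (Matrix (Idx ℓ r) (Idx ℓ r) ℝ)) (hΓ : IsCompact Γ)
    (hΓcorr : ∀ R ∈ Γ, IsCorrelation R)
    (θ₀ : EuclideanSpace ℝ (Fin Q)) (hθ₀ : θ₀ ∈ Θ)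
    (R₀ : Matrix (Idx ℓ r) (Idx ℓ r) ℝ) (hR₀ : R₀ ∈ Γ)
    (U : ℤ → Ω → (Idx ℓ r → ℝ)) (X : ℤ → Ω → (Fin m → ℝ)) (Y : ℤ → Ω → (Idx ℓ r → ℝ))
    (lam : ℤ → EuclideanSpace ℝ (Fin Q) → Ω → (Idx ℓ r → ℝ))
    (hmodel : IsModel P M g Θ θ₀ R₀ U X Y lam)
    (hG1 : AssumptionG1 M)
    (hG2 : AssumptionG2 P M Θ (Y 0) (lam 0))
    (hG3 : AssumptionG3 P M Θ (Y 0) (lam 0))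
    (θhat : ℕ → Ω → EuclideanSpace ℝ (Fin Q))
    (hθhat_mem : ∀ᵐ ω ∂P, ∀ n, θhat n ω ∈ Θ)
    (hθhat : ∀ᵐ ω ∂P, Tendsto (fun n => θhat n ω) atTop (𝓝 θ₀))
    (Rhat : ℕ → Ω → Matrix (Idx ℓ r) (Idx ℓ r) ℝ)
    (hRhat : ∀ᵐ ω ∂P, ∀ n, 1 ≤ n → Rhat n ω ∈ Γ ∧
      IsMaxOn (fun R => avgLogLik M (fun t => Y t ω) (fun t θ => lam t θ ω) n (θhat n ω) R) Γ
        (Rhat n ω)) :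
    ∀ᵐ ω ∂P, Tendsto (fun n => Rhat n ω) atTop (𝓝 R₀) := by
  classical
  have : CompactSpace Θ := isCompact_iff_compactSpace.1 hΘ
  have : CompactSpace Γ := isCompact_iff_compactSpace.1 hΓ
  have : SecondCountableTopology (Matrix (Idx ℓ r) (Idx ℓ r) ℝ) :=
    inferInstanceAs (SecondCountableTopology (Idx ℓ r → Idx ℓ r → ℝ))
  have : Nonempty Θ := ⟨⟨θ₀, hθ₀⟩⟩
  obtain ⟨C, η, hb⟩ := exists_ratioBounds hΓ hΓcorr
  set d := TopologicalSpace.denseSeq Θ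
  have hd : DenseRange d := TopologicalSpace.denseRange_denseSeq Θ
  have hreg := fun t => hmodel.ae_regular hM hG2 hG3 d t
  obtain ⟨K, hK⟩ := hM.exists_enorm_logRatio_le (E := Fin m → ℝ) hb hd hR₀
  -- Both estimators are viewed as one sequence in the compact space `Θ × Γ`. Almost surely the
  -- default value can occur only at `n = 0`.
  set p : ℕ → Ω → Θ × Γ := fun n ω =>
    if h : θhat n ω ∈ Θ ∧ Rhat n ω ∈ Γ then (⟨θhat n ω, h.1⟩, ⟨Rhat n ω, h.2⟩)
    else (⟨θ₀, hθ₀⟩, ⟨R₀, hR₀⟩) with hp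
  have hfin : ∫⁻ ω, ENNReal.ofReal K *
      (1 + M.envelope d (Y 0 ω, fun θ : Θ => lam 0 θ ω, X 0 ω)) ∂P < ⊤ := by
    rw [lintegral_const_mul' _ _ ENNReal.ofReal_ne_top, lintegral_add_left measurable_const]
    refine ENNReal.mul_lt_top ENNReal.ofReal_lt_top (ENNReal.add_lt_top.2 ⟨by simp, ?_⟩)
    exact hmodel.lintegral_envelope_lt_top hM hG2 hG3 d
  have hsum : ∀ᵐ ω ∂P, ∀ n : ℕ, 1 ≤ n → 0 ≤ ∑ t ∈ Finset.Icc 1 n, M.logRatio R₀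
      (Y (t : ℤ) ω, fun θ : Θ => lam (t : ℤ) θ ω, X (t : ℤ) ω) (p n ω) := by
    filter_upwards [ae_all_iff.2 hreg, hθhat_mem, hRhat] with ω h1 h2 h3 n hn
    have hpn : p n ω = (⟨θhat n ω, h2 n⟩, ⟨Rhat n ω, (h3 n hn).1⟩) :=
      dif_pos ⟨h2 n, (h3 n hn).1⟩
    have hmax : avgLogLik M (fun t => Y t ω) (fun t θ => lam t θ ω) n (θhat n ω) R₀ ≤
        avgLogLik M (fun t => Y t ω) (fun t θ => lam t θ ω) n (θhat n ω) (Rhat n ω) :=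
      (h3 n hn).2 hR₀
    rw [hpn]
    exact hM.sum_logRatio_nonneg (y := fun t => Y t ω) (lam := fun t θ => lam t θ ω)
      (x := fun t => X t ω) hb hd h1 hR₀ (⟨θhat n ω, h2 n⟩, ⟨Rhat n ω, (h3 n hn).1⟩) hn hmax
  have hcluster := ae_mapClusterPt_integral_nonneg
    (q := fun z => M.logRatio (T := Θ) (Γ := Γ) R₀ z) hmodel.solution_ergodic
    (fun c => hM.measurable_logRatio R₀ c)
    (fun t => (hreg t).mono fun ω hω => hM.continuous_logRatio hb hΓcorr hd hω hR₀)
    ((hreg 0).mono fun ω hω c => hK _ hω c) hfin hsum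
  filter_upwards [hcluster, hθhat, hθhat_mem, hRhat] with ω h1 h2 h3 h4
  have hpn : ∀ n, 1 ≤ n → ((p n ω).1 : EuclideanSpace ℝ (Fin Q)) = θhat n ω ∧
      ((p n ω).2 : Matrix (Idx ℓ r) (Idx ℓ r) ℝ) = Rhat n ω := by
    intro n hn
    have : p n ω = (⟨θhat n ω, h3 n⟩, ⟨Rhat n ω, (h4 n hn).1⟩) :=
      dif_pos ⟨h3 n, (h4 n hn).1⟩
    rw [this]
    exact ⟨rfl, rfl⟩
  have hθ : Tendsto (fun n => ((p n ω).1 : EuclideanSpace ℝ (Fin Q))) atTop (𝓝 θ₀) :=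
    h2.congr' ((eventually_ge_atTop 1).mono fun n hn => (hpn n hn).1.symm)
  have hlim : Tendsto (fun n => p n ω) atTop (𝓝 (⟨θ₀, hθ₀⟩, ⟨R₀, hR₀⟩)) := by
    -- In a compact space it is enough that there is a single possible cluster point: `θhat` fixes
    -- its first coordinate, and then the sign of the mean log-ratio fixes the second.
    refine isCompact_univ.tendsto_nhds_of_unique_mapClusterPt (by simp) ?_
    rintro ⟨θ, R⟩ - hc
    have hθeq : (θ : EuclideanSpace ℝ (Fin Q)) = θ₀ := by
      refine eq_of_mapClusterPt_of_tendsto (MapClusterPt.continuousAt_comp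
        (f := fun c : Θ × Γ => (c.1 : EuclideanSpace ℝ (Fin Q))) ?_ hc) hθ
      exact (continuous_subtype_val.comp continuous_fst).continuousAt
    obtain rfl : θ = ⟨θ₀, hθ₀⟩ := Subtype.ext hθeq
    have hReq : (R : Matrix (Idx ℓ r) (Idx ℓ r) ℝ) = R₀ := by
      by_contra hne
      exact absurd (h1 _ hc) (not_le.2
        (hmodel.integral_logRatio_neg hM hθ₀ hb hΓcorr hR₀ hG2 hG3 R.2 hne))
    exact Prod.ext rfl (Subtype.ext hReq)
  have hR : Tendsto (fun n => ((p n ω).2 : Matrix (Idx ℓ r) (Idx ℓ r) ℝ)) atTop (𝓝 R₀) :=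
    ((continuous_subtype_val.comp continuous_snd).tendsto _).comp hlim
  exact hR.congr' ((eventually_ge_atTop 1).mono fun n hn => (hpn n hn).2)
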